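/- **Setting.** Fix a first-order language $L$, infinitely many variables, and a first-order theory $CT$ in $L$ that contains Clark's equality theory for the function symbols of $L$. Built-in constraints are $c ::= d \mid c\wedge c\mid \exists_x c$ with $d$ atomic (equations included); $\mathtt{true}$ is the empty conjunction, $\mathtt{false}$ any constraint inconsistent with $CT$. CHR constraints are $p(t_1,\dots,t_k)$; $h\#i$ is a CHR constraint $h$ with identifier $i\in\mathbb N$, $chr(h\#i)=h$, $id(h\#i)=i$. For sequences of CHR constraints of equal length with pairwise equal predicate symbols and numbers of arguments, $H=H'$ is the conjunction of the equations between corresponding arguments. A token is $r@i_1,\dots,i_l$ with $r$ a rule name. $clean(\tilde B,T)$ is the set of tokens of $T$ all of whose identifiers occur in $\tilde B$. $inst(\tilde B,T,n)=(\tilde B',T',m)$ adds $n$ to every identifier in $\tilde B,T$, and $m$ is the greatest identifier in $(\tilde B',T')$ ($m=n$ if there is none). **Programs.** A CHR program is a finite set of rules $r@H_1\backslash H_2\Leftrightarrow D\mid B$ with pairwise distinct names $r$, heads $H_1,H_2$ sequences of CHR constraints (not both empty), guard $D$ of built-in constraints, body $B$ of built-in and CHR constraints. An annotated program is a set of rules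 $r@H_1\backslash H_2\Leftrightarrow D\mid\tilde B;T$ in which the CHR constraints of the body carry identifiers and $T$ is a set of tokens. $Ann(P)$ numbers the CHR constraints of each body $1,\dots,m$ in order of occurrence and takes $T=\emptyset$. **Semantics.** Configurations of a CHR program are $\langle G,\tilde S,C,T\rangle_n$ ($G$ a goal, $\tilde S$ identified CHR constraints with distinct identifiers, $C$ a built-in constraint, $T$ a set of tokens, all identifiers in $\tilde S,T$ less than $n$). A configuration is *failed*, and then final, if $C$ is inconsistent with $CT$. The transitions from non-failed configurations are: * Solve: $\langle\{c\}\uplus G,\tilde S,C,T\rangle_n\to\langle G,\tilde S,C',T\rangle_n$ for $c$ built-in and $CT\models c\wedge C\leftrightarrow C'$; * Introduce: $\langle\{h\}\uplus G,\tilde S,C,T\rangle_n\to\langle G,\{h\#n\}\cup\tilde S,C,T\rangle_{n+1}$ for $h$ a CHR constraint; * Apply: $\langle G,\tilde H_1\cup\tilde H_2\cup\tilde S,C,T\rangle_n\to\langle B\uplus G,\tilde H_1\cup\tilde S,(chr(\tilde H_1,\tilde H_2)=(H_1',H_2'))\wedge C,T'\rangle_n$, where $r@H_1'\backslash H_2'\Leftrightarrow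 D\mid B$ is a variant of a rule of the program, with variables not occurring in the configuration or in the initial configuration of the computation, $CT\models C\to\exists_x((chr(\tilde H_1,\tilde H_2)=(H_1',H_2'))\wedge D)$ with $x=Fv(H_1',H_2')$, the token $t=r@id(\tilde H_1,\tilde H_2)$ is not in $T$, and $T'=T\cup\{t\}$ if $\tilde H_2=\emptyset$, $T'=T$ otherwise. Configurations of an annotated program are $\langle\tilde S,C,T\rangle_n$, where $\tilde S$ consists of identified CHR constraints with distinct identifiers and of built-in constraints, and all identifiers in $\tilde S,T$ are at most $n$. Failed configurations are as before. The transitions are Solve' (as Solve, on $\tilde S$) and Apply' (same conditions as Apply, with a rule with body $\tilde B$ and token store $T_r$): $$\langle\tilde H_1\cup\tilde H_2\cup\tilde G,C,T\rangle_n\to\langle\tilde B'\cup\tilde H_1\cup\tilde G,(chr(\tilde H_1,\tilde H_2)=(H_1',H_2'))\wedge C,T'\cup T_r'\rangle_m,\qquad (\tilde B',T_r',m)=inst(\tilde B,T_r,n).$$ A configuration is built-in free if it is failed or has no built-in constraints in $G$ (resp. $\tilde S$). A derivation is *normal* if Apply (Apply') is used only on built-in free configurations. A program is *normal terminating* if it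 has no infinite normal computation. $\sigma_1\simeq'_V\sigma_2$ means that both are failed, or that they are identical up to renaming of variables not in $V$, renaming of identifiers, logical equivalence of built-in constraints, and deletion of the tokens having an identifier that does not occur among the identified CHR constraints. A program is *normal confluent* if for all normal derivations $\sigma\to^*\sigma_1$, $\sigma\to^*\sigma_2$ there are derivations $\sigma_1\to^*\sigma_1'$, $\sigma_2\to^*\sigma_2'$ with $\sigma_1'\simeq'_{Fv(\sigma)}\sigma_2'$. **Unfolding.** Let $r@H_1\backslash H_2\Leftrightarrow D\mid\tilde K,\tilde S_1,\tilde S_2,C;T$ ($C$ the built-in constraints of the body) and $v@H_1'\backslash H_2'\Leftrightarrow D'\mid\tilde B;T'$ be in the annotated program $P$, the second renamed apart from the first, and let $\theta$ be a substitution of the variables of $H_1',H_2'$ with $CT\models(C\wedge D)\to chr(\tilde S_1,\tilde S_2)=(H_1',H_2')\theta$. Let $v@id(\tilde S_1,\tilde S_2)\notin T$, let $m$ be the greatest identifier in the first rule, $(\tilde B_1,T_1,m_1)=inst(\tilde B,T',m)$, let $D''$ consist of the $c$ in $D'$ with $CT\not\models C\wedge D\to c\theta$, and let $D\wedge D''\theta$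 be satisfiable. The unfolding is $$r@H_1\backslash H_2\Leftrightarrow D,D''\theta\mid\tilde K,\tilde S_1,\tilde B_1,C,chr(\tilde S_1,\tilde S_2)=(H_1',H_2');T'',$$ where $T''=clean((\tilde K,\tilde S_1),T)\cup T_1$, together with $v@id(\tilde S_1)$ if $H_2'=\emptyset$. Write $\mathbf r$ for the first rule, $\mathrm{Unf}_P(\mathbf r)$ for the set of its unfoldings with rules of $P$, and $U^+_P(\mathbf r)$ for the set of pairs (rule of $P$, sequence $id(\tilde S_1,\tilde S_2)$) for which an unfolding exists. Let $\tilde A$ be the body of $\mathbf r$. $U^\#_P(\mathbf r)$ is the set of rules of $P$ that have a variant $v@H_1'\backslash H_2'\Leftrightarrow D'\mid\tilde B;T'$, renamed apart from $\mathbf r$, and a built-in constraint $C'$ sharing no variable with the variant, with $D\wedge C'$ satisfiable, such that, with $x=Fv(H_1',H_2')$, (a) there are $(\tilde A_1,\tilde A_2)\subseteq\tilde A$ with $CT\models(D\wedge C')\to\exists_x((chr(\tilde A_1,\tilde A_2)=(H_1',H_2'))\wedge D')$ and $v@id(\tilde A_1,\tilde A_2)\notin T$, while the rule together with $id(\tilde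 A_1,\tilde A_2)$ is not in $U^+_P(\mathbf r)$; or (b) there are a nonempty $\tilde A'\subseteq\tilde A$ of identified CHR constraints and a nonempty multiset $H'$ of CHR constraints with $chr(\tilde A')\uplus H'=K_1\uplus K_2$ and $CT\models(D\wedge C')\to\exists_x(((K_1,K_2)=(H_1',H_2'))\wedge D')$. The rule $\mathbf r\in P$ *can be safely replaced* in $P$ if $U^\#_P(\mathbf r)=\emptyset$, $U^+_P(\mathbf r)\ne\emptyset$, and every rule in $\mathrm{Unf}_P(\mathbf r)$ has a guard equivalent to $D$ under $CT$. A *U-sequence* starting from $P_0$ is a sequence $P_0,\dots,P_n$ of annotated programs with $P_{i+1}=(P_i\setminus\{\mathbf r\})\cup\mathrm{Unf}_{P_i}(\mathbf r)$ for some $\mathbf r$ that can be safely replaced in $P_i$, the unfoldings being taken up to renaming of variables (it is enough to take at least one variant of each). **Statement.** Let $P$ be a normal terminating CHR program and $P_0,\dots,P_n$ a U-sequence starting from $Ann(P)$. Then $P$ is normal confluent if and only if $P_n$ is normal confluent. -/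

import Mathlib

universe u v w z

namespace CHR

/-! ### Built-in constraints and their meaning -/

/-- Built-in constraints `c ::= d | c ∧ c | ∃ x, c` over a first-order language `L`, where `d` is
atomic (an equation or a relation symbol applied to terms), with the empty conjunction `true` added.
Free variables are natural numbers; `BuiltIn L n` has `n` further variables that are bound outside. -/
inductive BuiltIn (L : FirstOrder.Language.{u, v}) : ℕ → Type (max u v)
  | tru {n : ℕ} : BuiltIn L n
  | eq {n : ℕ} (s t : L.Term (ℕ ⊕ Fin n)) : BuiltIn L n
  | rel {n l : ℕ} (R : L.Relations l) (ts : Fin l → L.Term (ℕ ⊕ Fin n)) : BuiltIn L n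
  | and {n : ℕ} (c d : BuiltIn L n) : BuiltIn L n
  | ex {n : ℕ} (c : BuiltIn L (n + 1)) : BuiltIn L n

namespace BuiltIn

variable {L : FirstOrder.Language.{u, v}}

/-- Truth of a built-in constraint in a structure, under an assignment of the variables. -/
def RealizeAux {M : Type w} [L.Structure M] (a : ℕ → M) :
    {n : ℕ} → BuiltIn L n → (Fin n → M) → Prop
  | _, tru, _ => True
  | _, eq s t, xs => s.realize (Sum.elim a xs) = t.realize (Sum.elim a xs)
  | _, rel R ts, xs => FirstOrder.Language.Structure.RelMap R fun i => (ts i).realize (Sum.elim a xs)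
  | _, and c d, xs => c.RealizeAux a xs ∧ d.RealizeAux a xs
  | _, ex c, xs => ∃ b : M, c.RealizeAux a (Fin.snoc xs b)

/-- Simultaneous substitution of terms for the free variables inside a term that may also contain
bound variables. -/
def substTerm {n : ℕ} (θ : ℕ → L.Term ℕ) (t : L.Term (ℕ ⊕ Fin n)) : L.Term (ℕ ⊕ Fin n) :=
  t.subst (Sum.elim (fun x => (θ x).relabel Sum.inl) fun i => FirstOrder.Language.Term.var (Sum.inr i))

/-- Capture-avoiding substitution of terms for the free variables of a built-in constraint. -/
def subst (θ : ℕ → L.Term ℕ) : {n : ℕ} → BuiltIn L n → BuiltIn L n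
  | _, tru => tru
  | _, eq s t => eq (substTerm θ s) (substTerm θ t)
  | _, rel R ts => rel R fun i => substTerm θ (ts i)
  | _, and c d => and (c.subst θ) (d.subst θ)
  | _, ex c => ex (c.subst θ)

/-- The set of free variables. -/
def vars : {n : ℕ} → BuiltIn L n → Set ℕ
  | _, tru => ∅
  | _, eq s t => ↑s.varFinsetLeft ∪ ↑t.varFinsetLeft
  | _, rel _ ts => ⋃ i, ↑(ts i).varFinsetLeft
  | _, and c d => c.vars ∪ d.vars
  | _, ex c => c.vars

end BuiltIn

/-- Built-in constraints without dangling bound variables. -/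
abbrev Constraint (L : FirstOrder.Language.{u, v}) : Type (max u v) := BuiltIn L 0

/-- The equation `s = t`. -/
def mkEq {L : FirstOrder.Language.{u, v}} (s t : L.Term ℕ) : Constraint L :=
  BuiltIn.eq (s.relabel Sum.inl) (t.relabel Sum.inl)

/-- The conjunction of a sequence of built-in constraints. -/
def conj {L : FirstOrder.Language.{u, v}} (cs : List (Constraint L)) : Constraint L :=
  cs.foldr BuiltIn.and BuiltIn.tru

/-- The free variables of a sequence of built-in constraints. -/
def conjVars {L : FirstOrder.Language.{u, v}} (cs : List (Constraint L)) : Set ℕ := {x | ∃ c ∈ cs, x ∈ c.vars}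

/-- The substitution that replaces each variable `x` by the variable `ρ x`. -/
def renSubst (L : FirstOrder.Language.{u, v}) (ρ : Equiv.Perm ℕ) : ℕ → L.Term ℕ :=
  fun x => FirstOrder.Language.Term.var (ρ x)

section Logic

variable {L : FirstOrder.Language.{u, v}} (CT : L.Theory)

/-- Truth of a built-in constraint under an assignment of its free variables. -/
def Holds {L : FirstOrder.Language.{u, v}} {M : Type w} [L.Structure M] (a : ℕ → M) (c : Constraint L) : Prop :=
  c.RealizeAux a Fin.elim0

/-- `CT ⊨ c → d`. -/
def Entails (c d : Constraint L) : Prop :=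
  ∀ (M : FirstOrder.Language.Theory.ModelType.{u, v, max u v} CT) (a : ℕ → M), Holds a c → Holds a d

/-- `CT ⊨ c → ∃ X, d`, for a set `X` of variables. -/
def EntailsEx (c : Constraint L) (X : Set ℕ) (d : Constraint L) : Prop :=
  ∀ (M : FirstOrder.Language.Theory.ModelType.{u, v, max u v} CT) (a : ℕ → M), Holds a c →
    ∃ b : ℕ → M, (∀ x, x ∉ X → b x = a x) ∧ Holds b d

/-- `CT ⊨ c ↔ d`. -/
def Equivalent (c d : Constraint L) : Prop := Entails CT c d ∧ Entails CT d c

/-- `c` is inconsistent with `CT`; such constraints are what is written `false`. -/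
def Inconsistent (c : Constraint L) : Prop :=
  ∀ (M : FirstOrder.Language.Theory.ModelType.{u, v, max u v} CT) (a : ℕ → M), ¬ Holds a c

/-- `c` is satisfiable in some model of `CT`. -/
def Satisfiable (c : Constraint L) : Prop := ¬ Inconsistent CT c

/-- `CT` contains Clark's equality theory for the function symbols of `L` (equality itself is
interpreted as identity). -/
structure ClarkEquality : Prop where
  injective : ∀ {n : ℕ} (f : L.Functions n) (s t : Fin n → L.Term ℕ) (i : Fin n),
    Entails CT (mkEq (FirstOrder.Language.Term.func f s) (FirstOrder.Language.Term.func f t)) (mkEq (s i) (t i))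
  clash : ∀ {m n : ℕ} (f : L.Functions m) (g : L.Functions n) (s : Fin m → L.Term ℕ)
    (t : Fin n → L.Term ℕ), (⟨m, f⟩ : Σ k, L.Functions k) ≠ ⟨n, g⟩ →
    Inconsistent CT (mkEq (FirstOrder.Language.Term.func f s) (FirstOrder.Language.Term.func g t))
  occurs : ∀ (x : ℕ) (t : L.Term ℕ), x ∈ t.varFinset → t ≠ FirstOrder.Language.Term.var x →
    Inconsistent CT (mkEq (FirstOrder.Language.Term.var x) t)

end Logic

/-! ### CHR constraints, identified constraints, tokens -/

/-- A user-defined (CHR) constraint `p(t₁, …, tₙ)`. -/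
structure Atom (L : FirstOrder.Language.{u, v}) (κ : Type w) : Type (max u v w) where
  sym : κ
  args : List (L.Term ℕ)

/-- An identified CHR constraint `h#i`. -/
structure IdAtom (L : FirstOrder.Language.{u, v}) (κ : Type w) : Type (max u v w) where
  chr : Atom L κ
  id : ℕ

/-- A token `r@i₁,…,iₗ`. -/
structure Token (ν : Type z) : Type z where
  name : ν
  ids : List ℕ

section Objects

variable {L : FirstOrder.Language.{u, v}} {κ : Type w} {ν : Type z}

def Atom.subst (θ : ℕ → L.Term ℕ) (h : Atom L κ) : Atom L κ :=
  ⟨h.sym, h.args.map fun t => t.subst θ⟩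

def Atom.vars (h : Atom L κ) : Set ℕ := {x | ∃ t ∈ h.args, x ∈ t.varFinset}

def atomsVars (hs : List (Atom L κ)) : Set ℕ := {x | ∃ h ∈ hs, x ∈ h.vars}

def IdAtom.subst (θ : ℕ → L.Term ℕ) (h : IdAtom L κ) : IdAtom L κ := ⟨h.chr.subst θ, h.id⟩

/-- Increment the identifier by `n`. -/
def IdAtom.shift (n : ℕ) (h : IdAtom L κ) : IdAtom L κ := ⟨h.chr, h.id + n⟩

/-- Increment every identifier of a token by `n`. -/
def Token.shift (n : ℕ) (t : Token ν) : Token ν := ⟨t.name, t.ids.map (· + n)⟩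

/-- `p(t̄) = p'(t̄')` is defined: same predicate symbol, same number of arguments. -/
def SameSym (h k : Atom L κ) : Prop := h.sym = k.sym ∧ h.args.length = k.args.length

/-- `H = H'` is defined, for two sequences of CHR constraints. -/
def Matchable (H K : List (Atom L κ)) : Prop := List.Forall₂ SameSym H K

/-- The set of equations that `H = H'` stands for. -/
def matchEqs (H K : List (Atom L κ)) : List (Constraint L) :=
  (List.zipWith (fun h k => List.zipWith mkEq h.args k.args) H K).flatten

/-- `clean(B, T)`: delete from `T` the tokens with an identifier that does not occur in `B`. -/
def clean (B : Multiset (IdAtom L κ)) (T : Set (Token ν)) : Set (Token ν) :=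
  {t | t ∈ T ∧ ∀ i ∈ t.ids, ∃ h ∈ B, h.id = i}

/-- The greatest identifier that occurs in `(B, T)`, and `0` if there is none. -/
noncomputable def maxId (B : Multiset (IdAtom L κ)) (T : Set (Token ν)) : ℕ :=
  sSup ({i | ∃ h ∈ B, h.id = i} ∪ {i | ∃ t ∈ T, i ∈ t.ids})

end Objects

/-! ### Rules and programs -/

/-- A CHR rule `r @ H₁ \ H₂ ⇔ C | B`; the body is split into its CHR part and its built-in part. -/
structure Rule (L : FirstOrder.Language.{u, v}) (κ : Type w) (ν : Type z) : Type (max u v w z) where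
  name : ν
  kept : List (Atom L κ)
  removed : List (Atom L κ)
  guard : List (Constraint L)
  bodyChr : List (Atom L κ)
  bodyBI : List (Constraint L)

/-- An annotated rule `r @ H₁ \ H₂ ⇔ C | B̃; T`. -/
structure ARule (L : FirstOrder.Language.{u, v}) (κ : Type w) (ν : Type z) : Type (max u v w z) where
  name : ν
  kept : List (Atom L κ)
  removed : List (Atom L κ)
  guard : List (Constraint L)
  bodyChr : Multiset (IdAtom L κ)
  bodyBI : List (Constraint L)
  tokens : Set (Token ν)

section Programs

variable {L : FirstOrder.Language.{u, v}} {κ : Type w} {ν : Type z}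

/-- The heads `H₁, H₂`. -/
def Rule.heads (r : Rule L κ ν) : List (Atom L κ) := r.kept ++ r.removed

def Rule.vars (r : Rule L κ ν) : Set ℕ :=
  atomsVars r.heads ∪ conjVars r.guard ∪ atomsVars r.bodyChr ∪ conjVars r.bodyBI

/-- The variant of a rule under a renaming of its variables. -/
def Rule.rename (ρ : Equiv.Perm ℕ) (r : Rule L κ ν) : Rule L κ ν where
  name := r.name
  kept := r.kept.map fun h => h.subst (renSubst L ρ)
  removed := r.removed.map fun h => h.subst (renSubst L ρ)
  guard := r.guard.map fun c => c.subst (renSubst L ρ)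
  bodyChr := r.bodyChr.map fun h => h.subst (renSubst L ρ)
  bodyBI := r.bodyBI.map fun c => c.subst (renSubst L ρ)

/-- The heads `H₁, H₂`. -/
def ARule.heads (r : ARule L κ ν) : List (Atom L κ) := r.kept ++ r.removed

def ARule.vars (r : ARule L κ ν) : Set ℕ :=
  atomsVars r.heads ∪ conjVars r.guard ∪ {x | ∃ h ∈ r.bodyChr, x ∈ h.chr.vars} ∪ conjVars r.bodyBI

/-- The variant of an annotated rule under a renaming of its variables. -/
def ARule.rename (ρ : Equiv.Perm ℕ) (r : ARule L κ ν) : ARule L κ ν where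
  name := r.name
  kept := r.kept.map fun h => h.subst (renSubst L ρ)
  removed := r.removed.map fun h => h.subst (renSubst L ρ)
  guard := r.guard.map fun c => c.subst (renSubst L ρ)
  bodyChr := r.bodyChr.map fun h => h.subst (renSubst L ρ)
  bodyBI := r.bodyBI.map fun c => c.subst (renSubst L ρ)
  tokens := r.tokens

/-- A CHR program: a finite set of rules with non-empty heads and pairwise distinct names. -/
structure IsProgram (P : Set (Rule L κ ν)) : Prop where
  finite : P.Finite
  heads_ne : ∀ r ∈ P, r.heads ≠ []
  name_unique : ∀ r ∈ P, ∀ s ∈ P, r.name = s.name → r = s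

/-- The annotated version of a rule: the CHR constraints of the body get the identifiers
`1, …, m` in their order of occurrence, and the local token store is empty. -/
def Rule.ann (r : Rule L κ ν) : ARule L κ ν where
  name := r.name
  kept := r.kept
  removed := r.removed
  guard := r.guard
  bodyChr := ↑(r.bodyChr.mapIdx fun i h => (⟨h, i + 1⟩ : IdAtom L κ))
  bodyBI := r.bodyBI
  tokens := ∅

/-- `Ann(P)`. -/
def Ann (P : Set (Rule L κ ν)) : Set (ARule L κ ν) := Rule.ann '' P

end Programs

/-! ### The semantics of CHR programs -/

/-- A configuration `⟨G, S̃, C, T⟩ₙ`; the goal `G` is split into its CHR constraints and its built-in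
constraints. -/
structure Conf (L : FirstOrder.Language.{u, v}) (κ : Type w) (ν : Type z) : Type (max u v w z) where
  goalChr : Multiset (Atom L κ)
  goalBI : Multiset (Constraint L)
  store : Multiset (IdAtom L κ)
  bi : Constraint L
  tokens : Set (Token ν)
  counter : ℕ

section Semantics

variable {L : FirstOrder.Language.{u, v}} {κ : Type w} {ν : Type z} (CT : L.Theory)

def Conf.vars (σ : Conf L κ ν) : Set ℕ :=
  {x | ∃ h ∈ σ.goalChr, x ∈ h.vars} ∪ {x | ∃ c ∈ σ.goalBI, x ∈ c.vars} ∪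
    {x | ∃ h ∈ σ.store, x ∈ h.chr.vars} ∪ σ.bi.vars

/-- Identifiers distinguish the constraints of the store, and the counter is the next free integer:
every identifier in use is smaller. -/
structure Conf.WF (σ : Conf L κ ν) : Prop where
  nodup : (σ.store.map IdAtom.id).Nodup
  store_lt : ∀ h ∈ σ.store, h.id < σ.counter
  token_lt : ∀ t ∈ σ.tokens, ∀ i ∈ t.ids, i < σ.counter

/-- A failed configuration: the built-in store is `false`. -/
def Conf.Failed (σ : Conf L κ ν) : Prop := Inconsistent CT σ.bi

def Conf.BuiltInFree (σ : Conf L κ ν) : Prop := σ.Failed CT ∨ σ.goalBI = 0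

/-- Transition Solve. -/
def Solve (σ τ : Conf L κ ν) : Prop :=
  ∃ (c : Constraint L) (G : Multiset (Constraint L)) (C' : Constraint L),
    σ.goalBI = c ::ₘ G ∧ Equivalent CT (BuiltIn.and c σ.bi) C' ∧
    τ = { σ with goalBI := G, bi := C' }

/-- Transition Introduce. -/
def Introduce (σ τ : Conf L κ ν) : Prop :=
  ∃ (h : Atom L κ) (G : Multiset (Atom L κ)),
    σ.goalChr = h ::ₘ G ∧
    τ = { σ with goalChr := G, store := ⟨h, σ.counter⟩ ::ₘ σ.store, counter := σ.counter + 1 }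

/-- Transition Apply, with a variant of a rule of `P` whose variables are fresh: they occur neither
in the current configuration nor in the set `V`. -/
def Apply (P : Set (Rule L κ ν)) (V : Set ℕ) (σ τ : Conf L κ ν) : Prop :=
  ∃ r₀ ∈ P, ∃ (ρ : Equiv.Perm ℕ) (r : Rule L κ ν), r = r₀.rename ρ ∧
    Disjoint r.vars (V ∪ σ.vars) ∧
    ∃ (H₁ H₂ : List (IdAtom L κ)) (S : Multiset (IdAtom L κ)) (E : Constraint L) (t : Token ν),
      σ.store = ↑H₁ + ↑H₂ + S ∧
      Matchable (H₁.map IdAtom.chr) r.kept ∧ Matchable (H₂.map IdAtom.chr) r.removed ∧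
      E = conj (matchEqs ((H₁ ++ H₂).map IdAtom.chr) r.heads) ∧
      EntailsEx CT σ.bi (atomsVars r.heads) (BuiltIn.and E (conj r.guard)) ∧
      t = ⟨r.name, (H₁ ++ H₂).map IdAtom.id⟩ ∧ t ∉ σ.tokens ∧
      τ = { goalChr := ↑r.bodyChr + σ.goalChr
            goalBI := ↑r.bodyBI + σ.goalBI
            store := ↑H₁ + S
            bi := BuiltIn.and E σ.bi
            tokens := σ.tokens ∪ {t' | H₂ = [] ∧ t' = t}
            counter := σ.counter }

/-- One transition. Failed configurations are final. -/
def Step (P : Set (Rule L κ ν)) (V : Set ℕ) (σ τ : Conf L κ ν) : Prop :=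
  ¬ σ.Failed CT ∧ (Solve CT σ τ ∨ Introduce σ τ ∨ Apply CT P V σ τ)

/-- One transition of a normal derivation: Apply is used on built-in free configurations only. -/
def NormalStep (P : Set (Rule L κ ν)) (V : Set ℕ) (σ τ : Conf L κ ν) : Prop :=
  ¬ σ.Failed CT ∧
    (Solve CT σ τ ∨ Introduce σ τ ∨ (σ.BuiltInFree CT ∧ Apply CT P V σ τ))

/-- The relation `≃'_V`: both failed, or identical up to renaming of variables outside `V`, renaming
of identifiers, cleaning of the token store and logical equivalence of built-in constraints. -/
def Conf.Equiv (V : Set ℕ) (σ τ : Conf L κ ν) : Prop :=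
  (σ.Failed CT ∧ τ.Failed CT) ∨
  ∃ ρ π : Equiv.Perm ℕ, (∀ x ∈ V, ρ x = x) ∧
    σ.goalChr.map (fun h => h.subst (renSubst L ρ)) = τ.goalChr ∧
    Multiset.Rel (Equivalent CT) (σ.goalBI.map fun c => c.subst (renSubst L ρ)) τ.goalBI ∧
    σ.store.map (fun h => (⟨h.chr.subst (renSubst L ρ), π h.id⟩ : IdAtom L κ)) = τ.store ∧
    Equivalent CT (σ.bi.subst (renSubst L ρ)) τ.bi ∧
    (fun t : Token ν => (⟨t.name, t.ids.map π⟩ : Token ν)) '' clean σ.store σ.tokens =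
      clean τ.store τ.tokens

/-- No infinite normal computations. -/
def NormalTerminating (P : Set (Rule L κ ν)) : Prop :=
  ¬ ∃ s : ℕ → Conf L κ ν, (s 0).WF ∧ ∀ i, NormalStep CT P (s 0).vars (s i) (s (i + 1))

/-- Normal confluence. All derivations belong to computations from `σ`, so the variables of the
applied rule variants are kept apart from those of `σ`. -/
def NormalConfluent (P : Set (Rule L κ ν)) : Prop :=
  ∀ σ σ₁ σ₂ : Conf L κ ν, σ.WF →
    Relation.ReflTransGen (NormalStep CT P σ.vars) σ σ₁ →
    Relation.ReflTransGen (NormalStep CT P σ.vars) σ σ₂ →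
    ∃ τ₁ τ₂ : Conf L κ ν, Relation.ReflTransGen (Step CT P σ.vars) σ₁ τ₁ ∧
      Relation.ReflTransGen (Step CT P σ.vars) σ₂ τ₂ ∧ Conf.Equiv CT σ.vars τ₁ τ₂

end Semantics

/-! ### The semantics of annotated programs -/

/-- A configuration `⟨S̃, C, T⟩ₙ`; the store `S̃` is split into its identified CHR constraints and
its built-in constraints. -/
structure AConf (L : FirstOrder.Language.{u, v}) (κ : Type w) (ν : Type z) : Type (max u v w z) where
  store : Multiset (IdAtom L κ)
  storeBI : Multiset (Constraint L)
  bi : Constraint L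
  tokens : Set (Token ν)
  counter : ℕ

section ASemantics

variable {L : FirstOrder.Language.{u, v}} {κ : Type w} {ν : Type z} (CT : L.Theory)

def AConf.vars (σ : AConf L κ ν) : Set ℕ :=
  {x | ∃ h ∈ σ.store, x ∈ h.chr.vars} ∪ {x | ∃ c ∈ σ.storeBI, x ∈ c.vars} ∪ σ.bi.vars

/-- Identifiers distinguish the constraints of the store, and no identifier in use exceeds the
counter, which is the last integer used. -/
structure AConf.WF (σ : AConf L κ ν) : Prop where
  nodup : (σ.store.map IdAtom.id).Nodup
  store_le : ∀ h ∈ σ.store, h.id ≤ σ.counter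
  token_le : ∀ t ∈ σ.tokens, ∀ i ∈ t.ids, i ≤ σ.counter

/-- A failed configuration: the built-in store is `false`. -/
def AConf.Failed (σ : AConf L κ ν) : Prop := Inconsistent CT σ.bi

def AConf.BuiltInFree (σ : AConf L κ ν) : Prop := σ.Failed CT ∨ σ.storeBI = 0

/-- Transition Solve'. -/
def ASolve (σ τ : AConf L κ ν) : Prop :=
  ∃ (c : Constraint L) (G : Multiset (Constraint L)) (C' : Constraint L),
    σ.storeBI = c ::ₘ G ∧ Equivalent CT (BuiltIn.and c σ.bi) C' ∧
    τ = { σ with storeBI := G, bi := C' }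

/-- Transition Apply', with a variant of a rule of `P` whose variables are fresh: they occur neither
in the current configuration nor in the set `V`. The identifiers of the body and of the local token
store are incremented by the counter. -/
def AApply (P : Set (ARule L κ ν)) (V : Set ℕ) (σ τ : AConf L κ ν) : Prop :=
  ∃ r₀ ∈ P, ∃ (ρ : Equiv.Perm ℕ) (r : ARule L κ ν), r = r₀.rename ρ ∧
    Disjoint r.vars (V ∪ σ.vars) ∧
    ∃ (H₁ H₂ : List (IdAtom L κ)) (G : Multiset (IdAtom L κ)) (E : Constraint L) (t : Token ν),
      σ.store = ↑H₁ + ↑H₂ + G ∧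
      Matchable (H₁.map IdAtom.chr) r.kept ∧ Matchable (H₂.map IdAtom.chr) r.removed ∧
      E = conj (matchEqs ((H₁ ++ H₂).map IdAtom.chr) r.heads) ∧
      EntailsEx CT σ.bi (atomsVars r.heads) (BuiltIn.and E (conj r.guard)) ∧
      t = ⟨r.name, (H₁ ++ H₂).map IdAtom.id⟩ ∧ t ∉ σ.tokens ∧
      τ = { store := r.bodyChr.map (IdAtom.shift σ.counter) + ↑H₁ + G
            storeBI := ↑r.bodyBI + σ.storeBI
            bi := BuiltIn.and E σ.bi
            tokens := σ.tokens ∪ {t' | H₂ = [] ∧ t' = t} ∪ Token.shift σ.counter '' r.tokens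
            counter := σ.counter + maxId r.bodyChr r.tokens }

/-- One transition. Failed configurations are final. -/
def AStep (P : Set (ARule L κ ν)) (V : Set ℕ) (σ τ : AConf L κ ν) : Prop :=
  ¬ σ.Failed CT ∧ (ASolve CT σ τ ∨ AApply CT P V σ τ)

/-- One transition of a normal derivation: Apply' is used on built-in free configurations only. -/
def ANormalStep (P : Set (ARule L κ ν)) (V : Set ℕ) (σ τ : AConf L κ ν) : Prop :=
  ¬ σ.Failed CT ∧ (ASolve CT σ τ ∨ (σ.BuiltInFree CT ∧ AApply CT P V σ τ))

/-- The relation `≃'_V` on configurations for annotated programs. -/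
def AConf.Equiv (V : Set ℕ) (σ τ : AConf L κ ν) : Prop :=
  (σ.Failed CT ∧ τ.Failed CT) ∨
  ∃ ρ π : Equiv.Perm ℕ, (∀ x ∈ V, ρ x = x) ∧
    σ.store.map (fun h => (⟨h.chr.subst (renSubst L ρ), π h.id⟩ : IdAtom L κ)) = τ.store ∧
    Multiset.Rel (Equivalent CT) (σ.storeBI.map fun c => c.subst (renSubst L ρ)) τ.storeBI ∧
    Equivalent CT (σ.bi.subst (renSubst L ρ)) τ.bi ∧
    (fun t : Token ν => (⟨t.name, t.ids.map π⟩ : Token ν)) '' clean σ.store σ.tokens =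
      clean τ.store τ.tokens

/-- Normal confluence of an annotated program. -/
def ANormalConfluent (P : Set (ARule L κ ν)) : Prop :=
  ∀ σ σ₁ σ₂ : AConf L κ ν, σ.WF →
    Relation.ReflTransGen (ANormalStep CT P σ.vars) σ σ₁ →
    Relation.ReflTransGen (ANormalStep CT P σ.vars) σ σ₂ →
    ∃ τ₁ τ₂ : AConf L κ ν, Relation.ReflTransGen (AStep CT P σ.vars) σ₁ τ₁ ∧
      Relation.ReflTransGen (AStep CT P σ.vars) σ₂ τ₂ ∧ AConf.Equiv CT σ.vars τ₁ τ₂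

end ASemantics

/-! ### Unfolding and safe rule replacement -/

section Unfolding

variable {L : FirstOrder.Language.{u, v}} {κ : Type w} {ν : Type z} (CT : L.Theory)

open Classical in
/-- `Unfolds CT r w₀ ids u`: the rule `u` is obtained by unfolding `r` with (a variant `w`, renamed
apart from `r`, of) the rule `w₀`, using the atoms of the body of `r` with identifiers `ids`. -/
def Unfolds (r w₀ : ARule L κ ν) (ids : List ℕ) (u : ARule L κ ν) : Prop :=
  ∃ (ρ : Equiv.Perm ℕ) (w : ARule L κ ν), w = w₀.rename ρ ∧ Disjoint r.vars w.vars ∧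
    ∃ (K : Multiset (IdAtom L κ)) (S₁ S₂ : List (IdAtom L κ)) (θ : ℕ → L.Term ℕ)
      (CD : Constraint L) (D'' : List (Constraint L)),
      r.bodyChr = K + ↑S₁ + ↑S₂ ∧
      Matchable (S₁.map IdAtom.chr) w.kept ∧ Matchable (S₂.map IdAtom.chr) w.removed ∧
      (∀ x, x ∉ atomsVars w.heads → θ x = FirstOrder.Language.Term.var x) ∧
      CD = BuiltIn.and (conj r.bodyBI) (conj r.guard) ∧
      Entails CT CD
        (conj (matchEqs ((S₁ ++ S₂).map IdAtom.chr) (w.heads.map fun h => h.subst θ))) ∧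
      ids = (S₁ ++ S₂).map IdAtom.id ∧
      (⟨w.name, ids⟩ : Token ν) ∉ r.tokens ∧
      D'' = w.guard.filter (fun c => ¬ Entails CT CD (c.subst θ)) ∧
      Satisfiable CT (conj (r.guard ++ D''.map fun c => c.subst θ)) ∧
      u = { name := r.name
            kept := r.kept
            removed := r.removed
            guard := r.guard ++ D''.map fun c => c.subst θ
            bodyChr := K + ↑S₁ + w.bodyChr.map (IdAtom.shift (maxId r.bodyChr r.tokens))
            bodyBI := w.bodyBI ++ r.bodyBI ++ matchEqs ((S₁ ++ S₂).map IdAtom.chr) w.heads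
            tokens := clean (K + ↑S₁) r.tokens ∪
              Token.shift (maxId r.bodyChr r.tokens) '' w.tokens ∪
              {t | w.removed = [] ∧ t = ⟨w.name, ids⟩} }

/-- The set `U⁺_P(r)`. -/
def UPlus (P : Set (ARule L κ ν)) (r : ARule L κ ν) : Set (ARule L κ ν × List ℕ) :=
  {p | p.1 ∈ P ∧ ∃ u, Unfolds CT r p.1 p.2 u}

/-- The set `Unf_P(r)`. -/
def Unf (P : Set (ARule L κ ν)) (r : ARule L κ ν) : Set (ARule L κ ν) :=
  {u | ∃ w ∈ P, ∃ ids, Unfolds CT r w ids u}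

/-- The set `U^#_P(r)`: the rules `w₀` of `P` that could fire (in a variant `w` renamed apart from
`r`, under some further built-in constraint `C'`) on atoms of the body of `r` only, without giving an
unfolding of `r`, or on some atoms of the body of `r` together with other CHR constraints `H'`. -/
def UHash (P : Set (ARule L κ ν)) (r : ARule L κ ν) : Set (ARule L κ ν) :=
  {w₀ | w₀ ∈ P ∧ ∃ (ρ : Equiv.Perm ℕ) (w : ARule L κ ν) (C' : Constraint L),
    w = w₀.rename ρ ∧ Disjoint r.vars w.vars ∧ Disjoint C'.vars w.vars ∧
    Satisfiable CT (BuiltIn.and (conj r.guard) C') ∧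
    ((∃ A₁ A₂ : List (IdAtom L κ),
        (↑A₁ + ↑A₂ : Multiset (IdAtom L κ)) ≤ r.bodyChr ∧
        Matchable (A₁.map IdAtom.chr) w.kept ∧ Matchable (A₂.map IdAtom.chr) w.removed ∧
        EntailsEx CT (BuiltIn.and (conj r.guard) C') (atomsVars w.heads)
          (BuiltIn.and (conj (matchEqs ((A₁ ++ A₂).map IdAtom.chr) w.heads)) (conj w.guard)) ∧
        (⟨w.name, (A₁ ++ A₂).map IdAtom.id⟩ : Token ν) ∉ r.tokens ∧
        (w₀, (A₁ ++ A₂).map IdAtom.id) ∉ UPlus CT P r) ∨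
     (∃ (A' : Multiset (IdAtom L κ)) (H' : Multiset (Atom L κ)) (K₁ K₂ : List (Atom L κ)),
        A' ≤ r.bodyChr ∧ A' ≠ 0 ∧ H' ≠ 0 ∧ A'.map IdAtom.chr + H' = ↑K₁ + ↑K₂ ∧
        Matchable K₁ w.kept ∧ Matchable K₂ w.removed ∧
        EntailsEx CT (BuiltIn.and (conj r.guard) C') (atomsVars w.heads)
          (BuiltIn.and (conj (matchEqs (K₁ ++ K₂) w.heads)) (conj w.guard))))}

/-- The rule `r` can be safely replaced in `P`. -/
structure SafelyReplaceable (P : Set (ARule L κ ν)) (r : ARule L κ ν) : Prop where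
  mem : r ∈ P
  uHash : UHash CT P r = ∅
  uPlus : (UPlus CT P r).Nonempty
  guard : ∀ u ∈ Unf CT P r, Equivalent CT (conj r.guard) (conj u.guard)

/-- One step of a U-sequence: some safely replaceable rule `r` is replaced by its unfoldings, which
are taken up to renaming of variables: `U` contains a variant of every element of `Unf_P(r)`. -/
def UStep (P P' : Set (ARule L κ ν)) : Prop :=
  ∃ (r : ARule L κ ν) (U : Set (ARule L κ ν)), SafelyReplaceable CT P r ∧
    U ⊆ Unf CT P r ∧ (∀ u ∈ Unf CT P r, ∃ ρ : Equiv.Perm ℕ, u.rename ρ ∈ U) ∧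
    P' = (P \ {r}) ∪ U

/-- `Q 0, …, Q n` is a U-sequence starting from `P`. -/
def IsUSequence (P : Set (ARule L κ ν)) (n : ℕ) (Q : Fin (n + 1) → Set (ARule L κ ν)) : Prop :=
  Q 0 = P ∧ ∀ i : Fin n, UStep CT (Q i.castSucc) (Q i.succ)

end Unfolding

end CHR

/-! Both semantics are reduced to one abstract system. A solved state (`MState`) has all its CHR
constraints identified and all its built-in constraints conjoined; an abstract transition (`MStep`)
applies a rule, solves the built-in part of its body at once, and takes any fresh identifiers for
the rest. Transitions are compatible with ≃' (`MEquiv.step`), and the choice of fresh identifiers is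
immaterial (`Res.unique`). Under termination, normal confluence amounts to uniqueness of abstract
normal forms up to ≃' (`Impl.confluent_iff`); `confImpl` gives this for a CHR program and its
annotated version, `aConfImpl` for annotated programs.

It remains to compare P with P', where P' arises from P by replacing r by unfoldings. An unfolding u
of r with w has the heads of r and an equivalent guard, so it applies exactly where r does. After an
application of r, the rule w applies to the unfolded body constraints: by Clark's theory the
matching equations determine the values of the head variables, so the guard of r, entailed before
under an existential quantifier, is now entailed outright (`IsUnf.fire_snd`). The two applications
together have the effect of u (`IsUnf.cong`). Hence a transition of P' is, up to ≃', one or two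
transitions of P (`Replaces.transGen`). A transition of P is one of P', or else an application of r;
the latter either fails together with an application of an unfolding, or can be continued by w to a
state that P' reaches in one transition (`Replaces.exists_step`). Therefore termination passes from
P to P', both have the same normal states, and uniqueness of normal forms passes from P to P'.

For the converse, `Replaces.equiv_of_normal` shows by well-founded induction along P that the
P-normal forms of a state are equivalent to its P'-normal forms. After a transition σ → σ₁ by r that
does not fail, some P-normal form of σ₁ is, up to ≃', also a P'-normal form of σ, and the induction
hypothesis at σ₁ identifies it with every other P-normal form of σ₁. -/

namespace CHR

open FirstOrder Language Relation

/-! ### Permutations with prescribed values on a finite set -/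

/-- The symmetric group of ℕ is `n`-transitive for every `n`. Renamings have to be permutations, and
this lets them be prescribed where only finitely many variables or identifiers matter. -/
theorem exists_perm_eqOn {s : Set ℕ} (hs : s.Finite) {g : ℕ → ℕ} (hg : Set.InjOn g s) :
    ∃ π : Equiv.Perm ℕ, Set.EqOn π g s := by
  classical
  obtain ⟨n, ⟨e⟩⟩ := hs.exists_equiv_fin
  have := Equiv.Perm.isMultiplyPretransitive ℕ n
  let x : Fin n ↪ ℕ := ⟨fun i => (e.symm i : ℕ), fun i j h => e.symm.injective (Subtype.ext h)⟩
  let y : Fin n ↪ ℕ := ⟨fun i => g (e.symm i : ℕ), fun i j h =>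
    e.symm.injective (Subtype.ext (hg (e.symm i).2 (e.symm j).2 h))⟩
  obtain ⟨π, hπ⟩ := MulAction.exists_smul_eq (Equiv.Perm ℕ) x y
  refine ⟨π, fun a ha => ?_⟩
  have := DFunLike.congr_fun hπ (e ⟨a, ha⟩)
  change π (e.symm (e ⟨a, ha⟩) : ℕ) = g (e.symm (e ⟨a, ha⟩) : ℕ) at this
  simpa using this

/-- A permutation can be changed off `A` so that it moves `B` away from `F`. -/
theorem exists_perm_eqOn_disjoint {A B F : Set ℕ} (hA : A.Finite) (hB : B.Finite)
    (hF : F.Finite) (hAB : Disjoint A B) (ρ : Equiv.Perm ℕ) :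
    ∃ ρ' : Equiv.Perm ℕ, Set.EqOn ρ' ρ A ∧ Disjoint (ρ' '' B) F := by
  classical
  obtain ⟨N, hN⟩ := (hF.union (hA.image ρ)).bddAbove
  -- `N` bounds `F` and `ρ '' A`, so `x + (N + 1)` avoids `F` and does not collide with the values
  -- prescribed on `A`.
  obtain ⟨π, hπ⟩ := exists_perm_eqOn (g := fun x => if x ∈ A then ρ x else x + (N + 1))
    (hA.union hB) (by
      intro x hx y hy hxy
      by_cases hxA : x ∈ A <;> by_cases hyA : y ∈ A <;> simp only [hxA, hyA, if_true, if_false] at hxy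
      · exact ρ.injective hxy
      · have := hN (Or.inr ⟨x, hxA, rfl⟩); omega
      · have := hN (Or.inr ⟨y, hyA, rfl⟩); omega
      · omega)
  refine ⟨π, fun x hx => by simpa [hx] using hπ (Or.inl hx), ?_⟩
  rw [Set.disjoint_left]
  rintro _ ⟨x, hx, rfl⟩ hxF
  have h := hπ (Or.inr hx)
  have hxA : x ∉ A := fun h' => Set.disjoint_left.1 hAB h' hx
  simp only [hxA, if_false] at h
  have := hN (Or.inl hxF)
  omega

/-! ### Terms and built-in constraints: evaluation, renaming, variables. -/

section Terms

variable {L : FirstOrder.Language.{u, v}} {κ : Type w} {ν : Type z}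

theorem realize_eq_of_eqOn {M : Type*} [L.Structure M] {a b : ℕ → M} (t : L.Term ℕ)
    (h : ∀ x ∈ t.varFinset, a x = b x) : t.realize a = t.realize b := by
  induction t with
  | var x => exact h x (by simp [Term.varFinset])
  | func f ts ih =>
    simp only [Term.realize_func]
    congr 1
    funext i
    exact ih i fun x hx => h x (by simp only [Term.varFinset, Finset.mem_biUnion]; exact ⟨i, by simp, hx⟩)

theorem term_subst_congr {θ θ' : ℕ → L.Term ℕ} (t : L.Term ℕ)
    (h : ∀ x ∈ t.varFinset, θ x = θ' x) : t.subst θ = t.subst θ' := by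
  induction t with
  | var x => exact h x (by simp [Term.varFinset])
  | func f ts ih =>
    simp only [Term.subst]
    congr 1
    funext i
    exact ih i fun x hx => h x (by simp only [Term.varFinset, Finset.mem_biUnion]; exact ⟨i, by simp, hx⟩)

theorem term_subst_ren_ren (ρ ρ' : Equiv.Perm ℕ) (t : L.Term ℕ) :
    (t.subst (renSubst L ρ)).subst (renSubst L ρ') = t.subst (renSubst L (ρ' * ρ)) := by
  induction t with
  | var x => rfl
  | func f ts ih => simp only [Term.subst, ih]

theorem term_subst_one (t : L.Term ℕ) : t.subst (renSubst L 1) = t := by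
  induction t with
  | var x => rfl
  | func f ts ih => simp only [Term.subst, ih]

theorem varFinset_subst_ren (ρ : Equiv.Perm ℕ) (t : L.Term ℕ) (x : ℕ) :
    x ∈ (t.subst (renSubst L ρ)).varFinset ↔ ∃ y ∈ t.varFinset, ρ y = x := by
  induction t with
  | var y => simp [Term.subst, renSubst, Term.varFinset, eq_comm]
  | func f ts ih =>
    simp only [Term.subst, Term.varFinset, Finset.mem_biUnion, Finset.mem_univ, true_and, ih]
    constructor
    · rintro ⟨i, y, hy, rfl⟩; exact ⟨y, ⟨i, hy⟩, rfl⟩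
    · rintro ⟨y, ⟨i, hy⟩, rfl⟩; exact ⟨i, y, hy, rfl⟩

namespace BuiltIn

theorem realize_substTerm {M : Type*} [L.Structure M] {n : ℕ} (θ : ℕ → L.Term ℕ)
    (t : L.Term (ℕ ⊕ Fin n)) (a : ℕ → M) (xs : Fin n → M) :
    (substTerm θ t).realize (Sum.elim a xs) =
      t.realize (Sum.elim (fun x => (θ x).realize a) xs) := by
  rw [substTerm, Term.realize_subst]
  congr 1
  funext x
  cases x with
  | inl x => simp [Term.realize_relabel]
  | inr i => simp

theorem realizeAux_subst {M : Type*} [L.Structure M] {n : ℕ} (θ : ℕ → L.Term ℕ) (a : ℕ → M)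
    (c : BuiltIn L n) : ∀ xs : Fin n → M,
    (c.subst θ).RealizeAux a xs ↔ c.RealizeAux (fun x => (θ x).realize a) xs := by
  induction c with
  | tru => intro xs; rfl
  | eq s t => intro xs; simp only [subst, RealizeAux, realize_substTerm]
  | rel R ts => intro xs; simp only [subst, RealizeAux, realize_substTerm]
  | and c d ihc ihd => intro xs; simp only [subst, RealizeAux, ihc, ihd]
  | ex c ih => intro xs; simp only [subst, RealizeAux, ih]

theorem substTerm_congr {n : ℕ} {θ θ' : ℕ → L.Term ℕ} (t : L.Term (ℕ ⊕ Fin n))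
    (h : ∀ x ∈ t.varFinsetLeft, θ x = θ' x) : substTerm θ t = substTerm θ' t := by
  induction t with
  | var x =>
    cases x with
    | inl x => simp [substTerm, Term.subst, h x (by simp [Term.varFinsetLeft])]
    | inr i => rfl
  | func f ts ih =>
    simp only [substTerm, Term.subst] at ih ⊢
    congr 1
    funext i
    exact ih i fun x hx => h x (by
      simp only [Term.varFinsetLeft, Finset.mem_biUnion]; exact ⟨i, by simp, hx⟩)

theorem substTerm_ren_ren {n : ℕ} (ρ ρ' : Equiv.Perm ℕ) (t : L.Term (ℕ ⊕ Fin n)) :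
    substTerm (renSubst L ρ') (substTerm (renSubst L ρ) t) = substTerm (renSubst L (ρ' * ρ)) t := by
  induction t with
  | var x => cases x <;> rfl
  | func f ts ih =>
    simp only [substTerm, Term.subst] at ih ⊢
    simp only [ih]

theorem substTerm_one {n : ℕ} (t : L.Term (ℕ ⊕ Fin n)) : substTerm (renSubst L 1) t = t := by
  induction t with
  | var x => cases x <;> rfl
  | func f ts ih =>
    simp only [substTerm, Term.subst] at ih ⊢
    simp only [ih]

theorem varFinsetLeft_substTerm {n : ℕ} (ρ : Equiv.Perm ℕ) (t : L.Term (ℕ ⊕ Fin n)) (x : ℕ) :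
    x ∈ (substTerm (renSubst L ρ) t).varFinsetLeft ↔ ∃ y ∈ t.varFinsetLeft, ρ y = x := by
  induction t with
  | var y =>
    cases y <;> simp [substTerm, Term.subst, renSubst, Term.varFinsetLeft, eq_comm]
  | func f ts ih =>
    simp only [substTerm] at ih ⊢
    simp only [Term.subst, Term.varFinsetLeft, Finset.mem_biUnion, Finset.mem_univ, true_and, ih]
    constructor
    · rintro ⟨i, y, hy, rfl⟩; exact ⟨y, ⟨i, hy⟩, rfl⟩
    · rintro ⟨y, ⟨i, hy⟩, rfl⟩; exact ⟨i, y, hy, rfl⟩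

theorem subst_congr {n : ℕ} {θ θ' : ℕ → L.Term ℕ} (c : BuiltIn L n) :
    (∀ x ∈ c.vars, θ x = θ' x) → c.subst θ = c.subst θ' := by
  induction c with
  | tru => intro _; rfl
  | eq s t =>
    intro h
    simp only [subst]
    rw [substTerm_congr s fun x hx => h x (Or.inl hx),
      substTerm_congr t fun x hx => h x (Or.inr hx)]
  | rel R ts =>
    intro h
    simp only [subst]
    congr 1
    funext i
    exact substTerm_congr (ts i) fun x hx => h x (Set.mem_iUnion.2 ⟨i, hx⟩)
  | and c d ihc ihd =>
    intro h
    simp only [subst]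
    rw [ihc fun x hx => h x (Or.inl hx), ihd fun x hx => h x (Or.inr hx)]
  | ex c ih =>
    intro h
    simp only [subst]
    rw [ih h]

theorem subst_ren_ren {n : ℕ} (ρ ρ' : Equiv.Perm ℕ) (c : BuiltIn L n) :
    (c.subst (renSubst L ρ)).subst (renSubst L ρ') = c.subst (renSubst L (ρ' * ρ)) := by
  induction c with
  | tru => rfl
  | eq s t => simp only [subst, substTerm_ren_ren]
  | rel R ts => simp only [subst, substTerm_ren_ren]
  | and c d ihc ihd => simp only [subst, ihc, ihd]
  | ex c ih => simp only [subst, ih]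

theorem subst_one {n : ℕ} (c : BuiltIn L n) : c.subst (renSubst L 1) = c := by
  induction c with
  | tru => rfl
  | eq s t => simp only [subst, substTerm_one]
  | rel R ts => simp only [subst, substTerm_one]
  | and c d ihc ihd => simp only [subst, ihc, ihd]
  | ex c ih => simp only [subst, ih]

theorem mem_vars_subst {n : ℕ} (ρ : Equiv.Perm ℕ) (c : BuiltIn L n) (x : ℕ) :
    x ∈ (c.subst (renSubst L ρ)).vars ↔ ∃ y ∈ c.vars, ρ y = x := by
  induction c with
  | tru => simp [subst, vars]
  | eq s t =>
    simp only [subst, vars, Set.mem_union, Finset.mem_coe, varFinsetLeft_substTerm]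
    simp only [or_and_right, exists_or]
  | rel R ts =>
    simp only [subst, vars, Set.mem_iUnion, Finset.mem_coe, varFinsetLeft_substTerm]
    constructor
    · rintro ⟨i, y, hy, rfl⟩; exact ⟨y, ⟨i, hy⟩, rfl⟩
    · rintro ⟨y, ⟨i, hy⟩, rfl⟩; exact ⟨i, y, hy, rfl⟩
  | and c d ihc ihd =>
    simp only [subst, vars, Set.mem_union, ihc, ihd, or_and_right, exists_or]
  | ex c ih => exact ih

theorem vars_finite {n : ℕ} (c : BuiltIn L n) : c.vars.Finite := by
  induction c with
  | tru => exact Set.finite_empty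
  | eq s t => exact (Finset.finite_toSet _).union (Finset.finite_toSet _)
  | rel R ts => exact Set.finite_iUnion fun i => Finset.finite_toSet _
  | and c d ihc ihd => exact ihc.union ihd
  | ex c ih => exact ih

end BuiltIn

theorem varFinsetLeft_relabel {n : ℕ} (t : L.Term ℕ) :
    (t.relabel (Sum.inl : ℕ → ℕ ⊕ Fin n)).varFinsetLeft = t.varFinset := by
  induction t with
  | var x => rfl
  | func f ts ih => simp only [Term.relabel, Term.varFinsetLeft, Term.varFinset, ih]

theorem vars_mkEq (s t : L.Term ℕ) : (mkEq s t).vars = ↑s.varFinset ∪ ↑t.varFinset := by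
  simp only [mkEq, BuiltIn.vars, varFinsetLeft_relabel]

theorem substTerm_relabel {n : ℕ} (θ : ℕ → L.Term ℕ) (t : L.Term ℕ) :
    BuiltIn.substTerm θ (t.relabel (Sum.inl : ℕ → ℕ ⊕ Fin n)) = (t.subst θ).relabel Sum.inl := by
  induction t with
  | var x => rfl
  | func f ts ih =>
    simp only [BuiltIn.substTerm] at ih ⊢
    simp only [Term.relabel, Term.subst, ih]

theorem mkEq_subst (θ : ℕ → L.Term ℕ) (s t : L.Term ℕ) :
    (mkEq s t).subst θ = mkEq (s.subst θ) (t.subst θ) := by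
  simp only [mkEq, BuiltIn.subst, substTerm_relabel]

section Holds

variable {M : Type*} [L.Structure M]

theorem holds_subst (θ : ℕ → L.Term ℕ) (a : ℕ → M) (c : Constraint L) :
    Holds a (c.subst θ) ↔ Holds (fun x => (θ x).realize a) c :=
  BuiltIn.realizeAux_subst θ a c _

theorem holds_subst_ren (ρ : Equiv.Perm ℕ) (a : ℕ → M) (c : Constraint L) :
    Holds a (c.subst (renSubst L ρ)) ↔ Holds (a ∘ ρ) c :=
  holds_subst _ a c

theorem holds_mkEq (a : ℕ → M) (s t : L.Term ℕ) :
    Holds a (mkEq s t) ↔ s.realize a = t.realize a := by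
  simp only [Holds, mkEq, BuiltIn.RealizeAux, Term.realize_relabel, Sum.elim_comp_inl]

theorem holds_and (a : ℕ → M) (c d : Constraint L) :
    Holds a (BuiltIn.and c d) ↔ Holds a c ∧ Holds a d := Iff.rfl

theorem holds_tru (a : ℕ → M) : Holds a (BuiltIn.tru : Constraint L) := trivial

theorem holds_conj (a : ℕ → M) (cs : List (Constraint L)) :
    Holds a (conj cs) ↔ ∀ c ∈ cs, Holds a c := by
  induction cs with
  | nil => simp [conj, holds_tru]
  | cons c cs ih =>
    have : conj (c :: cs) = BuiltIn.and c (conj cs) := rfl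
    rw [this, holds_and, ih]
    simp

end Holds

theorem conj_subst (θ : ℕ → L.Term ℕ) (cs : List (Constraint L)) :
    (conj cs).subst θ = conj (cs.map fun c => c.subst θ) := by
  induction cs with
  | nil => rfl
  | cons c cs ih =>
    change BuiltIn.and (c.subst θ) ((conj cs).subst θ) = _
    rw [ih]; rfl

theorem vars_conj (cs : List (Constraint L)) : (conj cs).vars = conjVars cs := by
  induction cs with
  | nil => simp [conj, conjVars, BuiltIn.vars]
  | cons c cs ih =>
    change c.vars ∪ (conj cs).vars = _
    rw [ih]
    ext x
    simp [conjVars]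

theorem conjVars_finite (cs : List (Constraint L)) : (conjVars cs).Finite :=
  vars_conj cs ▸ BuiltIn.vars_finite _

end Terms

/-! ### Entailment modulo `CT` and the semantic content of Clark's theory. -/

section Entailment

variable {L : FirstOrder.Language.{u, v}} {CT : L.Theory}

theorem Entails.refl (c : Constraint L) : Entails CT c c := fun _ _ h => h

theorem Entails.trans {c d e : Constraint L} (h : Entails CT c d) (h' : Entails CT d e) :
    Entails CT c e := fun M a ha => h' M a (h M a ha)

theorem equivalent_iff {c d : Constraint L} : Equivalent CT c d ↔
    ∀ (M : Theory.ModelType.{u, v, max u v} CT) (a : ℕ → M), Holds a c ↔ Holds a d :=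
  ⟨fun h M a => ⟨h.1 M a, h.2 M a⟩, fun h => ⟨fun M a => (h M a).1, fun M a => (h M a).2⟩⟩

theorem Equivalent.refl (c : Constraint L) : Equivalent CT c c := ⟨.refl c, .refl c⟩

theorem Equivalent.symm {c d : Constraint L} (h : Equivalent CT c d) : Equivalent CT d c :=
  ⟨h.2, h.1⟩

theorem Equivalent.trans {c d e : Constraint L} (h : Equivalent CT c d) (h' : Equivalent CT d e) :
    Equivalent CT c e := ⟨h.1.trans h'.1, h'.2.trans h.2⟩

theorem Equivalent.and {c c' d d' : Constraint L} (h : Equivalent CT c c')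
    (h' : Equivalent CT d d') : Equivalent CT (BuiltIn.and c d) (BuiltIn.and c' d') :=
  equivalent_iff.2 fun M a => by
    rw [holds_and, holds_and, equivalent_iff.1 h M a, equivalent_iff.1 h' M a]

theorem Equivalent.inconsistent_iff {c d : Constraint L} (h : Equivalent CT c d) :
    Inconsistent CT c ↔ Inconsistent CT d :=
  ⟨fun hc M a hd => hc M a (h.2 M a hd), fun hd M a hc => hd M a (h.1 M a hc)⟩

theorem Entails.subst_ren (ρ : Equiv.Perm ℕ) {c d : Constraint L} (h : Entails CT c d) :
    Entails CT (c.subst (renSubst L ρ)) (d.subst (renSubst L ρ)) := fun M a ha =>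
  (holds_subst_ren ρ a d).2 (h M _ ((holds_subst_ren ρ a c).1 ha))

theorem Equivalent.subst_ren (ρ : Equiv.Perm ℕ) {c d : Constraint L} (h : Equivalent CT c d) :
    Equivalent CT (c.subst (renSubst L ρ)) (d.subst (renSubst L ρ)) :=
  ⟨h.1.subst_ren ρ, h.2.subst_ren ρ⟩

theorem inconsistent_subst_ren (ρ : Equiv.Perm ℕ) (c : Constraint L) :
    Inconsistent CT (c.subst (renSubst L ρ)) ↔ Inconsistent CT c := by
  constructor
  · intro h M a ha
    refine h M (a ∘ ρ.symm) ((holds_subst_ren ρ _ c).2 ?_)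
    simpa [Function.comp_assoc] using ha
  · intro h M a ha
    exact h M _ ((holds_subst_ren ρ a c).1 ha)

theorem EntailsEx.subst_ren (ρ : Equiv.Perm ℕ) {c d : Constraint L} {X : Set ℕ}
    (h : EntailsEx CT c X d) :
    EntailsEx CT (c.subst (renSubst L ρ)) (ρ '' X) (d.subst (renSubst L ρ)) := by
  intro M a ha
  obtain ⟨b, hb, hd⟩ := h M _ ((holds_subst_ren ρ a c).1 ha)
  refine ⟨b ∘ ρ.symm, fun x hx => ?_, (holds_subst_ren ρ _ d).2 ?_⟩
  · have := hb (ρ.symm x) (fun h' => hx ⟨_, h', by simp⟩)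
    simpa using this
  · simpa [Function.comp_assoc] using hd

theorem EntailsEx.mono {c c' d d' : Constraint L} {X : Set ℕ} (h : EntailsEx CT c X d)
    (hc : Entails CT c' c) (hd : Entails CT d d') : EntailsEx CT c' X d' := fun M a ha =>
  let ⟨b, hb, hb'⟩ := h M a (hc M a ha)
  ⟨b, hb, hd M b hb'⟩

/-- The injectivity axiom is applied to distinct variables: `a` assigns one tuple to the variables
`0, …, n - 1`, the other to `n, …, 2n - 1`, and a dummy value elsewhere. -/
theorem funMap_injective (hCT : ClarkEquality CT) (M : Theory.ModelType.{u, v, max u v} CT) {n : ℕ}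
    (f : L.Functions n) : Function.Injective (Structure.funMap (M := M) f) := by
  intro x y hxy
  have : Nonempty M := inferInstance
  obtain ⟨m⟩ := this
  funext i
  let a : ℕ → M := fun j => if h : j < n then x ⟨j, h⟩ else if h : j - n < n then y ⟨j - n, h⟩ else m
  have h := hCT.injective f (fun i => Term.var (i : ℕ)) (fun i => Term.var (n + (i : ℕ))) i M a
    ((holds_mkEq _ _ _).2 (by simpa [a] using hxy))
  simpa [a] using (holds_mkEq _ _ _).1 h

/-- Function symbols are injective in models of `CT`, so the value of a term determines the values
of its variables. Clark's theory enters the proof through this fact. -/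
theorem eqOn_of_realize_eq (hCT : ClarkEquality CT) (M : Theory.ModelType.{u, v, max u v} CT)
    {a b : ℕ → M} (t : L.Term ℕ) :
    t.realize a = t.realize b → ∀ x ∈ t.varFinset, a x = b x := by
  induction t with
  | var x => intro h y hy; simp only [Term.varFinset, Finset.mem_singleton] at hy; subst hy; exact h
  | func f ts ih =>
    intro h x hx
    simp only [Term.varFinset, Finset.mem_biUnion, Finset.mem_univ, true_and] at hx
    obtain ⟨i, hi⟩ := hx
    exact ih i (congrFun (funMap_injective hCT M f h) i) x hi

end Entailment

/-! ### CHR constraints, identifiers and tokens under renaming. -/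

section Atoms

variable {L : FirstOrder.Language.{u, v}} {κ : Type w} {ν : Type z}

theorem Atom.subst_ren_ren (ρ ρ' : Equiv.Perm ℕ) (h : Atom L κ) :
    (h.subst (renSubst L ρ)).subst (renSubst L ρ') = h.subst (renSubst L (ρ' * ρ)) := by
  simp [Atom.subst, Function.comp_def, term_subst_ren_ren]

theorem Atom.subst_one (h : Atom L κ) : h.subst (renSubst L 1) = h := by
  simp [Atom.subst, term_subst_one]

theorem renSubst_eq {ρ ρ' : Equiv.Perm ℕ} {x : ℕ} (h : ρ x = ρ' x) :
    renSubst L ρ x = renSubst L ρ' x := by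
  simp [renSubst, h]

theorem Atom.subst_congr {ρ ρ' : Equiv.Perm ℕ} {h : Atom L κ} (hρ : ∀ x ∈ h.vars, ρ x = ρ' x) :
    h.subst (renSubst L ρ) = h.subst (renSubst L ρ') := by
  simp only [Atom.subst, Atom.mk.injEq, true_and]
  exact List.map_congr_left fun t ht => term_subst_congr t fun x hx => renSubst_eq (hρ x ⟨t, ht, hx⟩)

theorem Atom.mem_vars_subst (ρ : Equiv.Perm ℕ) (h : Atom L κ) (x : ℕ) :
    x ∈ (h.subst (renSubst L ρ)).vars ↔ ∃ y ∈ h.vars, ρ y = x := by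
  simp only [Atom.vars, Atom.subst, Set.mem_ofPred_eq, List.mem_map]
  constructor
  · rintro ⟨_, ⟨t, ht, rfl⟩, hx⟩
    obtain ⟨y, hy, rfl⟩ := (varFinset_subst_ren ρ t x).1 hx
    exact ⟨y, ⟨t, ht, hy⟩, rfl⟩
  · rintro ⟨y, ⟨t, ht, hy⟩, rfl⟩
    exact ⟨_, ⟨t, ht, rfl⟩, (varFinset_subst_ren ρ t _).2 ⟨y, hy, rfl⟩⟩

theorem Atom.vars_finite (h : Atom L κ) : h.vars.Finite := by
  have : h.vars = ⋃ t ∈ {t | t ∈ h.args}, (↑t.varFinset : Set ℕ) := by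
    ext x; simp [Atom.vars]
  rw [this]
  exact (List.finite_toSet h.args).biUnion fun t _ => Finset.finite_toSet _

theorem atomsVars_finite (hs : List (Atom L κ)) : (atomsVars hs).Finite := by
  have : atomsVars hs = ⋃ h ∈ {h | h ∈ hs}, h.vars := by
    ext x; simp [atomsVars]
  rw [this]
  exact (List.finite_toSet hs).biUnion fun h _ => h.vars_finite

/-- The variables of a multiset of identified constraints. -/
def storeVars (S : Multiset (IdAtom L κ)) : Set ℕ := {x | ∃ h ∈ S, x ∈ h.chr.vars}

theorem storeVars_finite (S : Multiset (IdAtom L κ)) : (storeVars S).Finite := by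
  have : storeVars S = ⋃ h ∈ {h | h ∈ S}, h.chr.vars := by
    ext x; simp [storeVars]
  rw [this]
  exact (Multiset.finite_toSet S).biUnion fun h _ => h.chr.vars_finite

theorem mem_atomsVars_map_subst (ρ : Equiv.Perm ℕ) (hs : List (Atom L κ)) :
    atomsVars (hs.map fun h => h.subst (renSubst L ρ)) = ρ '' atomsVars hs := by
  ext x
  simp only [atomsVars, Set.mem_ofPred_eq, List.mem_map, Set.mem_image]
  constructor
  · rintro ⟨_, ⟨h, hh, rfl⟩, hx⟩
    obtain ⟨y, hy, rfl⟩ := (h.mem_vars_subst ρ x).1 hx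
    exact ⟨y, ⟨h, hh, hy⟩, rfl⟩
  · rintro ⟨y, ⟨h, hh, hy⟩, rfl⟩
    exact ⟨_, ⟨h, hh, rfl⟩, (h.mem_vars_subst ρ _).2 ⟨y, hy, rfl⟩⟩

theorem conjVars_map_subst (ρ : Equiv.Perm ℕ) (cs : List (Constraint L)) :
    conjVars (cs.map fun c => c.subst (renSubst L ρ)) = ρ '' conjVars cs := by
  ext x
  simp only [conjVars, Set.mem_ofPred_eq, List.mem_map, Set.mem_image]
  constructor
  · rintro ⟨_, ⟨h, hh, rfl⟩, hx⟩
    obtain ⟨y, hy, rfl⟩ := (h.mem_vars_subst ρ x).1 hx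
    exact ⟨y, ⟨h, hh, hy⟩, rfl⟩
  · rintro ⟨y, ⟨h, hh, hy⟩, rfl⟩
    exact ⟨_, ⟨h, hh, rfl⟩, (h.mem_vars_subst ρ _).2 ⟨y, hy, rfl⟩⟩

/-- Rename the variables by `ρ` and the identifier by `π`. -/
def IdAtom.ren (ρ : Equiv.Perm ℕ) (π : ℕ → ℕ) (h : IdAtom L κ) : IdAtom L κ :=
  ⟨h.chr.subst (renSubst L ρ), π h.id⟩

/-- Rename the identifier. -/
def IdAtom.mapId (f : ℕ → ℕ) (h : IdAtom L κ) : IdAtom L κ := ⟨h.chr, f h.id⟩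

/-- Rename the identifiers of a token. -/
def Token.map (f : ℕ → ℕ) (t : Token ν) : Token ν := ⟨t.name, t.ids.map f⟩

theorem Token.map_map (f g : ℕ → ℕ) (t : Token ν) : (t.map f).map g = t.map (g ∘ f) := by
  simp [Token.map]

theorem Token.map_congr {f g : ℕ → ℕ} {t : Token ν} (h : ∀ i ∈ t.ids, f i = g i) :
    t.map f = t.map g := by
  simp only [Token.map, Token.mk.injEq, true_and]
  exact List.map_congr_left h

theorem Token.map_id (t : Token ν) : t.map id = t := by simp [Token.map]

theorem Token.map_injective {f : ℕ → ℕ} (hf : Function.Injective f) :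
    Function.Injective (Token.map f : Token ν → _) := by
  rintro ⟨n, is⟩ ⟨m, js⟩ h
  simp only [Token.map, Token.mk.injEq] at h
  rw [h.1, (List.map_injective_iff.2 hf) h.2]

theorem mem_storeVars_ren (ρ : Equiv.Perm ℕ) (π : ℕ → ℕ) (S : Multiset (IdAtom L κ)) :
    storeVars (S.map (IdAtom.ren ρ π)) = ρ '' storeVars S := by
  ext x
  simp only [storeVars, Set.mem_ofPred_eq, Multiset.mem_map, Set.mem_image]
  constructor
  · rintro ⟨_, ⟨h, hh, rfl⟩, hx⟩
    obtain ⟨y, hy, rfl⟩ := (h.chr.mem_vars_subst ρ x).1 hx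
    exact ⟨y, ⟨h, hh, hy⟩, rfl⟩
  · rintro ⟨y, ⟨h, hh, hy⟩, rfl⟩
    exact ⟨_, ⟨h, hh, rfl⟩, (h.chr.mem_vars_subst ρ _).2 ⟨y, hy, rfl⟩⟩

theorem IdAtom.ren_ren (ρ ρ' : Equiv.Perm ℕ) (π π' : ℕ → ℕ) (h : IdAtom L κ) :
    (h.ren ρ π).ren ρ' π' = h.ren (ρ' * ρ) (π' ∘ π) := by
  simp [IdAtom.ren, Atom.subst_ren_ren]

theorem IdAtom.ren_one_id (h : IdAtom L κ) : h.ren 1 _root_.id = h := by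
  simp [IdAtom.ren, Atom.subst_one]

theorem map_ren_congr {ρ ρ' : Equiv.Perm ℕ} {π π' : ℕ → ℕ} {S : Multiset (IdAtom L κ)}
    (hρ : ∀ x ∈ storeVars S, ρ x = ρ' x) (hπ : ∀ h ∈ S, π h.id = π' h.id) :
    S.map (IdAtom.ren ρ π) = S.map (IdAtom.ren ρ' π') :=
  Multiset.map_congr rfl fun h hh => by
    simp only [IdAtom.ren, IdAtom.mk.injEq]
    exact ⟨Atom.subst_congr fun x hx => hρ x ⟨h, hh, hx⟩, hπ h hh⟩

/-! ### Matching -/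

/-- The values of the arguments. -/
def Atom.val {M : Type*} [L.Structure M] (a : ℕ → M) (h : Atom L κ) : List M :=
  h.args.map fun t => t.realize a

theorem Matchable.length_eq {H K : List (Atom L κ)} (h : Matchable H K) : H.length = K.length :=
  List.Forall₂.length_eq h

theorem Matchable.append {H K H' K' : List (Atom L κ)} (h : Matchable H K) (h' : Matchable H' K') :
    Matchable (H ++ H') (K ++ K') :=
  List.rel_append h h'

theorem Matchable.subst {H K : List (Atom L κ)} (θ : ℕ → L.Term ℕ) (h : Matchable H K) :
    Matchable (H.map fun h => h.subst θ) (K.map fun h => h.subst θ) := by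
  induction h with
  | nil => exact .nil
  | cons h _ ih => exact .cons ⟨h.1, by simpa [Atom.subst] using h.2⟩ ih

theorem Matchable.subst_right {H K : List (Atom L κ)} (θ : ℕ → L.Term ℕ) (h : Matchable H K) :
    Matchable H (K.map fun h => h.subst θ) := by
  induction h with
  | nil => exact .nil
  | cons h _ ih => exact .cons ⟨h.1, by simpa [Atom.subst] using h.2⟩ ih

theorem holds_zipWith_mkEq {M : Type*} [L.Structure M] (a : ℕ → M) (s t : List (L.Term ℕ)) :
    s.length = t.length → ((∀ c ∈ List.zipWith mkEq s t, Holds a c) ↔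
      s.map (fun t => t.realize a) = t.map fun t => t.realize a) := by
  induction s generalizing t with
  | nil => intro h; cases t <;> simp_all
  | cons x s ih =>
    intro h
    cases t with
    | nil => simp at h
    | cons y t => simp [ih t (by simpa using h), holds_mkEq]

/-- `Matchable` rules out truncation by `zipWith`, so no argument is lost and matching can be
treated as equality of lists of values. -/
theorem holds_matchEqs {M : Type*} [L.Structure M] (a : ℕ → M) {H K : List (Atom L κ)}
    (h : Matchable H K) :
    Holds a (conj (matchEqs H K)) ↔ H.map (Atom.val a) = K.map (Atom.val a) := by
  rw [holds_conj]
  induction h with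
  | nil => simp [matchEqs]
  | @cons x y H K h _ ih =>
    have : matchEqs (x :: H) (y :: K) = List.zipWith mkEq x.args y.args ++ matchEqs H K := by
      simp [matchEqs]
    rw [this]
    simp only [List.mem_append, or_imp, forall_and, ih, holds_zipWith_mkEq a _ _ h.2]
    simp [Atom.val]

theorem val_subst {M : Type*} [L.Structure M] (θ : ℕ → L.Term ℕ) (a : ℕ → M) (h : Atom L κ) :
    (h.subst θ).val a = h.val fun x => (θ x).realize a := by
  simp [Atom.val, Atom.subst, Function.comp_def, Term.realize_subst]

theorem val_congr {M : Type*} [L.Structure M] {a b : ℕ → M} {h : Atom L κ}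
    (hab : ∀ x ∈ h.vars, a x = b x) : h.val a = h.val b :=
  List.map_congr_left fun t ht => realize_eq_of_eqOn t fun x hx => hab x ⟨t, ht, hx⟩

theorem map_val_congr {M : Type*} [L.Structure M] {a b : ℕ → M} {H : List (Atom L κ)}
    (hab : ∀ x ∈ atomsVars H, a x = b x) : H.map (Atom.val a) = H.map (Atom.val b) :=
  List.map_congr_left fun h hh => val_congr fun x hx => hab x ⟨h, hh, hx⟩

theorem eqOn_of_map_val_eq {CT : L.Theory} (hCT : ClarkEquality CT)
    (M : Theory.ModelType.{u, v, max u v} CT) {a b : ℕ → M} {H : List (Atom L κ)}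
    (h : H.map (Atom.val a) = H.map (Atom.val b)) : ∀ x ∈ atomsVars H, a x = b x := by
  rintro x ⟨k, hk, t, ht, hx⟩
  have h1 : k.val a = k.val b := List.map_inj_left.1 h k hk
  exact eqOn_of_realize_eq hCT M t (List.map_inj_left.1 h1 t ht) x hx

theorem conjVars_matchEqs_subset (H K : List (Atom L κ)) :
    conjVars (matchEqs H K) ⊆ atomsVars H ∪ atomsVars K := by
  rintro x ⟨c, hc, hx⟩
  simp only [matchEqs, List.mem_flatten] at hc
  obtain ⟨l, hl, hc⟩ := hc
  obtain ⟨n, hn, rfl⟩ := List.mem_iff_getElem.1 hl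
  simp only [List.getElem_zipWith] at hc
  obtain ⟨m, hm, rfl⟩ := List.mem_iff_getElem.1 hc
  simp only [List.getElem_zipWith, vars_mkEq] at hx
  rcases hx with hx | hx
  · exact Or.inl ⟨_, List.getElem_mem _, _, List.getElem_mem _, hx⟩
  · exact Or.inr ⟨_, List.getElem_mem _, _, List.getElem_mem _, hx⟩

theorem matchEqs_subst (θ : ℕ → L.Term ℕ) (H K : List (Atom L κ)) :
    (matchEqs H K).map (fun c => c.subst θ) =
      matchEqs (H.map fun h => h.subst θ) (K.map fun h => h.subst θ) := by
  simp only [matchEqs, List.map_flatten, List.map_zipWith, List.zipWith_map, Atom.subst, mkEq_subst]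

/-! ### Cleaning -/

/-- Injectivity ensures that an identifier is alive after the renaming only if it was alive before.
-/
theorem clean_map {f : ℕ → ℕ} (hf : Function.Injective f) {S S' : Multiset (IdAtom L κ)}
    (hS : S'.map IdAtom.id = S.map fun h => f h.id) (T : Set (Token ν)) :
    clean S' (Token.map f '' T) = Token.map f '' clean S T := by
  have key : ∀ i, (∃ h ∈ S', h.id = f i) ↔ ∃ h ∈ S, h.id = i := by
    intro i
    rw [← Multiset.mem_map, hS, Multiset.mem_map]
    simp [hf.eq_iff]
  ext t
  constructor
  · rintro ⟨⟨t, ht, rfl⟩, h⟩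
    exact ⟨t, ⟨ht, fun i hi => (key i).1 (h _ (List.mem_map_of_mem hi))⟩, rfl⟩
  · rintro ⟨t, ⟨ht, h⟩, rfl⟩
    refine ⟨⟨t, ht, rfl⟩, fun j hj => ?_⟩
    obtain ⟨i, hi, rfl⟩ := List.mem_map.1 hj
    exact (key i).2 (h i hi)

theorem clean_clean (S : Multiset (IdAtom L κ)) (T : Set (Token ν)) :
    clean S (clean S T) = clean S T := by
  ext t; simp only [clean, Set.mem_ofPred_eq, and_assoc, and_self]

end Atoms

/-! ### Variants of annotated rules. -/

section Renaming

variable {L : FirstOrder.Language.{u, v}} {κ : Type w} {ν : Type z}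

theorem ARule.vars_eq (r : ARule L κ ν) : r.vars =
    atomsVars r.heads ∪ conjVars r.guard ∪ storeVars r.bodyChr ∪ conjVars r.bodyBI := rfl

theorem ARule.vars_finite (r : ARule L κ ν) : r.vars.Finite :=
  (((atomsVars_finite _).union (conjVars_finite _)).union (storeVars_finite _)).union
    (conjVars_finite _)

theorem ARule.heads_rename (ρ : Equiv.Perm ℕ) (r : ARule L κ ν) :
    (r.rename ρ).heads = r.heads.map fun h => h.subst (renSubst L ρ) := by
  simp [ARule.heads, ARule.rename]

theorem ARule.bodyChr_rename (ρ : Equiv.Perm ℕ) (r : ARule L κ ν) :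
    (r.rename ρ).bodyChr = r.bodyChr.map (IdAtom.ren ρ _root_.id) := rfl

theorem ARule.vars_rename (ρ : Equiv.Perm ℕ) (r : ARule L κ ν) :
    (r.rename ρ).vars = ρ '' r.vars := by
  rw [ARule.vars_eq, ARule.vars_eq, heads_rename, bodyChr_rename, mem_atomsVars_map_subst,
    mem_storeVars_ren]
  simp only [ARule.rename, conjVars_map_subst, Set.image_union]

theorem ARule.rename_rename (ρ ρ' : Equiv.Perm ℕ) (r : ARule L κ ν) :
    (r.rename ρ).rename ρ' = r.rename (ρ' * ρ) := by
  simp [ARule.rename, Function.comp_def, Atom.subst_ren_ren, BuiltIn.subst_ren_ren, IdAtom.subst]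

theorem ARule.rename_congr {ρ ρ' : Equiv.Perm ℕ} {r : ARule L κ ν} (h : Set.EqOn ρ ρ' r.vars) :
    r.rename ρ = r.rename ρ' := by
  have hh : ∀ k ∈ r.heads, k.subst (renSubst L ρ) = k.subst (renSubst L ρ') := fun k hk =>
    Atom.subst_congr fun x hx => h (Or.inl (Or.inl (Or.inl ⟨k, hk, hx⟩)))
  simp only [ARule.rename, ARule.mk.injEq, true_and, and_true]
  refine ⟨?_, ?_, ?_, ?_, ?_⟩
  · exact List.map_congr_left fun k hk => hh k (List.mem_append_left _ hk)
  · exact List.map_congr_left fun k hk => hh k (List.mem_append_right _ hk)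
  · exact List.map_congr_left fun c hc => BuiltIn.subst_congr c fun x hx =>
      renSubst_eq (h (Or.inl (Or.inl (Or.inr ⟨c, hc, hx⟩))))
  · exact map_ren_congr (π := _root_.id) (π' := _root_.id) (fun x hx => h (Or.inl (Or.inr hx))) fun _ _ => rfl
  · exact List.map_congr_left fun c hc => BuiltIn.subst_congr c fun x hx =>
      renSubst_eq (h (Or.inr ⟨c, hc, hx⟩))

end Renaming

/-! ### States with solved built-in constraints -/

/-- A configuration in which all CHR constraints are identified and all built-in constraints
are solved. -/
structure MState (L : FirstOrder.Language.{u, v}) (κ : Type w) (ν : Type z) :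
    Type (max u v w z) where
  store : Multiset (IdAtom L κ)
  bi : Constraint L
  tokens : Set (Token ν)

section MState

variable {L : FirstOrder.Language.{u, v}} {κ : Type w} {ν : Type z} (CT : L.Theory)

def MState.vars (σ : MState L κ ν) : Set ℕ := storeVars σ.store ∪ σ.bi.vars

def MState.ren (ρ π : Equiv.Perm ℕ) (σ : MState L κ ν) : MState L κ ν :=
  ⟨σ.store.map (IdAtom.ren ρ π), σ.bi.subst (renSubst L ρ), Token.map π '' σ.tokens⟩

/-- The identifiers of the store are pairwise distinct. -/
def MState.Nodup (σ : MState L κ ν) : Prop := (σ.store.map IdAtom.id).Nodup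

/-- Equality up to equivalence of the built-in constraint and cleaning of the tokens. -/
structure MCong (σ τ : MState L κ ν) : Prop where
  store : σ.store = τ.store
  bi : Equivalent CT σ.bi τ.bi
  tokens : clean σ.store σ.tokens = clean τ.store τ.tokens

/-- The relation `≃'_V` on solved states. -/
def MEquiv (V : Set ℕ) (σ τ : MState L κ ν) : Prop :=
  (Inconsistent CT σ.bi ∧ Inconsistent CT τ.bi) ∨
    ∃ ρ π : Equiv.Perm ℕ, (∀ x ∈ V, ρ x = x) ∧ MCong CT (σ.ren ρ π) τ

/-- The rule `r` is applicable to the constraints `H₁, H₂` of the state `σ`. -/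
structure Fire (r : ARule L κ ν) (σ : MState L κ ν) (H₁ H₂ : List (IdAtom L κ))
    (G : Multiset (IdAtom L κ)) : Prop where
  store : σ.store = ↑H₁ + ↑H₂ + G
  kept : Matchable (H₁.map IdAtom.chr) r.kept
  removed : Matchable (H₂.map IdAtom.chr) r.removed
  entails : EntailsEx CT σ.bi (atomsVars r.heads)
    (BuiltIn.and (conj (matchEqs ((H₁ ++ H₂).map IdAtom.chr) r.heads)) (conj r.guard))
  token : (⟨r.name, (H₁ ++ H₂).map IdAtom.id⟩ : Token ν) ∉ σ.tokens

/-- `τ` results from `σ` by applying `r` to `H₁, H₂` and solving the built-in constraints of the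
body, where the identifiers of the body are chosen by `f`. -/
structure Res (r : ARule L κ ν) (σ : MState L κ ν) (H₁ H₂ : List (IdAtom L κ))
    (G : Multiset (IdAtom L κ)) (f : ℕ → ℕ) (τ : MState L κ ν) : Prop where
  inj : Set.InjOn f {i | ∃ h ∈ r.bodyChr, h.id = i}
  disj : ∀ h ∈ r.bodyChr, ∀ k ∈ σ.store, f h.id ≠ k.id
  store : τ.store = r.bodyChr.map (IdAtom.mapId f) + ↑H₁ + G
  bi : Equivalent CT τ.bi (BuiltIn.and (conj r.bodyBI)
    (BuiltIn.and (conj (matchEqs ((H₁ ++ H₂).map IdAtom.chr) r.heads)) σ.bi))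
  -- The old tokens are cleaned first: `f` need only avoid identifiers of the current store, so it
  -- may reuse one that occurs in a dead token, and that token must not be revived.
  tokens : clean τ.store τ.tokens = clean τ.store (clean σ.store σ.tokens ∪
    {t' | H₂ = [] ∧ t' = ⟨r.name, (H₁ ++ H₂).map IdAtom.id⟩} ∪ Token.map f '' r.tokens)

/-- One rule application followed by the solution of the built-in constraints of the body. -/
def MStep (P : Set (ARule L κ ν)) (V : Set ℕ) (σ τ : MState L κ ν) : Prop :=
  ¬ Inconsistent CT σ.bi ∧ ∃ r₀ ∈ P, ∃ ρ : Equiv.Perm ℕ,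
    Disjoint (r₀.rename ρ).vars (V ∪ σ.vars) ∧ ∃ H₁ H₂ G, Fire CT (r₀.rename ρ) σ H₁ H₂ G ∧
    ∃ f, Res CT (r₀.rename ρ) σ H₁ H₂ G f τ

variable {CT}

theorem MState.vars_finite (σ : MState L κ ν) : σ.vars.Finite :=
  (storeVars_finite _).union (BuiltIn.vars_finite _)

theorem MState.ren_ren (ρ π ρ' π' : Equiv.Perm ℕ) (σ : MState L κ ν) :
    (σ.ren ρ π).ren ρ' π' = σ.ren (ρ' * ρ) (π' * π) := by
  simp only [MState.ren, MState.mk.injEq, Multiset.map_map, BuiltIn.subst_ren_ren, true_and,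
    ← Set.image_comp]
  constructor
  · exact Multiset.map_congr rfl fun h _ => h.ren_ren _ _ _ _
  · congr 1
    funext t
    exact t.map_map _ _

theorem MState.ren_one (σ : MState L κ ν) : σ.ren 1 1 = σ := by
  have h1 : (IdAtom.ren 1 (1 : Equiv.Perm ℕ) : IdAtom L κ → _) = _root_.id :=
    funext fun h => h.ren_one_id
  have h2 : (Token.map (1 : Equiv.Perm ℕ) : Token ν → _) = _root_.id := funext fun t => t.map_id
  rw [MState.ren, h1, h2, BuiltIn.subst_one, Multiset.map_id, Set.image_id]

theorem MState.ren_congr {ρ ρ' : Equiv.Perm ℕ} (π : Equiv.Perm ℕ) {σ : MState L κ ν}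
    (h : Set.EqOn ρ ρ' σ.vars) : σ.ren ρ π = σ.ren ρ' π := by
  simp only [MState.ren, MState.mk.injEq, and_true]
  exact ⟨map_ren_congr (fun x hx => h (Or.inl hx)) fun _ _ => rfl,
    BuiltIn.subst_congr _ fun x hx => renSubst_eq (h (Or.inr hx))⟩

theorem map_id_ren (ρ π : Equiv.Perm ℕ) (S : Multiset (IdAtom L κ)) :
    (S.map (IdAtom.ren ρ π)).map IdAtom.id = S.map fun h => π h.id := by
  rw [Multiset.map_map]; rfl

theorem MState.clean_ren (ρ π : Equiv.Perm ℕ) (σ : MState L κ ν) :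
    clean (σ.ren ρ π).store (σ.ren ρ π).tokens = Token.map π '' clean σ.store σ.tokens :=
  clean_map π.injective (map_id_ren ρ π σ.store) _

theorem MCong.refl (σ : MState L κ ν) : MCong CT σ σ := ⟨rfl, .refl _, rfl⟩

theorem MCong.symm {σ τ : MState L κ ν} (h : MCong CT σ τ) : MCong CT τ σ :=
  ⟨h.store.symm, h.bi.symm, h.tokens.symm⟩

theorem MCong.trans {σ τ υ : MState L κ ν} (h : MCong CT σ τ) (h' : MCong CT τ υ) :
    MCong CT σ υ :=
  ⟨h.store.trans h'.store, h.bi.trans h'.bi, h.tokens.trans h'.tokens⟩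

theorem MCong.ren {σ τ : MState L κ ν} (h : MCong CT σ τ) (ρ π : Equiv.Perm ℕ) :
    MCong CT (σ.ren ρ π) (τ.ren ρ π) :=
  ⟨by simp only [MState.ren, h.store], h.bi.subst_ren ρ, by
    rw [MState.clean_ren, MState.clean_ren, h.tokens]⟩

/-- Renaming and logical equivalence preserve failure, so the two alternatives of ≃' do not
interfere; transitivity rests on this. -/
theorem MEquiv.failed_iff {V : Set ℕ} {σ τ : MState L κ ν} (h : MEquiv CT V σ τ) :
    Inconsistent CT σ.bi ↔ Inconsistent CT τ.bi := by
  rcases h with h | ⟨ρ, π, -, h⟩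
  · simp [h.1, h.2]
  · rw [← h.bi.inconsistent_iff]
    exact (inconsistent_subst_ren ρ _).symm

theorem MCong.equiv {σ τ : MState L κ ν} (h : MCong CT σ τ) (V : Set ℕ) : MEquiv CT V σ τ :=
  Or.inr ⟨1, 1, fun _ _ => rfl, by rwa [MState.ren_one]⟩

theorem MEquiv.refl (V : Set ℕ) (σ : MState L κ ν) : MEquiv CT V σ σ := (MCong.refl σ).equiv V

theorem MEquiv.symm {V : Set ℕ} {σ τ : MState L κ ν} (h : MEquiv CT V σ τ) : MEquiv CT V τ σ := by
  rcases h with h | ⟨ρ, π, hV, h⟩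
  · exact Or.inl h.symm
  · refine Or.inr ⟨ρ⁻¹, π⁻¹, fun x hx => ?_, ?_⟩
    · rw [Equiv.Perm.inv_eq_iff_eq, hV x hx]
    · have := (h.ren ρ⁻¹ π⁻¹).symm
      rwa [MState.ren_ren, inv_mul_cancel, inv_mul_cancel, MState.ren_one] at this

theorem MEquiv.trans {V : Set ℕ} {σ τ υ : MState L κ ν} (h : MEquiv CT V σ τ)
    (h' : MEquiv CT V τ υ) : MEquiv CT V σ υ := by
  by_cases hf : Inconsistent CT τ.bi
  · exact Or.inl ⟨h.failed_iff.2 hf, h'.failed_iff.1 hf⟩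
  · rcases h with h | ⟨ρ, π, hV, h⟩
    · exact absurd h.2 hf
    · rcases h' with h' | ⟨ρ', π', hV', h'⟩
      · exact absurd h'.1 hf
      · refine Or.inr ⟨ρ' * ρ, π' * π, fun x hx => by simp [hV x hx, hV' x hx], ?_⟩
        rw [← MState.ren_ren]
        exact (h.ren ρ' π').trans h'

theorem MEquiv.mono {V W : Set ℕ} {σ τ : MState L κ ν} (h : MEquiv CT W σ τ) (hVW : V ⊆ W) :
    MEquiv CT V σ τ :=
  h.imp_right fun ⟨ρ, π, hV, h⟩ => ⟨ρ, π, fun x hx => hV x (hVW hx), h⟩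

theorem map_chr_ren (ρ : Equiv.Perm ℕ) (π : ℕ → ℕ) (H : List (IdAtom L κ)) :
    (H.map (IdAtom.ren ρ π)).map IdAtom.chr =
      (H.map IdAtom.chr).map fun h => h.subst (renSubst L ρ) := by
  simp [IdAtom.ren, Function.comp_def]

theorem conj_matchEqs_ren (ρ : Equiv.Perm ℕ) (π : ℕ → ℕ) (H : List (IdAtom L κ))
    (r : ARule L κ ν) :
    conj (matchEqs ((H.map (IdAtom.ren ρ π)).map IdAtom.chr) (r.rename ρ).heads) =
      (conj (matchEqs (H.map IdAtom.chr) r.heads)).subst (renSubst L ρ) := by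
  rw [conj_subst, matchEqs_subst, map_chr_ren, ARule.heads_rename]

theorem conj_guard_rename (ρ : Equiv.Perm ℕ) (r : ARule L κ ν) :
    conj (r.rename ρ).guard = (conj r.guard).subst (renSubst L ρ) := by
  rw [conj_subst]; rfl

theorem conj_bodyBI_rename (ρ : Equiv.Perm ℕ) (r : ARule L κ ν) :
    conj (r.rename ρ).bodyBI = (conj r.bodyBI).subst (renSubst L ρ) := by
  rw [conj_subst]; rfl

theorem token_ren (ρ : Equiv.Perm ℕ) (π : ℕ → ℕ) (n : ν) (H : List (IdAtom L κ)) :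
    (⟨n, (H.map (IdAtom.ren ρ π)).map IdAtom.id⟩ : Token ν) =
      Token.map π ⟨n, H.map IdAtom.id⟩ := by
  simp [IdAtom.ren, Token.map, Function.comp_def]

theorem Fire.ren {r : ARule L κ ν} {σ : MState L κ ν} {H₁ H₂ : List (IdAtom L κ)}
    {G : Multiset (IdAtom L κ)} (h : Fire CT r σ H₁ H₂ G) (ρ π : Equiv.Perm ℕ) :
    Fire CT (r.rename ρ) (σ.ren ρ π) (H₁.map (IdAtom.ren ρ π)) (H₂.map (IdAtom.ren ρ π))
      (G.map (IdAtom.ren ρ π)) where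
  store := by simp [MState.ren, h.store]
  kept := by rw [map_chr_ren]; exact h.kept.subst _
  removed := by rw [map_chr_ren]; exact h.removed.subst _
  entails := by
    rw [← List.map_append, conj_matchEqs_ren, conj_guard_rename, ARule.heads_rename,
      mem_atomsVars_map_subst]
    exact h.entails.subst_ren ρ
  token := by
    rw [← List.map_append, token_ren]
    rintro ⟨t, ht, hteq⟩
    exact h.token (Token.map_injective π.injective hteq ▸ ht)

theorem mapId_ren (ρ π : Equiv.Perm ℕ) (f : ℕ → ℕ) (S : Multiset (IdAtom L κ)) :
    (S.map (IdAtom.mapId f)).map (IdAtom.ren ρ π) =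
      (S.map (IdAtom.ren ρ _root_.id)).map (IdAtom.mapId (π ∘ f)) := by
  rw [Multiset.map_map, Multiset.map_map]; rfl

theorem Res.ren {r : ARule L κ ν} {σ τ : MState L κ ν} {H₁ H₂ : List (IdAtom L κ)}
    {G : Multiset (IdAtom L κ)} {f : ℕ → ℕ} (h : Res CT r σ H₁ H₂ G f τ) (ρ π : Equiv.Perm ℕ) :
    Res CT (r.rename ρ) (σ.ren ρ π) (H₁.map (IdAtom.ren ρ π)) (H₂.map (IdAtom.ren ρ π))
      (G.map (IdAtom.ren ρ π)) (π ∘ f) (τ.ren ρ π) where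
  inj := by
    refine π.injective.comp_injOn (h.inj.mono ?_)
    rintro i ⟨k, hk, rfl⟩
    obtain ⟨l, hl, rfl⟩ := Multiset.mem_map.1 hk
    exact ⟨l, hl, rfl⟩
  disj := by
    intro k' hk' l' hl'
    obtain ⟨k, hk, rfl⟩ := Multiset.mem_map.1 hk'
    obtain ⟨l, hl, rfl⟩ := Multiset.mem_map.1 hl'
    exact fun h' => h.disj k hk l hl (π.injective h')
  store := by
    rw [ARule.bodyChr_rename, ← mapId_ren]
    simp [MState.ren, h.store]
  bi := by
    rw [← List.map_append, conj_matchEqs_ren, conj_bodyBI_rename]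
    exact h.bi.subst_ren ρ
  tokens := by
    rw [MState.clean_ren, h.tokens, ← clean_map π.injective (map_id_ren ρ π τ.store),
      Set.image_union, Set.image_union, ← Set.image_comp, MState.clean_ren]
    have h1 : (Token.map π ∘ Token.map f : Token ν → _) = Token.map (π ∘ f) :=
      funext fun t => t.map_map f π
    have h2 : Token.map π '' {t' : Token ν | H₂ = [] ∧ t' = ⟨r.name, (H₁ ++ H₂).map IdAtom.id⟩} =
        {t' | H₂.map (IdAtom.ren ρ π) = [] ∧ t' = ⟨(r.rename ρ).name,
          (H₁.map (IdAtom.ren ρ π) ++ H₂.map (IdAtom.ren ρ π)).map IdAtom.id⟩} := by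
      rw [← List.map_append, token_ren]
      ext t
      simp only [Set.mem_image, Set.mem_ofPred_eq, List.map_eq_nil_iff]
      constructor
      · rintro ⟨t, ⟨h, rfl⟩, rfl⟩; exact ⟨h, rfl⟩
      · rintro ⟨h, rfl⟩; exact ⟨_, ⟨h, rfl⟩, rfl⟩
    rw [h1, h2]
    rfl

/-- A token over identifiers of the store survives cleaning, so passing to a congruent state cannot
change whether the rule is blocked. -/
theorem Fire.congr {r : ARule L κ ν} {σ τ : MState L κ ν} {H₁ H₂ : List (IdAtom L κ)}
    {G : Multiset (IdAtom L κ)} (h : Fire CT r σ H₁ H₂ G) (hστ : MCong CT σ τ) :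
    Fire CT r τ H₁ H₂ G where
  store := hστ.store ▸ h.store
  kept := h.kept
  removed := h.removed
  entails := h.entails.mono hστ.bi.2 (.refl _)
  token := by
    intro ht
    have : (⟨r.name, (H₁ ++ H₂).map IdAtom.id⟩ : Token ν) ∈ clean τ.store τ.tokens := by
      refine ⟨ht, fun i hi => ?_⟩
      obtain ⟨k, hk, rfl⟩ := List.mem_map.1 hi
      refine ⟨k, ?_, rfl⟩
      rw [← hστ.store, h.store]
      rcases List.mem_append.1 hk with hk | hk <;> simp [hk]
    rw [← hστ.tokens] at this
    exact h.token this.1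

theorem Res.congr {r : ARule L κ ν} {σ τ σ' : MState L κ ν} {H₁ H₂ : List (IdAtom L κ)}
    {G : Multiset (IdAtom L κ)} {f : ℕ → ℕ} (h : Res CT r σ H₁ H₂ G f σ')
    (hστ : MCong CT σ τ) : Res CT r τ H₁ H₂ G f σ' where
  inj := h.inj
  disj := hστ.store ▸ h.disj
  store := h.store
  bi := h.bi.trans ((Equivalent.refl _).and ((Equivalent.refl _).and hστ.bi))
  tokens := hστ.tokens ▸ h.tokens

/-- Transitions are compatible with `≃'_V`, for any finite set of variables to be avoided. -/
theorem MEquiv.step {P : Set (ARule L κ ν)} {V W : Set ℕ} (hV : V.Finite) (hW : W.Finite)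
    {σ τ σ' : MState L κ ν} (h : MEquiv CT V σ τ) (hs : MStep CT P V σ σ') :
    ∃ τ', MStep CT P W τ τ' ∧ MEquiv CT V σ' τ' := by
  obtain ⟨hf, r₀, hr₀, ρ₀, hdisj, H₁, H₂, G, hfire, f, hres⟩ := hs
  rcases h with h | ⟨ρ, π, hρV, hcong⟩
  · exact absurd h.1 hf
  -- The renaming relating `σ` to `τ` is changed on the variables of the rule variant, which do not
  -- occur in `V` or `σ`, to make the variant fresh for `W` and `τ`. As `W` is arbitrary, the set of
  -- avoided variables can be exchanged freely.
  obtain ⟨ρ', hρ', hfresh⟩ := exists_perm_eqOn_disjoint (hV.union σ.vars_finite)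
    (r₀.rename ρ₀).vars_finite (hW.union τ.vars_finite) hdisj.symm ρ
  have hren : σ.ren ρ π = σ.ren ρ' π := MState.ren_congr π fun x hx => (hρ' (Or.inr hx)).symm
  rw [hren] at hcong
  refine ⟨σ'.ren ρ' π, ⟨?_, r₀, hr₀, ρ' * ρ₀, ?_, H₁.map (IdAtom.ren ρ' π),
    H₂.map (IdAtom.ren ρ' π), G.map (IdAtom.ren ρ' π), ?_, π ∘ f, ?_⟩, ?_⟩
  · rw [← hcong.bi.inconsistent_iff]
    exact fun h' => hf ((inconsistent_subst_ren ρ' _).1 h')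
  · rwa [← ARule.rename_rename, ARule.vars_rename]
  · rw [← ARule.rename_rename]
    exact (hfire.ren ρ' π).congr hcong
  · rw [← ARule.rename_rename]
    exact (hres.ren ρ' π).congr hcong
  · exact Or.inr ⟨ρ', π, fun x hx => (hρ' (Or.inl hx)).trans (hρV x hx), .refl _⟩

/-- The choice of the new identifiers is immaterial. -/
theorem Res.unique {r : ARule L κ ν} {σ τ τ' : MState L κ ν} {H₁ H₂ : List (IdAtom L κ)}
    {G : Multiset (IdAtom L κ)} {f f' : ℕ → ℕ}
    (htok : ∀ t ∈ r.tokens, ∀ i ∈ t.ids, ∃ h ∈ r.bodyChr, h.id = i)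
    (hst : σ.store = ↑H₁ + ↑H₂ + G) (h : Res CT r σ H₁ H₂ G f τ)
    (h' : Res CT r σ H₁ H₂ G f' τ') (V : Set ℕ) : MEquiv CT V τ τ' := by
  classical
  set A : Set ℕ := {i | ∃ h ∈ σ.store, h.id = i} with hA
  set B : Set ℕ := {i | ∃ h ∈ r.bodyChr, h.id = i} with hB
  have hAfin : A.Finite := (Multiset.finite_toSet (σ.store.map IdAtom.id)).subset
    fun i hi => by simpa [hA] using hi
  have hBfin : B.Finite := (Multiset.finite_toSet (r.bodyChr.map IdAtom.id)).subset
    fun i hi => by simpa [hB] using hi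
  have hdis : ∀ b ∈ B, f b ∉ A := by
    rintro _ ⟨k, hk, rfl⟩ ⟨l, hl, hkl⟩
    exact h.disj k hk l hl hkl.symm
  have hdis' : ∀ b ∈ B, f' b ∉ A := by
    rintro _ ⟨k, hk, rfl⟩ ⟨l, hl, hkl⟩
    exact h'.disj k hk l hl hkl.symm
  -- `π` fixes the identifiers of the old store and sends each new one `f b` to `f' b`; this is
  -- injective because new identifiers never lie in the old store.
  obtain ⟨π, hπ⟩ := exists_perm_eqOn
    (g := fun i => if i ∈ A then i else f' (Function.invFunOn f B i))
    (hAfin.union (hBfin.image f)) (by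
      have hinv : ∀ b ∈ B, Function.invFunOn f B (f b) = b := fun b hb =>
        h.inj.leftInvOn_invFunOn hb
      rintro i hi j hj hij
      rcases hi with hi | ⟨b, hb, rfl⟩ <;> rcases hj with hj | ⟨c, hc, rfl⟩
      · simpa [hi, hj] using hij
      · simp only [hi, if_true, hdis c hc, if_false, hinv c hc] at hij
        exact absurd (hij ▸ hi) (hdis' c hc)
      · simp only [hj, if_true, hdis b hb, if_false, hinv b hb] at hij
        exact absurd (hij ▸ hj) (hdis' b hb)
      · simp only [hdis b hb, hdis c hc, if_false, hinv b hb, hinv c hc] at hij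
        rw [h'.inj hb hc hij])
  have hπA : ∀ i ∈ A, π i = i := fun i hi => by simpa [hi] using hπ (Or.inl hi)
  have hπB : ∀ b ∈ B, π (f b) = f' b := fun b hb => by
    have := hπ (Or.inr ⟨b, hb, rfl⟩)
    simp only [hdis b hb, if_false] at this
    rw [this, h.inj.leftInvOn_invFunOn hb]
  have hfix : ∀ S : Multiset (IdAtom L κ), S ≤ σ.store → S.map (IdAtom.ren 1 π) = S := by
    intro S hS
    conv_rhs => rw [← Multiset.map_id S]
    refine Multiset.map_congr rfl fun k hk => ?_
    simp [IdAtom.ren, Atom.subst_one, hπA k.id ⟨k, Multiset.mem_of_le hS hk, rfl⟩]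
  have hstore : (τ.ren 1 π).store = τ'.store := by
    simp only [MState.ren, h.store, h'.store, Multiset.map_add]
    rw [hfix ↑H₁ (by rw [hst, add_assoc]; exact Multiset.le_add_right _ _),
      hfix G (by rw [hst]; exact Multiset.le_add_left _ _), Multiset.map_map]
    congr 2
    refine Multiset.map_congr rfl fun k hk => ?_
    simp [IdAtom.ren, IdAtom.mapId, Atom.subst_one, hπB k.id ⟨k, hk, rfl⟩]
  refine Or.inr ⟨1, π, fun _ _ => rfl, hstore, ?_, ?_⟩
  · simp only [MState.ren, BuiltIn.subst_one]
    exact h.bi.trans h'.bi.symm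
  · rw [MState.clean_ren, h.tokens, ← clean_map π.injective (map_id_ren 1 π τ.store),
      Set.image_union, Set.image_union, h'.tokens]
    change clean (τ.ren 1 π).store _ = _
    rw [hstore]
    -- This covers the cleaned old tokens and the token of the application. The local tokens of `r`
    -- mention only body identifiers, on which `π ∘ f` is `f'`.
    have hid : ∀ T : Set (Token ν), (∀ t ∈ T, ∀ i ∈ t.ids, i ∈ A) → Token.map π '' T = T := by
      intro T hT
      have : ∀ t ∈ T, Token.map π t = t := fun t ht => by
        rw [Token.map_congr (g := _root_.id) fun i hi => hπA i (hT t ht i hi), Token.map_id]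
      rw [Set.image_congr this, Set.image_id']
    rw [hid (clean σ.store σ.tokens) fun t ht i hi => ht.2 i hi, hid {t' | _}, ← Set.image_comp]
    · congr 2
      refine Set.image_congr fun t ht => ?_
      simp only [Function.comp, Token.map_map]
      exact Token.map_congr fun i hi => hπB i (htok t ht i hi)
    · rintro t ⟨-, rfl⟩ i hi
      obtain ⟨k, hk, rfl⟩ := List.mem_map.1 hi
      refine ⟨k, ?_, rfl⟩
      rw [hst]
      rcases List.mem_append.1 hk with hk | hk <;> simp [hk]

theorem Res.nodup {r : ARule L κ ν} {σ τ : MState L κ ν} {H₁ H₂ : List (IdAtom L κ)}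
    {G : Multiset (IdAtom L κ)} {f : ℕ → ℕ} (hnd : (r.bodyChr.map IdAtom.id).Nodup)
    (hσ : σ.Nodup) (hst : σ.store = ↑H₁ + ↑H₂ + G) (h : Res CT r σ H₁ H₂ G f τ) : τ.Nodup := by
  unfold MState.Nodup at *
  have hle : (↑H₁ + G : Multiset (IdAtom L κ)) ≤ σ.store := by
    rw [hst, add_right_comm]; exact Multiset.le_add_right _ _
  rw [h.store, add_assoc, Multiset.map_add, Multiset.nodup_add]
  refine ⟨?_, Multiset.nodup_of_le (Multiset.map_le_map hle) hσ, ?_⟩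
  · have : (r.bodyChr.map (IdAtom.mapId f)).map IdAtom.id = (r.bodyChr.map IdAtom.id).map f := by
      rw [Multiset.map_map, Multiset.map_map]; rfl
    rw [this]
    refine Multiset.Nodup.map_on (fun x hx y hy hxy => ?_) hnd
    exact h.inj (by simpa using hx) (by simpa using hy) hxy
  · rw [Multiset.disjoint_left]
    intro i hi hi'
    obtain ⟨k', hk', rfl⟩ := Multiset.mem_map.1 hi
    obtain ⟨k, hk, rfl⟩ := Multiset.mem_map.1 hk'
    obtain ⟨l, hl, hkl⟩ := Multiset.mem_map.1 hi'
    exact h.disj k hk l (Multiset.mem_of_le hle hl) hkl.symm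

end MState

/-! ### Well-formed rules and a canonical result of their application. -/

section Good

variable {L : FirstOrder.Language.{u, v}} {κ : Type w} {ν : Type z} {CT : L.Theory}

/-- Non-empty heads, a body with distinct positive identifiers, and a token store that refers to
the constraints of the body. -/
structure GoodRule (r : ARule L κ ν) : Prop where
  heads_ne : r.heads ≠ []
  nodup : (r.bodyChr.map IdAtom.id).Nodup
  pos : ∀ h ∈ r.bodyChr, 0 < h.id
  tokens : ∀ t ∈ r.tokens, ∀ i ∈ t.ids, ∃ h ∈ r.bodyChr, h.id = i

theorem GoodRule.rename {r : ARule L κ ν} (h : GoodRule r) (ρ : Equiv.Perm ℕ) :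
    GoodRule (r.rename ρ) where
  heads_ne := by simpa [ARule.heads_rename] using h.heads_ne
  nodup := by
    rw [ARule.bodyChr_rename, Multiset.map_map]
    exact h.nodup
  pos := by
    intro k hk
    obtain ⟨l, hl, rfl⟩ := Multiset.mem_map.1 hk
    exact h.pos l hl
  tokens := by
    intro t ht i hi
    obtain ⟨l, hl, rfl⟩ := h.tokens t ht i hi
    exact ⟨_, Multiset.mem_map_of_mem _ hl, rfl⟩

/-- The supremum of an unbounded set would be the default value `0`. Here the set is finite, since
the tokens refer only to the body. -/
theorem GoodRule.le_maxId {r : ARule L κ ν} (h : GoodRule r) {k : IdAtom L κ}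
    (hk : k ∈ r.bodyChr) : k.id ≤ maxId r.bodyChr r.tokens := by
  refine le_csSup ?_ (Or.inl ⟨k, hk, rfl⟩)
  refine Set.Finite.bddAbove ((Multiset.finite_toSet (r.bodyChr.map IdAtom.id)).subset ?_)
  rintro i (⟨l, hl, rfl⟩ | ⟨t, ht, hi⟩)
  · exact Multiset.mem_map_of_mem _ hl
  · obtain ⟨l, hl, rfl⟩ := h.tokens t ht i hi
    exact Multiset.mem_map_of_mem _ hl

/-- The result of applying a rule, with the identifiers of the body incremented by `N`. -/
def fireRes (r : ARule L κ ν) (σ : MState L κ ν) (H₁ H₂ : List (IdAtom L κ))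
    (G : Multiset (IdAtom L κ)) (N : ℕ) : MState L κ ν where
  store := r.bodyChr.map (IdAtom.mapId (· + N)) + ↑H₁ + G
  bi := BuiltIn.and (conj r.bodyBI)
    (BuiltIn.and (conj (matchEqs ((H₁ ++ H₂).map IdAtom.chr) r.heads)) σ.bi)
  tokens := clean σ.store σ.tokens ∪
    {t' | H₂ = [] ∧ t' = ⟨r.name, (H₁ ++ H₂).map IdAtom.id⟩} ∪ Token.map (· + N) '' r.tokens

/-- Body identifiers are positive, so adding a bound `N` of the identifiers in use makes them fresh.
-/
theorem GoodRule.res_fireRes {r : ARule L κ ν} (h : GoodRule r) {σ : MState L κ ν}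
    (H₁ H₂ : List (IdAtom L κ)) (G : Multiset (IdAtom L κ)) {N : ℕ}
    (hN : ∀ k ∈ σ.store, k.id ≤ N) :
    Res CT r σ H₁ H₂ G (· + N) (fireRes r σ H₁ H₂ G N) where
  inj := (add_left_injective N).injOn
  disj := fun k hk l hl hkl => by
    have := h.pos k hk
    have := hN l hl
    omega
  store := rfl
  bi := .refl _
  tokens := rfl

theorem exists_id_bound (S : Multiset (IdAtom L κ)) : ∃ N, ∀ k ∈ S, k.id ≤ N := by
  obtain ⟨N, hN⟩ := (Multiset.finite_toSet (S.map IdAtom.id)).bddAbove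
  exact ⟨N, fun k hk => hN (Multiset.mem_map_of_mem _ hk)⟩

theorem atomsVars_subset_storeVars {H : List (IdAtom L κ)} {S : Multiset (IdAtom L κ)}
    (h : (↑H : Multiset (IdAtom L κ)) ≤ S) : atomsVars (H.map IdAtom.chr) ⊆ storeVars S := by
  rintro x ⟨k, hk, hx⟩
  obtain ⟨l, hl, rfl⟩ := List.mem_map.1 hk
  exact ⟨l, Multiset.mem_of_le h (Multiset.mem_coe.2 hl), hx⟩

theorem coe_append_le {H₁ H₂ : List (IdAtom L κ)} {G S : Multiset (IdAtom L κ)}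
    (h : S = ↑H₁ + ↑H₂ + G) : (↑(H₁ ++ H₂) : Multiset (IdAtom L κ)) ≤ S := by
  rw [h, ← Multiset.coe_add]; exact Multiset.le_add_right _ _

theorem fireRes_vars_subset {r : ARule L κ ν} {σ : MState L κ ν} {H₁ H₂ : List (IdAtom L κ)}
    {G : Multiset (IdAtom L κ)} (hst : σ.store = ↑H₁ + ↑H₂ + G) (N : ℕ) :
    (fireRes r σ H₁ H₂ G N).vars ⊆ r.vars ∪ σ.vars := by
  rintro x (⟨k, hk, hx⟩ | hx)
  · simp only [fireRes, Multiset.mem_add, Multiset.mem_map, Multiset.mem_coe] at hk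
    rcases hk with (⟨l, hl, rfl⟩ | hk) | hk
    · exact Or.inl (Or.inl (Or.inr ⟨l, hl, hx⟩))
    · exact Or.inr (Or.inl ⟨k, by simp [hst, hk], hx⟩)
    · exact Or.inr (Or.inl ⟨k, by simp [hst, hk], hx⟩)
  · simp only [fireRes, BuiltIn.vars, vars_conj] at hx
    rcases hx with hx | hx | hx
    · exact Or.inl (Or.inr hx)
    · rcases conjVars_matchEqs_subset _ _ hx with hx | hx
      · exact Or.inr (Or.inl (atomsVars_subset_storeVars (coe_append_le hst) hx))
      · exact Or.inl (Or.inl (Or.inl (Or.inl hx)))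
    · exact Or.inr (Or.inr hx)

/-! ### Unfoldings, semantically -/

variable (CT) in
/-- The rule `u` is the unfolding of `r` with `w` at `S₁, S₂`, and its guard is equivalent to that
of `r`. -/
structure IsUnf (r w u : ARule L κ ν) (K : Multiset (IdAtom L κ)) (S₁ S₂ : List (IdAtom L κ)) :
    Prop where
  body : r.bodyChr = K + ↑S₁ + ↑S₂
  kept : Matchable (S₁.map IdAtom.chr) w.kept
  removed : Matchable (S₂.map IdAtom.chr) w.removed
  entails : EntailsEx CT (BuiltIn.and (conj r.bodyBI) (conj r.guard)) (atomsVars w.heads)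
    (BuiltIn.and (conj (matchEqs ((S₁ ++ S₂).map IdAtom.chr) w.heads)) (conj w.guard))
  token : (⟨w.name, (S₁ ++ S₂).map IdAtom.id⟩ : Token ν) ∉ r.tokens
  name_eq : u.name = r.name
  kept_eq : u.kept = r.kept
  removed_eq : u.removed = r.removed
  guard : Equivalent CT (conj r.guard) (conj u.guard)
  bodyChr_eq : u.bodyChr =
    K + ↑S₁ + w.bodyChr.map (IdAtom.mapId (· + maxId r.bodyChr r.tokens))
  bodyBI_eq : u.bodyBI = w.bodyBI ++ r.bodyBI ++ matchEqs ((S₁ ++ S₂).map IdAtom.chr) w.heads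
  tokens_eq : u.tokens = clean (K + (↑S₁ : Multiset (IdAtom L κ))) r.tokens ∪
    Token.map (· + maxId r.bodyChr r.tokens) '' w.tokens ∪
    {t | w.removed = [] ∧ t = ⟨w.name, (S₁ ++ S₂).map IdAtom.id⟩}

/-- The substitution `θ` supplies the values of the head variables. A guard constraint of the second
rule is either entailed by `C ∧ D` or belongs to `D''`; in the second case its instance follows from
`D`, which is equivalent to the guard of the unfolding. Afterwards `θ` can be forgotten. -/
theorem Unfolds.isUnf {r w₀ u : ARule L κ ν} {ids : List ℕ} (h : Unfolds CT r w₀ ids u)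
    (hg : Equivalent CT (conj r.guard) (conj u.guard)) :
    ∃ ρ K S₁ S₂, Disjoint r.vars (w₀.rename ρ).vars ∧ IsUnf CT r (w₀.rename ρ) u K S₁ S₂ := by
  obtain ⟨ρ, w, rfl, hdisj, K, S₁, S₂, θ, CD, D'', hbody, hk, hr, hθ, rfl, hent, rfl, htok, rfl,
    -, rfl⟩ := h
  refine ⟨ρ, K, S₁, S₂, hdisj, hbody, hk, hr, ?_, htok, rfl, rfl, rfl, hg, rfl, rfl, rfl⟩
  have hm : Matchable ((S₁ ++ S₂).map IdAtom.chr) (w₀.rename ρ).heads := by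
    rw [List.map_append]
    exact hk.append hr
  intro M a ha
  refine ⟨fun x => (θ x).realize a, fun x hx => by simp [hθ x hx], ?_, ?_⟩
  · have h1 := hent M a ha
    rw [holds_matchEqs _ (hm.subst_right θ)] at h1
    refine (holds_matchEqs _ hm).2 ?_
    have h2 : (Atom.val a ∘ fun h : Atom L κ => h.subst θ) = Atom.val fun x => (θ x).realize a :=
      funext fun h => val_subst θ a h
    refine Eq.trans (map_val_congr fun x hx => ?_) (h1.trans (List.map_map.trans (by rw [h2])))
    -- The body of `r` shares no variable with the variant of `w₀`, so `θ` fixes the variables of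
    -- the matched constraints.
    have hxr : x ∈ r.vars := by
      obtain ⟨k, hk, hx⟩ := hx
      obtain ⟨l, hl, rfl⟩ := List.mem_map.1 hk
      refine Or.inl (Or.inr ⟨l, ?_, hx⟩)
      rw [hbody]
      rcases List.mem_append.1 hl with hl | hl <;> simp [hl]
    rw [hθ x fun hx' => Set.disjoint_left.1 hdisj hxr (Or.inl (Or.inl (Or.inl hx')))]
    rfl
  · refine (holds_conj _ _).2 fun c hc => ?_
    rw [← holds_subst]
    by_cases hE : Entails CT (BuiltIn.and (conj r.bodyBI) (conj r.guard)) (c.subst θ)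
    · exact hE M a ha
    · have h1 := hg.1 M a ha.2
      refine (holds_conj _ _).1 h1 _ (List.mem_append_right _ ?_)
      exact List.mem_map.2 ⟨c, List.mem_filter.2 ⟨hc, by simpa using hE⟩, rfl⟩

theorem maxId_rename (ρ : Equiv.Perm ℕ) (r : ARule L κ ν) :
    maxId (r.rename ρ).bodyChr (r.rename ρ).tokens = maxId r.bodyChr r.tokens := by
  rw [ARule.bodyChr_rename]
  simp only [maxId]
  congr 2
  ext i
  simp [IdAtom.ren]

theorem clean_ren_id (ρ : Equiv.Perm ℕ) (S : Multiset (IdAtom L κ)) (T : Set (Token ν)) :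
    clean (S.map (IdAtom.ren ρ _root_.id)) T = clean S T := by
  ext t
  simp [clean, IdAtom.ren]

theorem map_id_ren_id (ρ : Equiv.Perm ℕ) (H : List (IdAtom L κ)) :
    (H.map (IdAtom.ren ρ _root_.id)).map IdAtom.id = H.map IdAtom.id := by
  rw [List.map_map]; rfl

theorem IsUnf.rename {r w u : ARule L κ ν} {K : Multiset (IdAtom L κ)} {S₁ S₂ : List (IdAtom L κ)}
    (h : IsUnf CT r w u K S₁ S₂) (ρ : Equiv.Perm ℕ) :
    IsUnf CT (r.rename ρ) (w.rename ρ) (u.rename ρ) (K.map (IdAtom.ren ρ _root_.id))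
      (S₁.map (IdAtom.ren ρ _root_.id)) (S₂.map (IdAtom.ren ρ _root_.id)) where
  body := by rw [ARule.bodyChr_rename, h.body]; simp
  kept := by rw [map_chr_ren]; exact h.kept.subst _
  removed := by rw [map_chr_ren]; exact h.removed.subst _
  entails := by
    rw [← List.map_append, conj_matchEqs_ren, conj_guard_rename, conj_guard_rename,
      conj_bodyBI_rename, ARule.heads_rename, mem_atomsVars_map_subst]
    exact h.entails.subst_ren ρ
  token := by
    rw [← List.map_append, map_id_ren_id]
    exact h.token
  name_eq := h.name_eq
  kept_eq := by simp [ARule.rename, h.kept_eq]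
  removed_eq := by simp [ARule.rename, h.removed_eq]
  guard := by
    rw [conj_guard_rename, conj_guard_rename]
    exact h.guard.subst_ren ρ
  bodyChr_eq := by
    rw [maxId_rename, ARule.bodyChr_rename, ARule.bodyChr_rename, h.bodyChr_eq]
    simp only [Multiset.map_add, Multiset.map_map, Multiset.map_coe]
    rfl
  bodyBI_eq := by
    rw [← List.map_append, map_chr_ren, ARule.heads_rename, ← matchEqs_subst]
    simp [ARule.rename, h.bodyBI_eq]
  tokens_eq := by
    rw [maxId_rename, ← List.map_append, map_id_ren_id]
    have : (K.map (IdAtom.ren ρ _root_.id) + ↑(S₁.map (IdAtom.ren ρ _root_.id)) :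
        Multiset (IdAtom L κ)) = (K + ↑S₁).map (IdAtom.ren ρ _root_.id) := by simp
    rw [this, clean_ren_id]
    simp [ARule.rename, h.tokens_eq]

theorem IsUnf.heads_eq {r w u : ARule L κ ν} {K : Multiset (IdAtom L κ)}
    {S₁ S₂ : List (IdAtom L κ)} (h : IsUnf CT r w u K S₁ S₂) : u.heads = r.heads := by
  rw [ARule.heads, h.kept_eq, h.removed_eq]; rfl

/-- The identifiers taken from `w` are shifted beyond those of `r`. The token of the unfolding step
is recorded only if `w` removes nothing, and then all its identifiers stay in the body. -/
theorem IsUnf.good {r w u : ARule L κ ν} {K : Multiset (IdAtom L κ)} {S₁ S₂ : List (IdAtom L κ)}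
    (h : IsUnf CT r w u K S₁ S₂) (hr : GoodRule r) (hw : GoodRule w) : GoodRule u where
  heads_ne := h.heads_eq ▸ hr.heads_ne
  nodup := by
    have hle : (K + ↑S₁ : Multiset (IdAtom L κ)) ≤ r.bodyChr := by
      rw [h.body]; exact Multiset.le_add_right _ _
    rw [h.bodyChr_eq, Multiset.map_add, Multiset.nodup_add]
    refine ⟨Multiset.nodup_of_le (Multiset.map_le_map hle) hr.nodup, ?_, ?_⟩
    · have := Multiset.Nodup.map (add_left_injective (maxId r.bodyChr r.tokens)) hw.nodup
      rw [Multiset.map_map] at this ⊢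
      exact this
    · rw [Multiset.disjoint_left]
      intro i hi hi'
      obtain ⟨k, hk, rfl⟩ := Multiset.mem_map.1 hi
      obtain ⟨l', hl', hkl⟩ := Multiset.mem_map.1 hi'
      obtain ⟨l, hl, rfl⟩ := Multiset.mem_map.1 hl'
      have := hr.le_maxId (Multiset.mem_of_le hle hk)
      have := hw.pos l hl
      simp only [IdAtom.mapId] at hkl
      omega
  pos := by
    intro k hk
    rw [h.bodyChr_eq] at hk
    rcases Multiset.mem_add.1 hk with hk | hk
    · exact hr.pos k (by rw [h.body]; exact Multiset.mem_add.2 (Or.inl hk))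
    · obtain ⟨l, hl, rfl⟩ := Multiset.mem_map.1 hk
      exact Nat.add_pos_left (hw.pos l hl) _
  tokens := by
    intro t ht i hi
    rw [h.tokens_eq] at ht
    rw [h.bodyChr_eq]
    rcases ht with (ht | ⟨t, ht, rfl⟩) | ⟨hrem, rfl⟩
    · obtain ⟨k, hk, rfl⟩ := ht.2 i hi
      exact ⟨k, Multiset.mem_add.2 (Or.inl hk), rfl⟩
    · obtain ⟨j, hj, rfl⟩ := List.mem_map.1 hi
      obtain ⟨k, hk, rfl⟩ := hw.tokens t ht j hj
      exact ⟨_, Multiset.mem_add.2 (Or.inr (Multiset.mem_map_of_mem _ hk)), rfl⟩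
    · have hS : S₂ = [] := by
        have := h.removed.length_eq
        rw [hrem] at this
        simpa using this
      subst hS
      obtain ⟨k, hk, rfl⟩ := List.mem_map.1 hi
      exact ⟨k, by simp at hk; simp [hk], rfl⟩

theorem IsUnf.fire_iff {r w u : ARule L κ ν} {K : Multiset (IdAtom L κ)}
    {S₁ S₂ : List (IdAtom L κ)} (h : IsUnf CT r w u K S₁ S₂) {σ : MState L κ ν}
    {H₁ H₂ : List (IdAtom L κ)} {G : Multiset (IdAtom L κ)} :
    Fire CT u σ H₁ H₂ G ↔ Fire CT r σ H₁ H₂ G := by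
  constructor
  · intro hf
    refine ⟨hf.store, h.kept_eq ▸ hf.kept, h.removed_eq ▸ hf.removed, ?_, h.name_eq ▸ hf.token⟩
    rw [← h.heads_eq]
    exact hf.entails.mono (.refl _) ((Equivalent.refl _).and h.guard.symm).1
  · intro hf
    refine ⟨hf.store, h.kept_eq ▸ hf.kept, h.removed_eq ▸ hf.removed, ?_, h.name_eq ▸ hf.token⟩
    rw [h.heads_eq]
    exact hf.entails.mono (.refl _) ((Equivalent.refl _).and h.guard).1

theorem fireRes_id_le {r : ARule L κ ν} (hr : GoodRule r) {σ : MState L κ ν}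
    {H₁ H₂ : List (IdAtom L κ)} {G : Multiset (IdAtom L κ)} {N : ℕ}
    (hst : σ.store = ↑H₁ + ↑H₂ + G) (hN : ∀ k ∈ σ.store, k.id ≤ N) :
    ∀ k ∈ (fireRes r σ H₁ H₂ G N).store, k.id ≤ N + maxId r.bodyChr r.tokens := by
  intro k hk
  simp only [fireRes, Multiset.mem_add, Multiset.mem_map, Multiset.mem_coe] at hk
  rcases hk with (⟨l, hl, rfl⟩ | hk) | hk
  · have := hr.le_maxId hl
    simp only [IdAtom.mapId]
    omega
  · exact (hN k (by simp [hst, hk])).trans (Nat.le_add_right _ _)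
  · exact (hN k (by simp [hst, hk])).trans (Nat.le_add_right _ _)

theorem map_mapId_chr (f : ℕ → ℕ) (H : List (IdAtom L κ)) :
    (H.map (IdAtom.mapId f)).map IdAtom.chr = H.map IdAtom.chr := by
  rw [List.map_map]; rfl

theorem map_mapId_id (f : ℕ → ℕ) (n : ν) (H : List (IdAtom L κ)) :
    (⟨n, (H.map (IdAtom.mapId f)).map IdAtom.id⟩ : Token ν) =
      Token.map f ⟨n, H.map IdAtom.id⟩ := by
  simp only [Token.map, List.map_map]; rfl

/-- After an application of `r`, its unfolding partner is applicable to the body of `r`. -/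
theorem IsUnf.fire_snd (hCT : ClarkEquality CT) {r w u : ARule L κ ν} {K : Multiset (IdAtom L κ)}
    {S₁ S₂ : List (IdAtom L κ)} (h : IsUnf CT r w u K S₁ S₂) (hr : GoodRule r) (hw : GoodRule w)
    {σ : MState L κ ν} {H₁ H₂ : List (IdAtom L κ)} {G : Multiset (IdAtom L κ)} {N : ℕ}
    (hN : ∀ k ∈ σ.store, k.id ≤ N) (hdisj : Disjoint r.vars σ.vars)
    (hfire : Fire CT r σ H₁ H₂ G) :
    Fire CT w (fireRes r σ H₁ H₂ G N) (S₁.map (IdAtom.mapId (· + N)))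
      (S₂.map (IdAtom.mapId (· + N))) (K.map (IdAtom.mapId (· + N)) + ↑H₁ + G) where
  store := by
    simp only [fireRes, h.body, Multiset.map_add, Multiset.map_coe]
    abel
  kept := by rw [map_mapId_chr]; exact h.kept
  removed := by rw [map_mapId_chr]; exact h.removed
  entails := by
    rw [← List.map_append, map_mapId_chr]
    refine h.entails.mono ?_ (.refl _)
    rintro M a ⟨hB, hE, hσ⟩
    refine ⟨hB, ?_⟩
    -- `b` witnesses the applicability of `r` before the step. It satisfies the same matching
    -- equations as `a`, so the two agree on the head variables by injectivity, and hence
    -- everywhere; thus `a` itself satisfies the guard of `r`.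
    obtain ⟨b, hb, hbE, hbg⟩ := hfire.entails M a hσ
    have hm := hfire.kept.append hfire.removed
    rw [← List.map_append] at hm
    have hE' := (holds_matchEqs a hm).1 hE
    have hbE' := (holds_matchEqs b hm).1 hbE
    have hab : ((H₁ ++ H₂).map IdAtom.chr).map (Atom.val a) =
        ((H₁ ++ H₂).map IdAtom.chr).map (Atom.val b) := by
      refine map_val_congr fun x hx => (hb x fun hx' => ?_).symm
      exact Set.disjoint_left.1 hdisj (Or.inl (Or.inl (Or.inl hx')))
        (Or.inl (atomsVars_subset_storeVars (coe_append_le hfire.store) hx))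
    have heq := eqOn_of_map_val_eq hCT M (hE'.symm.trans (hab.trans hbE'))
    have : b = a := by
      funext x
      by_cases hx : x ∈ atomsVars r.heads
      · exact (heq x hx).symm
      · exact hb x hx
    exact this ▸ hbg
  token := by
    rw [← List.map_append, map_mapId_id]
    -- Since `w` has a head, some body constraint is matched. Its shifted identifier exceeds `N`, so
    -- the token could come only from the local store of `r`, where `h.token` excludes it.
    have hne : ∃ k, k ∈ S₁ ++ S₂ := by
      refine List.exists_mem_of_ne_nil _ fun hnil => hw.heads_ne ?_
      have := (h.kept.append h.removed).length_eq
      rw [← List.map_append, hnil] at this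
      simpa [ARule.heads, eq_comm] using this
    obtain ⟨k, hk⟩ := hne
    have hkpos : 0 < k.id := hr.pos k (by
      rw [h.body]; rcases List.mem_append.1 hk with hk | hk <;> simp [hk])
    have hmem : k.id + N ∈ (Token.map (· + N) (⟨w.name, (S₁ ++ S₂).map IdAtom.id⟩ : Token ν)).ids :=
      List.mem_map_of_mem (f := (· + N)) (List.mem_map_of_mem hk)
    rintro ((ht | ⟨-, ht⟩) | ⟨t, ht, hteq⟩)
    · obtain ⟨l, hl, hlk⟩ := ht.2 _ hmem
      have := hN l hl
      omega
    · rw [ht] at hmem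
      obtain ⟨l, hl, hlk⟩ := List.mem_map.1 hmem
      have := hN l (Multiset.mem_of_le (coe_append_le hfire.store) (Multiset.mem_coe.2 hl))
      omega
    · exact h.token (Token.map_injective (add_left_injective N) hteq ▸ ht)

/-- Applying `r` and then its unfolding partner amounts to applying the unfolded rule. -/
theorem IsUnf.cong {r w u : ARule L κ ν} {K : Multiset (IdAtom L κ)}
    {S₁ S₂ : List (IdAtom L κ)} (h : IsUnf CT r w u K S₁ S₂) (hr : GoodRule r) (hw : GoodRule w)
    {σ : MState L κ ν} {H₁ H₂ : List (IdAtom L κ)} {G : Multiset (IdAtom L κ)} {N : ℕ}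
    (hst : σ.store = ↑H₁ + ↑H₂ + G) (hN : ∀ k ∈ σ.store, k.id ≤ N) :
    MCong CT (fireRes w (fireRes r σ H₁ H₂ G N) (S₁.map (IdAtom.mapId (· + N)))
      (S₂.map (IdAtom.mapId (· + N))) (K.map (IdAtom.mapId (· + N)) + ↑H₁ + G)
      (N + maxId r.bodyChr r.tokens)) (fireRes u σ H₁ H₂ G N) := by
  set m := maxId r.bodyChr r.tokens with hm
  have hstore : (fireRes w (fireRes r σ H₁ H₂ G N) (S₁.map (IdAtom.mapId (· + N)))
      (S₂.map (IdAtom.mapId (· + N))) (K.map (IdAtom.mapId (· + N)) + ↑H₁ + G) (N + m)).store =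
      (fireRes u σ H₁ H₂ G N).store := by
    simp only [fireRes, h.bodyChr_eq, Multiset.map_add, Multiset.map_coe, Multiset.map_map]
    -- The body of `w` is shifted by `m` in the unfolding and by `N` when the unfolding is applied;
    -- in the two-step computation both shifts occur at once.
    have : (IdAtom.mapId (· + (N + m)) : IdAtom L κ → _) =
        IdAtom.mapId (· + N) ∘ IdAtom.mapId (· + m) := by
      funext k
      simp only [IdAtom.mapId, Function.comp, IdAtom.mk.injEq, true_and]
      omega
    rw [this]
    abel
  refine ⟨hstore, ?_, ?_⟩
  · rw [equivalent_iff]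
    intro M a
    simp only [fireRes, holds_and, h.bodyBI_eq, h.heads_eq, holds_conj, List.mem_append, or_imp,
      forall_and, ← List.map_append, map_mapId_chr]
    tauto
  · rw [hstore]
    set S := (fireRes u σ H₁ H₂ G N).store with hS
    -- The identifiers of the final store lie in three disjoint ranges: up to `N` for the old store,
    -- from there up to `N + m` for the rest of the body of `r`, and above `N + m` for the body of
    -- `w`. The comparison of tokens rests on this.
    have hSmem : ∀ k ∈ S, (∃ l ∈ K + ↑S₁, l.id + N = k.id) ∨ (N + m < k.id) ∨
        (k ∈ (↑H₁ + G : Multiset (IdAtom L κ))) := by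
      intro k hk
      rw [hS] at hk
      simp only [fireRes, h.bodyChr_eq, Multiset.map_add, add_assoc, Multiset.mem_add,
        Multiset.mem_map] at hk
      rcases hk with ⟨l, hl, rfl⟩ | ⟨l, hl, rfl⟩ | ⟨l, ⟨j, hj, rfl⟩, rfl⟩ | hk | hk
      · exact Or.inl ⟨l, Multiset.mem_add.2 (Or.inl hl), rfl⟩
      · exact Or.inl ⟨l, Multiset.mem_add.2 (Or.inr hl), rfl⟩
      · have := hw.pos j hj
        refine Or.inr (Or.inl ?_)
        simp only [IdAtom.mapId]
        omega
      · exact Or.inr (Or.inr (Multiset.mem_add.2 (Or.inl hk)))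
      · exact Or.inr (Or.inr (Multiset.mem_add.2 (Or.inr hk)))
    have hle : ∀ k ∈ (↑H₁ + G : Multiset (IdAtom L κ)), k ∈ σ.store := by
      intro k hk
      rw [hst]
      rcases Multiset.mem_add.1 hk with hk | hk <;> simp_all
    have hrS : ∀ k ∈ S, k.id ≤ N + m → ∃ l ∈ (fireRes r σ H₁ H₂ G N).store, l.id = k.id := by
      intro k hk hkN
      rcases hSmem k hk with ⟨l, hl, hlk⟩ | hk | hk
      · refine ⟨l.mapId (· + N), ?_, hlk⟩
        simp only [fireRes, h.body, Multiset.map_add, Multiset.mem_add] at hl ⊢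
        rcases hl with hl | hl
        · exact Or.inl (Or.inl (Or.inl (Or.inl (Multiset.mem_map_of_mem _ hl))))
        · exact Or.inl (Or.inl (Or.inl (Or.inr (Multiset.mem_map_of_mem _ hl))))
      · omega
      · refine ⟨k, ?_, rfl⟩
        simp only [fireRes, add_assoc]
        exact Multiset.mem_add.2 (Or.inr hk)
    have hS₂ : S₂.map (IdAtom.mapId (· + N)) = [] ↔ w.removed = [] := by
      have := h.removed.length_eq
      rw [List.length_map] at this
      rw [List.map_eq_nil_iff, ← List.length_eq_zero_iff, ← List.length_eq_zero_iff, this]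
    have hcomp : ∀ t : Token ν, Token.map (· + (N + m)) t = (t.map (· + m)).map (· + N) := by
      intro t
      rw [Token.map_map]
      exact Token.map_congr fun i _ => by simp only [Function.comp]; omega
    have hrt : ∀ t ∈ r.tokens, ∀ i ∈ t.ids, 0 < i ∧ i ≤ m := by
      intro t ht i hi
      obtain ⟨l, hl, rfl⟩ := hr.tokens t ht i hi
      exact ⟨hr.pos l hl, hr.le_maxId hl⟩
    have htle : ∀ t ∈ (fireRes r σ H₁ H₂ G N).tokens, ∀ i ∈ t.ids, i ≤ N + m := by
      rintro t ((ht | ⟨-, rfl⟩) | ⟨t, ht, rfl⟩) i hi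
      · obtain ⟨l, hl, rfl⟩ := ht.2 i hi
        exact (hN l hl).trans (Nat.le_add_right _ _)
      · obtain ⟨l, hl, rfl⟩ := List.mem_map.1 hi
        exact (hN l (Multiset.mem_of_le (coe_append_le hst) (Multiset.mem_coe.2 hl))).trans
          (Nat.le_add_right _ _)
      · obtain ⟨j, hj, rfl⟩ := List.mem_map.1 hi
        have := (hrt t ht j hj).2
        omega
    ext t
    constructor
    · rintro ⟨ht, hc⟩
      refine ⟨?_, hc⟩
      rcases ht with (ht | ⟨hnil, rfl⟩) | ⟨t, ht, rfl⟩
      · obtain ⟨ht, -⟩ := ht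
        rcases ht with (ht | ht) | ⟨t, ht, rfl⟩
        · exact Or.inl (Or.inl ht)
        · rw [← h.name_eq] at ht
          exact Or.inl (Or.inr ht)
        · refine Or.inr ⟨t, ?_, rfl⟩
          rw [h.tokens_eq]
          -- A local token of `r` survives the final cleaning only if its identifiers, which lie in
          -- the middle range, belong to `K` or `S₁`. This is the cleaning built into the unfolding.
          refine Or.inl (Or.inl ⟨ht, fun i hi => ?_⟩)
          obtain ⟨k, hk, hki⟩ := hc (i + N) (List.mem_map_of_mem (f := (· + N)) hi)
          obtain ⟨hi0, him⟩ := hrt t ht i hi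
          rcases hSmem k hk with ⟨l, hl, hlk⟩ | hk | hk
          · exact ⟨l, hl, by omega⟩
          · omega
          · have := hN k (hle k hk)
            omega
      · refine Or.inr ⟨⟨w.name, (S₁ ++ S₂).map IdAtom.id⟩, ?_, ?_⟩
        · rw [h.tokens_eq]
          exact Or.inr ⟨hS₂.1 hnil, rfl⟩
        · rw [← List.map_append, map_mapId_id]
      · refine Or.inr ⟨t.map (· + m), ?_, (hcomp t).symm⟩
        rw [h.tokens_eq]
        exact Or.inl (Or.inr ⟨t, ht, rfl⟩)
    · rintro ⟨ht, hc⟩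
      refine ⟨?_, hc⟩
      -- The second application creates only identifiers above `N + m`, so a token of the
      -- intermediate state that is alive at the end was alive in between.
      have hlift : t ∈ (fireRes r σ H₁ H₂ G N).tokens → t ∈ clean (fireRes r σ H₁ H₂ G N).store
          (fireRes r σ H₁ H₂ G N).tokens := fun ht' => ⟨ht', fun i hi => by
        obtain ⟨k, hk, rfl⟩ := hc i hi
        exact hrS k hk (htle t ht' _ hi)⟩
      rcases ht with (ht | ht) | ⟨t, ht, rfl⟩
      · exact Or.inl (Or.inl (hlift (Or.inl (Or.inl ht))))
      · rw [h.name_eq] at ht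
        exact Or.inl (Or.inl (hlift (Or.inl (Or.inr ht))))
      · rw [h.tokens_eq] at ht
        rcases ht with (ht | ⟨t, ht, rfl⟩) | ⟨hnil, rfl⟩
        · exact Or.inl (Or.inl (hlift (Or.inr ⟨t, ht.1, rfl⟩)))
        · exact Or.inr ⟨t, ht, hcomp t⟩
        · refine Or.inl (Or.inr ⟨hS₂.2 hnil, ?_⟩)
          rw [← List.map_append, map_mapId_id]

end Good

/-! ### Termination and unique normal forms under rule replacement. -/

section Confluence

variable {L : FirstOrder.Language.{u, v}} {κ : Type w} {ν : Type z} (CT : L.Theory)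

/-- No transition is possible. -/
def MNormal (P : Set (ARule L κ ν)) (V : Set ℕ) (σ : MState L κ ν) : Prop :=
  ∀ τ, ¬ MStep CT P V σ τ

/-- Termination on solved states. -/
def MTerminating (P : Set (ARule L κ ν)) : Prop :=
  ∀ V : Set ℕ, V.Finite → ∀ σ : MState L κ ν, σ.Nodup →
    Acc (fun τ σ => MStep CT P V σ τ) σ

/-- Uniqueness of normal forms of solved states. -/
def MUnique (P : Set (ARule L κ ν)) : Prop :=
  ∀ V : Set ℕ, V.Finite → ∀ σ τ₁ τ₂ : MState L κ ν, σ.Nodup →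
    ReflTransGen (MStep CT P V) σ τ₁ → ReflTransGen (MStep CT P V) σ τ₂ →
    MNormal CT P V τ₁ → MNormal CT P V τ₂ → MEquiv CT V τ₁ τ₂

variable {CT} {P P' : Set (ARule L κ ν)} {V W : Set ℕ}

theorem MStep.nodup (hP : ∀ r ∈ P, GoodRule r) {σ τ : MState L κ ν} (h : MStep CT P V σ τ)
    (hσ : σ.Nodup) : τ.Nodup := by
  obtain ⟨-, r₀, hr₀, ρ, -, H₁, H₂, G, hfire, f, hres⟩ := h
  exact hres.nodup ((hP r₀ hr₀).rename ρ).nodup hσ hfire.store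

theorem nodup_of_reach (hP : ∀ r ∈ P, GoodRule r) {σ τ : MState L κ ν}
    (h : ReflTransGen (MStep CT P V) σ τ) (hσ : σ.Nodup) : τ.Nodup := by
  induction h with
  | refl => exact hσ
  | tail _ hs ih => exact hs.nodup hP ih

theorem MEquiv.reach (hV : V.Finite) (hW : W.Finite) {σ τ σ' : MState L κ ν}
    (h : MEquiv CT V σ τ) (hs : ReflTransGen (MStep CT P V) σ σ') :
    ∃ τ', ReflTransGen (MStep CT P W) τ τ' ∧ MEquiv CT V σ' τ' := by
  induction hs with
  | refl => exact ⟨τ, .refl, h⟩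
  | tail _ hs ih =>
    obtain ⟨τ₁, hτ₁, h₁⟩ := ih
    obtain ⟨τ₂, hτ₂, h₂⟩ := h₁.step hV hW hs
    exact ⟨τ₂, hτ₁.tail hτ₂, h₂⟩

/-- A transition of `τ` avoiding `W` is first exchanged for one avoiding `V`, which the equivalence
then carries back to `σ`. -/
theorem MNormal.of_equiv (hV : V.Finite) (hW : W.Finite) {σ τ : MState L κ ν}
    (hσ : MNormal CT P V σ) (h : MEquiv CT V σ τ) : MNormal CT P W τ := by
  intro τ' hτ'
  obtain ⟨τ₁, hτ₁, -⟩ := (MEquiv.refl W τ).step hW hV hτ'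
  obtain ⟨σ₁, hσ₁, -⟩ := h.symm.step hV hV hτ₁
  exact hσ σ₁ hσ₁

theorem mNormal_of_inconsistent {σ : MState L κ ν} (h : Inconsistent CT σ.bi) :
    MNormal CT P V σ := fun _ hs => hs.1 h

theorem MNormal.eq_of_reach {σ τ : MState L κ ν} (hσ : MNormal CT P V σ)
    (h : ReflTransGen (MStep CT P V) σ τ) : τ = σ := by
  rcases h.cases_head with h | ⟨_, h, -⟩
  · exact h.symm
  · exact absurd h (hσ _)

theorem exists_mNormal {σ : MState L κ ν} (h : Acc (fun τ σ => MStep CT P V σ τ) σ) :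
    ∃ τ, ReflTransGen (MStep CT P V) σ τ ∧ MNormal CT P V τ := by
  induction h with
  | intro σ _ ih =>
    by_cases hσ : MNormal CT P V σ
    · exact ⟨σ, .refl, hσ⟩
    · simp only [MNormal, not_forall, not_not] at hσ
      obtain ⟨τ, hτ⟩ := hσ
      obtain ⟨υ, hυ, hn⟩ := ih τ hτ
      exact ⟨υ, hυ.head hτ, hn⟩

/-- An application of `r` can be continued to an application of its unfolding. -/
theorem IsUnf.step (hCT : ClarkEquality CT) {r w u : ARule L κ ν} {K : Multiset (IdAtom L κ)}
    {S₁ S₂ : List (IdAtom L κ)} (h : IsUnf CT r w u K S₁ S₂) (hr : GoodRule r) (hw : GoodRule w)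
    (hrP : ∃ r₀ ∈ P, ∃ ρ, r = r₀.rename ρ) (hwP : ∃ w₀ ∈ P, ∃ ρ, w = w₀.rename ρ)
    {σ : MState L κ ν} (hrw : Disjoint r.vars w.vars) (hrV : Disjoint r.vars (V ∪ σ.vars))
    (hwV : Disjoint w.vars (V ∪ σ.vars)) (hf : ¬ Inconsistent CT σ.bi)
    {H₁ H₂ : List (IdAtom L κ)} {G : Multiset (IdAtom L κ)} (hfire : Fire CT r σ H₁ H₂ G) :
    ∃ (f : ℕ → ℕ) (σr σu : MState L κ ν), Res CT r σ H₁ H₂ G f σr ∧ Res CT u σ H₁ H₂ G f σu ∧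
      MStep CT P V σ σr ∧ ((Inconsistent CT σr.bi ∧ Inconsistent CT σu.bi) ∨
        ∃ σw, MStep CT P V σr σw ∧ MCong CT σw σu) := by
  obtain ⟨N, hN⟩ := exists_id_bound σ.store
  obtain ⟨r₀, hr₀, ρr, rfl⟩ := hrP
  obtain ⟨w₀, hw₀, ρw, rfl⟩ := hwP
  have hres := hr.res_fireRes (CT := CT) H₁ H₂ G hN
  have hstep : MStep CT P V σ (fireRes (r₀.rename ρr) σ H₁ H₂ G N) :=
    ⟨hf, r₀, hr₀, ρr, hrV, H₁, H₂, G, hfire, _, hres⟩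
  have hcong := h.cong hr hw hfire.store hN
  refine ⟨_, _, _, hres, (h.good hr hw).res_fireRes H₁ H₂ G hN, hstep, ?_⟩
  -- If the application of `r` fails, `w` can no longer be applied; but then the unfolding fails as
  -- well, because its resulting built-in constraint implies the one obtained from `r`.
  by_cases hfr : Inconsistent CT (fireRes (r₀.rename ρr) σ H₁ H₂ G N).bi
  · refine Or.inl ⟨hfr, ?_⟩
    rw [← hcong.bi.inconsistent_iff]
    exact fun M a ha => hfr M a ha.2.2
  · refine Or.inr ⟨_, ⟨hfr, w₀, hw₀, ρw, ?_, _, _, _,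
      h.fire_snd hCT hr hw hN (hrV.mono_right Set.subset_union_right) hfire, _,
      hw.res_fireRes _ _ _ (fireRes_id_le hr hfire.store hN)⟩, hcong⟩
    rw [Set.disjoint_union_right] at hwV ⊢
    exact ⟨hwV.1, Set.disjoint_of_subset_right (fireRes_vars_subset hfire.store N)
      (Set.disjoint_union_right.2 ⟨hrw.symm, hwV.2⟩)⟩

theorem disjoint_rename {ρ : Equiv.Perm ℕ} {r w : ARule L κ ν} (h : Disjoint r.vars w.vars) :
    Disjoint (r.rename ρ).vars (w.rename ρ).vars := by
  rw [ARule.vars_rename, ARule.vars_rename]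
  exact (Set.disjoint_image_iff ρ.injective).2 h

/-- A renaming can be changed off `A` so that it moves `A ∪ B` away from `F`. -/
theorem exists_perm_extend_fresh {A B F : Set ℕ} (hA : A.Finite) (hB : B.Finite) (hF : F.Finite)
    (ρ : Equiv.Perm ℕ) (h : Disjoint (ρ '' A) F) :
    ∃ ρ' : Equiv.Perm ℕ, Set.EqOn ρ' ρ A ∧ Disjoint (ρ' '' (A ∪ B)) F := by
  obtain ⟨ρ', h1, h2⟩ := exists_perm_eqOn_disjoint hA (hB.sdiff (t := A)) hF disjoint_sdiff_self_right ρ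
  refine ⟨ρ', h1, ?_⟩
  rw [← Set.union_sdiff_self, Set.image_union, h1.image_eq]
  exact h.union_left h2

variable (CT) in
/-- The data of one step of a U-sequence. -/
structure Replaces (P P' : Set (ARule L κ ν)) (r : ARule L κ ν) (U : Set (ARule L κ ν)) : Prop where
  mem : r ∈ P
  eq : P' = (P \ {r}) ∪ U
  unf : ∀ u ∈ U, ∃ w₀ ∈ P, ∃ ρ K S₁ S₂, Disjoint r.vars (w₀.rename ρ).vars ∧
    IsUnf CT r (w₀.rename ρ) u K S₁ S₂
  exists_unf : ∃ u, (∃ ρ : Equiv.Perm ℕ, u.rename ρ ∈ U) ∧ ∃ w₀ ∈ P, ∃ ρ K S₁ S₂,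
    Disjoint r.vars (w₀.rename ρ).vars ∧ IsUnf CT r (w₀.rename ρ) u K S₁ S₂

/-- Equivalence of the guards makes every unfolding an `IsUnf`, and the nonempty `UPlus` supplies
one, of which `U` contains at least a variant. -/
theorem UStep.replaces (h : UStep CT P P') : ∃ r U, Replaces CT P P' r U := by
  obtain ⟨r, U, hsafe, hUsub, hU, rfl⟩ := h
  have hunf : ∀ u ∈ Unf CT P r, ∃ w₀ ∈ P, ∃ ρ K S₁ S₂, Disjoint r.vars (w₀.rename ρ).vars ∧
      IsUnf CT r (w₀.rename ρ) u K S₁ S₂ := by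
    intro u hu
    obtain ⟨w₀, hw₀, ids, h⟩ := hu
    exact ⟨w₀, hw₀, h.isUnf (hsafe.guard u ⟨w₀, hw₀, ids, h⟩)⟩
  obtain ⟨p, hp, u, hu⟩ := hsafe.uPlus
  have hu' : u ∈ Unf CT P r := ⟨p.1, hp, p.2, hu⟩
  exact ⟨r, U, hsafe.mem, rfl, fun u hu => hunf u (hUsub hu), u, hU u hu', hunf u hu'⟩

variable {r : ARule L κ ν} {U : Set (ARule L κ ν)}

theorem Replaces.good (h : Replaces CT P P' r U) (hP : ∀ r ∈ P, GoodRule r) :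
    ∀ r ∈ P', GoodRule r := by
  rw [h.eq]
  rintro u (hu | hu)
  · exact hP u hu.1
  · obtain ⟨w₀, hw₀, ρ, K, S₁, S₂, -, hunf⟩ := h.unf u hu
    exact hunf.good (hP r h.mem) ((hP w₀ hw₀).rename ρ)

/-- Every transition of the unfolded program corresponds to a computation of the program. -/
theorem Replaces.transGen (hCT : ClarkEquality CT) (h : Replaces CT P P' r U)
    (hP : ∀ r ∈ P, GoodRule r) (hV : V.Finite) {σ τ : MState L κ ν} (hs : MStep CT P' V σ τ) :
    ∃ τ', TransGen (MStep CT P V) σ τ' ∧ MEquiv CT V τ' τ := by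
  obtain ⟨hf, u, hu, ρ, hdisj, H₁, H₂, G, hfire, f, hres⟩ := hs
  rw [h.eq] at hu
  rcases hu with hu | hu
  · exact ⟨τ, .single ⟨hf, u, hu.1, ρ, hdisj, H₁, H₂, G, hfire, f, hres⟩, .refl _ _⟩
  · obtain ⟨w₀, hw₀, ρw, K, S₁, S₂, hrw, hunf⟩ := h.unf u hu
    rw [ARule.vars_rename] at hdisj
    -- The given renaming makes only `u` fresh; it is changed off the variables of `u` so that the
    -- variants of `r` and `w₀` become fresh too.
    obtain ⟨ρ', hρ', hfresh⟩ := exists_perm_extend_fresh u.vars_finite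
      (r.vars_finite.union (w₀.rename ρw).vars_finite) (hV.union σ.vars_finite) ρ hdisj
    rw [← ARule.rename_congr hρ'] at hfire hres
    rw [Set.image_union, Set.image_union, ← ARule.vars_rename, ← ARule.vars_rename,
      ← ARule.vars_rename] at hfresh
    have hunf' := hunf.rename ρ'
    have hgr := (hP r h.mem).rename ρ'
    have hgw := ((hP w₀ hw₀).rename ρw).rename ρ'
    obtain ⟨f', σr, σu, -, hresu, hstep, hor⟩ := hunf'.step (P := P) (V := V) hCT hgr hgw
      ⟨r, h.mem, ρ', rfl⟩ ⟨w₀, hw₀, _, ARule.rename_rename _ _ _⟩ (disjoint_rename hrw)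
      (hfresh.mono_left (Set.subset_union_left.trans Set.subset_union_right))
      (hfresh.mono_left (Set.subset_union_right.trans Set.subset_union_right)) hf
      (hunf'.fire_iff.1 hfire)
    have hτ : MEquiv CT V σu τ :=
      hresu.unique (hunf'.good hgr hgw).tokens hfire.store hres V
    rcases hor with ⟨hfr, hfu⟩ | ⟨σw, hσw, hcong⟩
    · exact ⟨σr, .single hstep, Or.inl ⟨hfr, hτ.failed_iff.1 hfu⟩⟩
    · exact ⟨σw, .tail (.single hstep) hσw, (hcong.equiv V).trans hτ⟩

/-- After an application of the replaced rule, the program can catch up with an application of one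
of the unfolded rules. -/
theorem Replaces.exists_step (hCT : ClarkEquality CT) (h : Replaces CT P P' r U)
    (hP : ∀ r ∈ P, GoodRule r) (hV : V.Finite) {σ τ : MState L κ ν} (hs : MStep CT P V σ τ) :
    MStep CT P' V σ τ ∨ ∃ σu, MStep CT P' V σ σu ∧
      ((Inconsistent CT τ.bi ∧ Inconsistent CT σu.bi) ∨
        ∃ τ', MStep CT P V τ τ' ∧ MEquiv CT V τ' σu) := by
  obtain ⟨hf, r₁, hr₁, ρ, hdisj, H₁, H₂, G, hfire, f, hres⟩ := hs
  by_cases hrr : r₁ = r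
  · subst hrr
    obtain ⟨u, ⟨ρ₁, hu⟩, w₀, hw₀, ρw, K, S₁, S₂, hrw, hunf⟩ := h.exists_unf
    rw [ARule.vars_rename] at hdisj
    obtain ⟨ρ', hρ', hfresh⟩ := exists_perm_extend_fresh r₁.vars_finite
      (u.vars_finite.union (w₀.rename ρw).vars_finite) (hV.union σ.vars_finite) ρ hdisj
    rw [← ARule.rename_congr hρ'] at hfire hres
    rw [Set.image_union, Set.image_union, ← ARule.vars_rename, ← ARule.vars_rename,
      ← ARule.vars_rename] at hfresh
    have hunf' := hunf.rename ρ'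
    have hgr := (hP r₁ h.mem).rename ρ'
    have hgw := ((hP w₀ hw₀).rename ρw).rename ρ'
    obtain ⟨f', σr, σu, hresr, hresu, hstep, hor⟩ := hunf'.step (P := P) (V := V) hCT hgr hgw
      ⟨r₁, h.mem, ρ', rfl⟩ ⟨w₀, hw₀, _, ARule.rename_rename _ _ _⟩ (disjoint_rename hrw)
      (hfresh.mono_left Set.subset_union_left)
      (hfresh.mono_left (Set.subset_union_right.trans Set.subset_union_right)) hf hfire
    have hτ : MEquiv CT V σr τ := hresr.unique hgr.tokens hfire.store hres V
    -- Only `u.rename ρ₁` is known to lie in `U`, so the variant to be applied is rewritten as a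
    -- variant of it.
    have hueq : u.rename ρ' = (u.rename ρ₁).rename (ρ' * ρ₁⁻¹) := by
      rw [ARule.rename_rename, inv_mul_cancel_right]
    refine Or.inr ⟨σu, ⟨hf, u.rename ρ₁, h.eq ▸ Or.inr hu, ρ' * ρ₁⁻¹, ?_, H₁, H₂, G, ?_, f', ?_⟩, ?_⟩
    · rw [← hueq]
      exact hfresh.mono_left (Set.subset_union_left.trans Set.subset_union_right)
    · rw [← hueq]
      exact hunf'.fire_iff.2 hfire
    · rw [← hueq]
      exact hresu
    · rcases hor with ⟨hfr, hfu⟩ | ⟨σw, hσw, hcong⟩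
      · exact Or.inl ⟨hτ.failed_iff.1 hfr, hfu⟩
      · obtain ⟨τ', hτ', hw⟩ := hτ.step hV hV hσw
        exact Or.inr ⟨τ', hτ', hw.symm.trans (hcong.equiv V)⟩
  · exact Or.inl ⟨hf, r₁, h.eq ▸ Or.inl ⟨hr₁, hrr⟩, ρ, hdisj, H₁, H₂, G, hfire, f, hres⟩

/-- Both simulations preserve the existence of a first transition: `exists_step` yields one of `P'`,
and the chain in `transGen` begins with one of `P`. -/
theorem Replaces.mNormal_iff (hCT : ClarkEquality CT) (h : Replaces CT P P' r U)
    (hP : ∀ r ∈ P, GoodRule r) (hV : V.Finite) {σ : MState L κ ν} :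
    MNormal CT P' V σ ↔ MNormal CT P V σ := by
  constructor
  · intro hσ τ hs
    rcases h.exists_step hCT hP hV hs with hs | ⟨σu, hs, -⟩
    exacts [hσ _ hs, hσ _ hs]
  · intro hσ τ hs
    obtain ⟨τ', hτ', -⟩ := h.transGen hCT hP hV hs
    obtain ⟨σ₁, hσ₁, -⟩ := TransGen.head'_iff.1 hτ'
    exact hσ _ hσ₁

theorem Replaces.reach (hCT : ClarkEquality CT) (h : Replaces CT P P' r U)
    (hP : ∀ r ∈ P, GoodRule r) (hV : V.Finite) {σ τ : MState L κ ν}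
    (hs : ReflTransGen (MStep CT P' V) σ τ) :
    ∃ τ', ReflTransGen (MStep CT P V) σ τ' ∧ MEquiv CT V τ' τ := by
  induction hs with
  | refl => exact ⟨σ, .refl, .refl _ _⟩
  | tail _ hs ih =>
    obtain ⟨τ₁, hτ₁, h₁⟩ := ih
    obtain ⟨τ₂, hτ₂, h₂⟩ := h₁.symm.step hV hV hs
    obtain ⟨τ₃, hτ₃, h₃⟩ := h.transGen hCT hP hV hτ₂
    exact ⟨τ₃, hτ₁.trans hτ₃.to_reflTransGen, h₃.trans h₂.symm⟩

/-- A transition of `P'` is a nonempty chain of `P`, so the induction runs over the transitive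
closure; quantifying over all equivalent `τ` absorbs the errors up to ≃'. -/
theorem Replaces.acc (hCT : ClarkEquality CT) (h : Replaces CT P P' r U)
    (hP : ∀ r ∈ P, GoodRule r) (hV : V.Finite) {σ : MState L κ ν}
    (hσ : Acc (fun τ σ => MStep CT P V σ τ) σ) :
    ∀ τ, MEquiv CT V σ τ → Acc (fun τ σ => MStep CT P' V σ τ) τ := by
  have hσ' := hσ.transGen
  clear hσ
  induction hσ' with
  | intro σ _ ih =>
    intro τ hτ
    refine ⟨_, fun τ' hτ' => ?_⟩
    obtain ⟨σ', hσ', h'⟩ := hτ.symm.step hV hV hτ'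
    obtain ⟨σ₁, hσ₁, h₁⟩ := h.transGen hCT hP hV hσ'
    have hswap : TransGen (fun τ σ => MStep CT P V σ τ) σ₁ σ := transGen_swap.1 hσ₁
    exact ih σ₁ hswap τ' (h₁.trans h'.symm)

theorem Replaces.terminating (hCT : ClarkEquality CT) (h : Replaces CT P P' r U)
    (hP : ∀ r ∈ P, GoodRule r) (ht : MTerminating CT P) : MTerminating CT P' :=
  fun V hV σ hσ => h.acc hCT hP hV (ht V hV σ hσ) σ (.refl _ _)

/-- Normal forms of `P'` are reached by `P` up to ≃' and are normal there. -/
theorem Replaces.unique (hCT : ClarkEquality CT) (h : Replaces CT P P' r U)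
    (hP : ∀ r ∈ P, GoodRule r) (hu : MUnique CT P) : MUnique CT P' := by
  intro V hV σ τ₁ τ₂ hσ h₁ h₂ hn₁ hn₂
  obtain ⟨υ₁, hυ₁, e₁⟩ := h.reach hCT hP hV h₁
  obtain ⟨υ₂, hυ₂, e₂⟩ := h.reach hCT hP hV h₂
  have n₁ := ((h.mNormal_iff hCT hP hV).1 hn₁).of_equiv hV hV e₁.symm
  have n₂ := ((h.mNormal_iff hCT hP hV).1 hn₂).of_equiv hV hV e₂.symm
  exact e₁.symm.trans ((hu V hV σ υ₁ υ₂ hσ hυ₁ hυ₂ n₁ n₂).trans e₂)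

/-- If the unfolded program has unique normal forms, these are the normal forms of the program. -/
theorem Replaces.equiv_of_normal (hCT : ClarkEquality CT) (h : Replaces CT P P' r U)
    (hP : ∀ r ∈ P, GoodRule r) (ht : MTerminating CT P) (hu : MUnique CT P') (hV : V.Finite)
    {σ : MState L κ ν} (hacc : Acc (fun τ σ => MStep CT P V σ τ) σ) :
    σ.Nodup → ∀ τ υ, ReflTransGen (MStep CT P V) σ τ → MNormal CT P V τ →
      ReflTransGen (MStep CT P' V) σ υ → MNormal CT P' V υ → MEquiv CT V τ υ := by
  have ht' := h.terminating hCT hP ht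
  induction hacc with
  | intro σ _ ih =>
    intro hσ τ υ hτ hnτ hυ hnυ
    rcases hτ.cases_head with rfl | ⟨σ₁, hs, hτ⟩
    · rw [((h.mNormal_iff hCT hP hV).2 hnτ).eq_of_reach hυ]
      exact .refl _ _
    · have hσ₁ := hs.nodup hP hσ
      obtain ⟨υ₁, hυ₁, hnυ₁⟩ := exists_mNormal (ht' V hV σ₁ hσ₁)
      -- It remains to compare `υ₁`, a `P'`-normal form of the successor `σ₁`, with `υ`, one of `σ`
      -- itself.
      have e₁ := ih σ₁ hs hσ₁ τ υ₁ hτ hnτ hυ₁ hnυ₁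
      rcases h.exists_step hCT hP hV hs with hs' | ⟨σu, hsu, hor⟩
      · exact e₁.trans (hu V hV σ υ₁ υ hσ (hυ₁.head hs') hυ hnυ₁ hnυ)
      · obtain ⟨υ₂, hυ₂, hnυ₂⟩ := exists_mNormal (ht' V hV σu (hsu.nodup (h.good hP) hσ))
        have e₂ := hu V hV σ υ₂ υ hσ (hυ₂.head hsu) hυ hnυ₂ hnυ
        refine MEquiv.trans ?_ e₂
        rcases hor with ⟨hf₁, hfu⟩ | ⟨σw, hσw, hw⟩
        · rw [(mNormal_of_inconsistent hf₁).eq_of_reach hτ,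
            (mNormal_of_inconsistent hfu).eq_of_reach hυ₂]
          exact Or.inl ⟨hf₁, hfu⟩
        -- The `P'`-computation from `σu` to `υ₂` is turned into one of `P`, then carried along the
        -- equivalence of `σu` and `σw`. Its end `υ₄` is a `P`-normal form of `σ₁`, so the induction
        -- hypothesis at `σ₁`, used a second time, compares `υ₄` with `υ₁`.
        · obtain ⟨υ₃, hυ₃, e₃⟩ := h.reach hCT hP hV hυ₂
          obtain ⟨υ₄, hυ₄, e₄⟩ := hw.symm.reach hV hV hυ₃
          have n₃ := ((h.mNormal_iff hCT hP hV).1 hnυ₂).of_equiv hV hV (e₃.symm.trans e₄)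
          have e₅ := ih σ₁ hs hσ₁ υ₄ υ₁ (hυ₄.head hσw) n₃ hυ₁ hnυ₁
          exact e₁.trans (e₅.symm.trans (e₄.symm.trans e₃))

theorem Replaces.unique_iff (hCT : ClarkEquality CT) (h : Replaces CT P P' r U)
    (hP : ∀ r ∈ P, GoodRule r) (ht : MTerminating CT P) : MUnique CT P ↔ MUnique CT P' := by
  refine ⟨h.unique hCT hP, fun hu V hV σ τ₁ τ₂ hσ h₁ h₂ hn₁ hn₂ => ?_⟩
  obtain ⟨υ, hυ, hnυ⟩ := exists_mNormal (h.terminating hCT hP ht V hV σ hσ)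
  have key := h.equiv_of_normal hCT hP ht hu hV (ht V hV σ hσ) hσ
  exact (key τ₁ υ h₁ hn₁ hυ hnυ).trans (key τ₂ υ h₂ hn₂ hυ hnυ).symm

/-- Properties preserved along a U-sequence. -/
theorem IsUSequence.unique_iff (hCT : ClarkEquality CT) {n : ℕ}
    {Q : Fin (n + 1) → Set (ARule L κ ν)} (hQ : IsUSequence CT P n Q)
    (hP : ∀ r ∈ P, GoodRule r) (ht : MTerminating CT P) (i : Fin (n + 1)) :
    (∀ r ∈ Q i, GoodRule r) ∧ MTerminating CT (Q i) ∧ (MUnique CT P ↔ MUnique CT (Q i)) := by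
  induction i using Fin.induction with
  | zero => rw [hQ.1]; exact ⟨hP, ht, Iff.rfl⟩
  | succ i ih =>
    obtain ⟨hg, ht, hu⟩ := ih
    obtain ⟨r, U, h⟩ := (hQ.2 i).replaces
    exact ⟨h.good hg, h.terminating hCT hg ht, hu.trans (h.unique_iff hCT hg ht)⟩

end Confluence

universe y

/-! ### Interface between concrete configurations and solved states. -/

section Impl

variable {L : FirstOrder.Language.{u, v}} {κ : Type w} {ν : Type z}

/-- A transition system whose normal derivations implement, up to the preparatory transitions,
those of the annotated program `P` on solved states. -/
structure Impl (CT : L.Theory) (P : Set (ARule L κ ν)) (X : Type y) where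
  vars : X → Set ℕ
  WF : X → Prop
  nstep : Set ℕ → X → X → Prop
  step : Set ℕ → X → X → Prop
  equiv : Set ℕ → X → X → Prop
  abs : X → MState L κ ν → Prop
  complete : X → Prop
  size : X → ℕ
  vars_finite : ∀ x, (vars x).Finite
  wf_step : ∀ {V x x'}, WF x → nstep V x x' → WF x'
  nstep_step : ∀ {V x x'}, nstep V x x' → step V x x'
  nodup : ∀ {x m}, WF x → abs x m → m.Nodup
  exists_abs : ∀ {x}, WF x → ∃ m, abs x m
  abs_unique : ∀ {x m m'}, WF x → abs x m → abs x m' → ∀ V, MEquiv CT V m m'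
  sim : ∀ {V x x'}, WF x → nstep V x x' →
    ∃ m m', abs x m ∧ abs x' m' ∧ (MEquiv CT V m m' ∨ MStep CT P V m m')
  progress : ∀ {x} V, WF x → ¬ complete x → ∃ x', nstep V x x' ∧ size x' < size x ∧
    ∃ m m', abs x m ∧ abs x' m' ∧ MEquiv CT V m m'
  -- The rule variant must be fresh for `x` itself, and the interface does not relate the variables
  -- of `m` to those of `x`; hence `V ∪ vars x`.
  sim_back : ∀ {V x m m'}, WF x → complete x → abs x m → MStep CT P (V ∪ vars x) m m' →
    ∃ x' m'', nstep V x x' ∧ abs x' m'' ∧ MEquiv CT V m'' m'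
  step_back : ∀ {V x x'}, WF x → complete x → step V x x' → ∃ m m', abs x m ∧ MStep CT P V m m'
  equiv_iff : ∀ {V x x' m m'}, WF x → WF x' → complete x → complete x' → abs x m → abs x' m' →
    (equiv V x x' ↔ MEquiv CT V m m')
  -- Confluence at `x` compares results up to renaming outside `vars x`; because of `V ⊆ vars x`
  -- this implies equivalence up to renaming outside `V`.
  concretize : ∀ {m V}, m.Nodup → V.Finite → ∃ x m', WF x ∧ complete x ∧ V ⊆ vars x ∧
    abs x m' ∧ MEquiv CT V m' m

namespace Impl

variable {CT : L.Theory} {P : Set (ARule L κ ν)} {X : Type y} (I : Impl CT P X)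

/-- `m` is, up to renaming, the solved state of `x`. -/
def Rep (V : Set ℕ) (x : X) (m : MState L κ ν) : Prop := ∃ m₀, I.abs x m₀ ∧ MEquiv CT V m₀ m

/-- Confluence of the normal derivations. -/
def Confluent : Prop :=
  ∀ x x₁ x₂ : X, I.WF x → ReflTransGen (I.nstep (I.vars x)) x x₁ →
    ReflTransGen (I.nstep (I.vars x)) x x₂ →
    ∃ y₁ y₂, ReflTransGen (I.step (I.vars x)) x₁ y₁ ∧ ReflTransGen (I.step (I.vars x)) x₂ y₂ ∧
      I.equiv (I.vars x) y₁ y₂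

variable {I} {V : Set ℕ}

theorem wf_reach {x y : X} (hx : I.WF x) (h : ReflTransGen (I.nstep V) x y) : I.WF y := by
  induction h with
  | refl => exact hx
  | tail _ hs ih => exact I.wf_step ih hs

theorem Rep.of_abs {x : X} {m : MState L κ ν} (h : I.abs x m) : I.Rep V x m := ⟨m, h, .refl _ _⟩

theorem Rep.reach (hV : V.Finite) {x y : X} (hx : I.WF x) (h : ReflTransGen (I.nstep V) x y)
    {m : MState L κ ν} (hm : I.Rep V x m) :
    ∃ m', ReflTransGen (MStep CT P V) m m' ∧ I.Rep V y m' := by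
  induction h with
  | refl => exact ⟨m, .refl, hm⟩
  | tail hxy hs ih =>
    obtain ⟨m₁, hm₁, n, hn, e⟩ := ih
    obtain ⟨n₁, n₂, h₁, h₂, hor⟩ := I.sim (wf_reach hx hxy) hs
    have e₁ := I.abs_unique (wf_reach hx hxy) h₁ hn V
    rcases hor with e₂ | hst
    · exact ⟨m₁, hm₁, n₂, h₂, e₂.symm.trans (e₁.trans e)⟩
    · obtain ⟨m₂, hm₂, e₂⟩ := (e₁.trans e).step hV hV hst
      exact ⟨m₂, hm₁.tail hm₂, n₂, h₂, e₂⟩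

/-- Preparatory transitions decrease the size and leave the solved state unchanged up to ≃'. -/
theorem Rep.complete {x : X} {m : MState L κ ν} (hx : I.WF x) (h : I.Rep V x m) :
    ∃ y, ReflTransGen (I.nstep V) x y ∧ I.complete y ∧ I.Rep V y m := by
  induction hn : I.size x using Nat.strong_induction_on generalizing x with
  | _ n ih =>
    by_cases hc : I.complete x
    · exact ⟨x, .refl, hc, h⟩
    · obtain ⟨x', hs, hlt, m₁, m₂, h₁, h₂, e⟩ := I.progress V hx hc
      obtain ⟨m₀, h₀, e₀⟩ := h
      obtain ⟨y, hy, hcy, hr⟩ := ih (I.size x') (hn ▸ hlt) (I.wf_step hx hs)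
        ⟨m₂, h₂, e.symm.trans ((I.abs_unique hx h₁ h₀ V).trans e₀)⟩ rfl
      exact ⟨y, hy.head hs, hcy, hr⟩

/-- The rule application is followed by the preparatory transitions it makes necessary. That the
chain is nonempty is what transfers termination. -/
theorem Rep.step (hV : V.Finite) {x : X} {m m' : MState L κ ν} (hx : I.WF x)
    (hc : I.complete x) (h : I.Rep V x m) (hs : MStep CT P V m m') :
    ∃ y, TransGen (I.nstep V) x y ∧ I.complete y ∧ I.Rep V y m' := by
  obtain ⟨m₀, h₀, e₀⟩ := h
  obtain ⟨m₁, hs₁, e₁⟩ := e₀.symm.step hV (hV.union (I.vars_finite x)) hs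
  obtain ⟨x', m₂, hx', h₂, e₂⟩ := I.sim_back hx hc h₀ hs₁
  obtain ⟨y, hy, hcy, hr⟩ := Rep.complete (V := V) (I.wf_step hx hx')
    ⟨m₂, h₂, e₂.trans e₁.symm⟩
  exact ⟨y, .head' hx' hy, hcy, hr⟩

theorem Rep.steps (hV : V.Finite) {x : X} {m m' : MState L κ ν} (hx : I.WF x)
    (hc : I.complete x) (h : I.Rep V x m) (hs : ReflTransGen (MStep CT P V) m m') :
    ∃ y, ReflTransGen (I.nstep V) x y ∧ I.complete y ∧ I.Rep V y m' := by
  induction hs with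
  | refl => exact ⟨x, .refl, hc, h⟩
  | tail _ hs ih =>
    obtain ⟨y, hy, hcy, hr⟩ := ih
    obtain ⟨y', hy', hcy', hr'⟩ := hr.step hV (wf_reach hx hy) hcy hs
    exact ⟨y', hy.trans hy'.to_reflTransGen, hcy', hr'⟩

theorem Rep.eq_of_step (hV : V.Finite) {x y : X} {m : MState L κ ν} (hx : I.WF x)
    (hc : I.complete x) (h : I.Rep V x m) (hm : MNormal CT P V m)
    (hs : ReflTransGen (I.step V) x y) : y = x := by
  rcases hs.cases_head with h' | ⟨x', hs, -⟩
  · exact h'.symm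
  · obtain ⟨m₀, h₀, e₀⟩ := h
    obtain ⟨m₁, m₂, h₁, hs₁⟩ := I.step_back hx hc hs
    exact absurd hs₁ (hm.of_equiv hV hV ((I.abs_unique hx h₁ h₀ V).trans e₀).symm m₂)

theorem Rep.equiv_iff {x y : X} {m n : MState L κ ν} (hx : I.WF x) (hy : I.WF y)
    (hcx : I.complete x) (hcy : I.complete y) (hm : I.Rep V x m) (hn : I.Rep V y n) :
    I.equiv V x y ↔ MEquiv CT V m n := by
  obtain ⟨m₀, hm₀, em⟩ := hm
  obtain ⟨n₀, hn₀, en⟩ := hn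
  rw [I.equiv_iff hx hy hcx hcy hm₀ hn₀]
  exact ⟨fun h => em.symm.trans (h.trans en), fun h => em.trans (h.trans en.symm)⟩

theorem reach_step {x y : X} (h : ReflTransGen (I.nstep V) x y) :
    ReflTransGen (I.step V) x y := by
  induction h with
  | refl => exact .refl
  | tail _ hs ih => exact ih.tail (I.nstep_step hs)

/-- If the concrete system is confluent, two normal forms of a solved state are realized by complete
configurations in which nothing more can happen; the joining derivations are empty, so these
configurations are themselves equivalent. Conversely, both ends of a peak are driven to complete
configurations with normal solved states, which uniqueness makes equivalent. -/
theorem confluent_iff (hP : ∀ r ∈ P, GoodRule r) (ht : MTerminating CT P) :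
    I.Confluent ↔ MUnique CT P := by
  constructor
  · intro hI V hV σ τ₁ τ₂ hσ h₁ h₂ hn₁ hn₂
    obtain ⟨x, m, hx, hc, hVx, hm, e⟩ := I.concretize hσ hV
    have hW := I.vars_finite x
    obtain ⟨υ₁, hυ₁, e₁⟩ := e.symm.reach hV hW h₁
    obtain ⟨υ₂, hυ₂, e₂⟩ := e.symm.reach hV hW h₂
    have hn₁' := hn₁.of_equiv hV hW e₁
    have hn₂' := hn₂.of_equiv hV hW e₂
    obtain ⟨y₁, hy₁, hc₁, hr₁⟩ := (Rep.of_abs hm).steps hW hx hc hυ₁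
    obtain ⟨y₂, hy₂, hc₂, hr₂⟩ := (Rep.of_abs hm).steps hW hx hc hυ₂
    obtain ⟨z₁, z₂, hz₁, hz₂, hz⟩ := hI x y₁ y₂ hx hy₁ hy₂
    rw [hr₁.eq_of_step hW (wf_reach hx hy₁) hc₁ hn₁' hz₁,
      hr₂.eq_of_step hW (wf_reach hx hy₂) hc₂ hn₂' hz₂,
      Rep.equiv_iff (wf_reach hx hy₁) (wf_reach hx hy₂) hc₁ hc₂ hr₁ hr₂] at hz
    exact e₁.trans ((hz.mono hVx).trans e₂.symm)
  · intro hu x x₁ x₂ hx h₁ h₂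
    have hW := I.vars_finite x
    obtain ⟨m, hm⟩ := I.exists_abs hx
    have hmn := I.nodup hx hm
    have key : ∀ x', ReflTransGen (I.nstep (I.vars x)) x x' → ∃ y n,
        ReflTransGen (I.nstep (I.vars x)) x' y ∧ I.complete y ∧ I.Rep (I.vars x) y n ∧
        ReflTransGen (MStep CT P (I.vars x)) m n ∧ MNormal CT P (I.vars x) n := by
      intro x' hx'
      obtain ⟨m', hm', hr⟩ := Rep.reach hW hx hx' (Rep.of_abs hm)
      obtain ⟨n, hn, hnn⟩ := exists_mNormal (ht _ hW m' (nodup_of_reach hP hm' hmn))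
      obtain ⟨y, hy, hc, hr'⟩ := hr.complete (wf_reach hx hx')
      obtain ⟨y', hy', hc', hr''⟩ := hr'.steps hW (wf_reach (wf_reach hx hx') hy) hc hn
      exact ⟨y', n, hy.trans hy', hc', hr'', hm'.trans hn, hnn⟩
    obtain ⟨y₁, n₁, hy₁, hc₁, hr₁, hm₁, hn₁⟩ := key x₁ h₁
    obtain ⟨y₂, n₂, hy₂, hc₂, hr₂, hm₂, hn₂⟩ := key x₂ h₂
    refine ⟨y₁, y₂, reach_step hy₁, reach_step hy₂, ?_⟩
    rw [Rep.equiv_iff (wf_reach (wf_reach hx h₁) hy₁) (wf_reach (wf_reach hx h₂) hy₂) hc₁ hc₂ hr₁ hr₂]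
    exact hu _ hW m n₁ n₂ hmn hm₁ hm₂ hn₁ hn₂

/-- One abstract transition is a nonempty concrete chain, hence the induction over the transitive
closure. -/
theorem acc_of_rep (hV : V.Finite) {x : X} (hacc : Acc (fun y x => I.nstep V x y) x) :
    I.WF x → I.complete x → ∀ m, I.Rep V x m → Acc (fun τ σ => MStep CT P V σ τ) m := by
  have hacc' := hacc.transGen
  clear hacc
  induction hacc' with
  | intro x _ ih =>
    intro hx hc m hm
    refine ⟨_, fun m' hs => ?_⟩
    obtain ⟨y, hy, hcy, hr⟩ := hm.step hV hx hc hs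
    exact ih y (transGen_swap.1 hy) (wf_reach hx hy.to_reflTransGen) hcy m' hr

/-- The hypothesis concerns derivations that avoid the variables of their own starting
configuration; `MEquiv.step` exchanges `V` for that set at each transition. -/
theorem terminating (h : ∀ x, I.WF x → Acc (fun y y' => I.nstep (I.vars x) y' y) x) :
    MTerminating CT P := by
  intro V hV σ hσ
  obtain ⟨x, m, hx, hc, hVx, hm, e⟩ := I.concretize hσ hV
  have hW := I.vars_finite x
  have hacc := acc_of_rep hW (h x hx) hx hc m (.of_abs hm)
  clear hm hσ
  induction hacc generalizing σ with
  | intro m _ ih =>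
    refine ⟨_, fun σ' hs => ?_⟩
    obtain ⟨m', hs', e'⟩ := e.symm.step hV hW hs
    exact ih m' hs' σ' e'.symm

end Impl

end Impl

/-! ### Annotated programs implement the abstract transitions. -/

section AConf

variable {L : FirstOrder.Language.{u, v}} {κ : Type w} {ν : Type z} {CT : L.Theory}

theorem holds_conj_toList {M : Type*} [L.Structure M] (a : ℕ → M) (B : Multiset (Constraint L)) :
    Holds a (conj B.toList) ↔ ∀ c ∈ B, Holds a c := by
  simp [holds_conj]

/-- A constraint that is always true and contains the given variables. -/
noncomputable def dummy (L : FirstOrder.Language.{u, v}) {V : Set ℕ} (hV : V.Finite) :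
    Constraint L :=
  conj (hV.toFinset.toList.map fun x => mkEq (Term.var x) (Term.var x))

theorem holds_dummy {M : Type*} [L.Structure M] (a : ℕ → M) {V : Set ℕ} (hV : V.Finite) :
    Holds a (dummy L hV) := by
  simp [dummy, holds_conj, holds_mkEq]

theorem subset_vars_dummy {V : Set ℕ} (hV : V.Finite) : V ⊆ (dummy L hV).vars := by
  intro x hx
  rw [dummy, vars_conj]
  exact ⟨_, List.mem_map.2 ⟨x, by simpa using hx, rfl⟩, by simp [vars_mkEq, Term.varFinset]⟩

/-- Solve all built-in constraints. -/
noncomputable def AConf.solved (σ : AConf L κ ν) : MState L κ ν where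
  store := σ.store
  bi := BuiltIn.and (conj σ.storeBI.toList) σ.bi
  tokens := σ.tokens

theorem AConf.vars_finite (σ : AConf L κ ν) : σ.vars.Finite := by
  have : σ.vars = storeVars σ.store ∪ {x | ∃ c ∈ σ.storeBI, x ∈ c.vars} ∪ σ.bi.vars := rfl
  rw [this]
  refine ((storeVars_finite _).union ?_).union (BuiltIn.vars_finite _)
  refine (conjVars_finite σ.storeBI.toList).subset ?_
  rintro x ⟨c, hc, hx⟩
  exact ⟨c, by simpa using hc, hx⟩

theorem AConf.vars_solved_subset (σ : AConf L κ ν) : σ.solved.vars ⊆ σ.vars := by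
  rintro x (hx | hx | hx)
  · exact Or.inl (Or.inl hx)
  · rw [vars_conj] at hx
    obtain ⟨c, hc, hx⟩ := hx
    exact Or.inl (Or.inr ⟨c, by simpa using hc, hx⟩)
  · exact Or.inr hx

theorem AConf.solved_bi_equivalent {σ : AConf L κ ν} (h : σ.storeBI = 0) :
    Equivalent CT σ.solved.bi σ.bi :=
  equivalent_iff.2 fun M a => by
    rw [AConf.solved, holds_and, holds_conj_toList, h]
    simp

theorem AConf.BuiltInFree.inconsistent_iff {σ : AConf L κ ν} (h : σ.BuiltInFree CT) :
    Inconsistent CT σ.solved.bi ↔ Inconsistent CT σ.bi := by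
  rcases h with h | h
  · exact ⟨fun _ => h, fun _ M a ha => h M a ha.2⟩
  · exact (AConf.solved_bi_equivalent h).inconsistent_iff

/-- Solving moves a conjunct between two places that `AConf.solved` conjoins anyway. -/
theorem ASolve.cong {σ τ : AConf L κ ν} (h : ASolve CT σ τ) : MCong CT σ.solved τ.solved := by
  obtain ⟨c, G, C', hG, hC, rfl⟩ := h
  refine ⟨rfl, equivalent_iff.2 fun M a => ?_, rfl⟩
  simp only [AConf.solved, holds_and, holds_conj_toList, hG, Multiset.mem_cons, forall_eq_or_imp,
    ← equivalent_iff.1 hC M a]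
  tauto

/-- The result of Apply'. -/
noncomputable def applyRes (r : ARule L κ ν) (σ : AConf L κ ν) (H₁ H₂ : List (IdAtom L κ))
    (G : Multiset (IdAtom L κ)) : AConf L κ ν where
  store := r.bodyChr.map (IdAtom.shift σ.counter) + ↑H₁ + G
  storeBI := ↑r.bodyBI + σ.storeBI
  bi := BuiltIn.and (conj (matchEqs ((H₁ ++ H₂).map IdAtom.chr) r.heads)) σ.bi
  tokens := σ.tokens ∪ {t' | H₂ = [] ∧ t' = ⟨r.name, (H₁ ++ H₂).map IdAtom.id⟩} ∪
    Token.shift σ.counter '' r.tokens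
  counter := σ.counter + maxId r.bodyChr r.tokens

theorem aApply_iff {P : Set (ARule L κ ν)} {V : Set ℕ} {σ τ : AConf L κ ν} (h0 : σ.storeBI = 0) :
    AApply CT P V σ τ ↔ ∃ r₀ ∈ P, ∃ ρ : Equiv.Perm ℕ, Disjoint (r₀.rename ρ).vars (V ∪ σ.vars) ∧
      ∃ H₁ H₂ G, Fire CT (r₀.rename ρ) σ.solved H₁ H₂ G ∧ τ = applyRes (r₀.rename ρ) σ H₁ H₂ G := by
  have hbi := AConf.solved_bi_equivalent (CT := CT) h0
  constructor
  · rintro ⟨r₀, hr₀, ρ, r, rfl, hdisj, H₁, H₂, G, E, t, hst, hk, hr, rfl, hent, rfl, ht, rfl⟩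
    exact ⟨r₀, hr₀, ρ, hdisj, H₁, H₂, G, ⟨hst, hk, hr, hent.mono hbi.1 (.refl _), ht⟩, rfl⟩
  · rintro ⟨r₀, hr₀, ρ, hdisj, H₁, H₂, G, ⟨hst, hk, hr, hent, ht⟩, rfl⟩
    exact ⟨r₀, hr₀, ρ, _, rfl, hdisj, H₁, H₂, G, _, _, hst, hk, hr, rfl, hent.mono hbi.2 (.refl _),
      rfl, ht, rfl⟩

theorem AConf.WF.res {σ : AConf L κ ν} (hσ : σ.WF) {r : ARule L κ ν} (hr : GoodRule r)
    {H₁ H₂ : List (IdAtom L κ)} {G : Multiset (IdAtom L κ)} (h0 : σ.storeBI = 0)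
    (hst : σ.store = ↑H₁ + ↑H₂ + G) :
    Res CT r σ.solved H₁ H₂ G (· + σ.counter) (applyRes r σ H₁ H₂ G).solved where
  inj := (add_left_injective _).injOn
  disj := fun k hk l hl hkl => by
    have := hr.pos k hk
    have := hσ.store_le l hl
    omega
  store := rfl
  bi := equivalent_iff.2 fun M a => by
    simp only [AConf.solved, applyRes, holds_and, h0, holds_conj]
    simp
  tokens := by
    ext t
    constructor
    · rintro ⟨ht, hc⟩
      refine ⟨?_, hc⟩
      rcases ht with (ht | ht) | ht
      -- Apply' does not clean, whereas `Res` does. No harm results: old tokens mention identifiers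
      -- up to the counter and the new ones lie above it, so a token alive afterwards was alive
      -- before.
      · refine Or.inl (Or.inl ⟨ht, fun i hi => ?_⟩)
        obtain ⟨k, hk, rfl⟩ := hc i hi
        have hle := hσ.token_le t ht _ hi
        simp only [AConf.solved, applyRes, Multiset.mem_add, Multiset.mem_map] at hk
        rcases hk with (⟨l, hl, rfl⟩ | hk) | hk
        · have := hr.pos l hl
          simp only [IdAtom.shift] at hle
          omega
        · exact ⟨k, by simp only [AConf.solved, hst, Multiset.mem_add]; simp [hk], rfl⟩
        · exact ⟨k, by simp only [AConf.solved, hst, Multiset.mem_add]; simp [hk], rfl⟩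
      · exact Or.inl (Or.inr ht)
      · exact Or.inr ht
    · rintro ⟨ht, hc⟩
      refine ⟨?_, hc⟩
      rcases ht with (ht | ht) | ht
      · exact Or.inl (Or.inl ht.1)
      · exact Or.inl (Or.inr ht)
      · exact Or.inr ht

theorem AConf.WF.applyRes {σ : AConf L κ ν} (hσ : σ.WF) {r : ARule L κ ν} (hr : GoodRule r)
    {H₁ H₂ : List (IdAtom L κ)} {G : Multiset (IdAtom L κ)} (hst : σ.store = ↑H₁ + ↑H₂ + G) :
    (applyRes r σ H₁ H₂ G).WF where
  nodup := by
    have hle : (↑H₁ + G : Multiset (IdAtom L κ)) ≤ σ.store := by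
      rw [hst, add_right_comm]; exact Multiset.le_add_right _ _
    simp only [CHR.applyRes, add_assoc]
    rw [Multiset.map_add, Multiset.nodup_add]
    refine ⟨?_, Multiset.nodup_of_le (Multiset.map_le_map hle) hσ.nodup, ?_⟩
    · have := Multiset.Nodup.map (add_left_injective σ.counter) hr.nodup
      rw [Multiset.map_map] at this ⊢
      exact this
    · rw [Multiset.disjoint_left]
      intro i hi hi'
      obtain ⟨k', hk', rfl⟩ := Multiset.mem_map.1 hi
      obtain ⟨k, hk, rfl⟩ := Multiset.mem_map.1 hk'
      obtain ⟨l, hl, hkl⟩ := Multiset.mem_map.1 hi'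
      have := hσ.store_le l (Multiset.mem_of_le hle hl)
      have := hr.pos k hk
      simp only [IdAtom.shift] at hkl
      omega
  store_le := by
    intro k hk
    simp only [CHR.applyRes, Multiset.mem_add, Multiset.mem_map, Multiset.mem_coe] at hk ⊢
    have hle : k ∈ σ.store → k.id ≤ σ.counter + maxId r.bodyChr r.tokens := fun h =>
      (hσ.store_le k h).trans (Nat.le_add_right _ _)
    rcases hk with (⟨l, hl, rfl⟩ | hk) | hk
    · have := hr.le_maxId hl
      simp only [IdAtom.shift]
      omega
    · exact hle (by simp [hst, hk])
    · exact hle (by simp [hst, hk])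
  token_le := by
    rintro t ((ht | ⟨-, rfl⟩) | ⟨t, ht, rfl⟩) i hi
    · exact (hσ.token_le t ht i hi).trans (Nat.le_add_right _ _)
    · obtain ⟨l, hl, rfl⟩ := List.mem_map.1 hi
      exact (hσ.store_le l (Multiset.mem_of_le (coe_append_le hst) (Multiset.mem_coe.2 hl))).trans
          (Nat.le_add_right _ _)
    · obtain ⟨j, hj, rfl⟩ := List.mem_map.1 hi
      obtain ⟨l, hl, rfl⟩ := hr.tokens t ht j hj
      have := hr.le_maxId hl
      simp only [CHR.applyRes]
      omega

theorem AApply.mStep {P : Set (ARule L κ ν)} (hP : ∀ r ∈ P, GoodRule r) {V : Set ℕ}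
    {σ τ : AConf L κ ν} (hσ : σ.WF) (hf : ¬ σ.Failed CT) (h0 : σ.storeBI = 0)
    (h : AApply CT P V σ τ) : MStep CT P V σ.solved τ.solved := by
  obtain ⟨r₀, hr₀, ρ, hdisj, H₁, H₂, G, hfire, rfl⟩ := (aApply_iff h0).1 h
  refine ⟨?_, r₀, hr₀, ρ, ?_, H₁, H₂, G, hfire, _, hσ.res ((hP r₀ hr₀).rename ρ) h0 hfire.store⟩
  · rwa [AConf.BuiltInFree.inconsistent_iff (Or.inr h0)]
  · exact hdisj.mono_right (Set.union_subset_union_right _ σ.vars_solved_subset)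

theorem AConf.Equiv.failed_iff {V : Set ℕ} {σ τ : AConf L κ ν} (h : AConf.Equiv CT V σ τ) :
    Inconsistent CT σ.bi ↔ Inconsistent CT τ.bi := by
  rcases h with ⟨h, h'⟩ | ⟨ρ, π, -, -, -, h, -⟩
  · exact ⟨fun _ => h', fun _ => h⟩
  · rw [← h.inconsistent_iff, inconsistent_subst_ren]

theorem AConf.equiv_iff {V : Set ℕ} {σ τ : AConf L κ ν} (hσ : σ.BuiltInFree CT)
    (hτ : τ.BuiltInFree CT) : AConf.Equiv CT V σ τ ↔ MEquiv CT V σ.solved τ.solved := by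
  by_cases hf : Inconsistent CT σ.bi
  · by_cases hf' : Inconsistent CT τ.bi
    · exact ⟨fun _ => Or.inl ⟨hσ.inconsistent_iff.2 hf, hτ.inconsistent_iff.2 hf'⟩,
        fun _ => Or.inl ⟨hf, hf'⟩⟩
    · refine ⟨fun h => absurd (h.failed_iff.1 hf) hf', fun h => absurd ?_ hf'⟩
      exact hτ.inconsistent_iff.1 (h.failed_iff.1 (hσ.inconsistent_iff.2 hf))
  · by_cases hf' : Inconsistent CT τ.bi
    · refine ⟨fun h => absurd (h.failed_iff.2 hf') hf, fun h => absurd ?_ hf⟩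
      exact hσ.inconsistent_iff.1 (h.failed_iff.2 (hτ.inconsistent_iff.2 hf'))
    · have h0 := hσ.resolve_left hf
      have h0' := hτ.resolve_left hf'
      have hb := AConf.solved_bi_equivalent (CT := CT) h0
      have hb' := AConf.solved_bi_equivalent (CT := CT) h0'
      constructor
      · rintro (h | ⟨ρ, π, hV, h1, -, h3, h4⟩)
        · exact absurd h.1 hf
        · refine Or.inr ⟨ρ, π, hV, h1, ?_, ?_⟩
          · exact (hb.subst_ren ρ).trans (h3.trans hb'.symm)
          · rw [MState.clean_ren]
            exact h4
      · rintro (h | ⟨ρ, π, hV, h⟩)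
        · exact absurd (hσ.inconsistent_iff.1 h.1) hf
        · refine Or.inr ⟨ρ, π, hV, h.store, ?_, ?_, ?_⟩
          · simp [h0, h0']
          · exact (hb.symm.subst_ren ρ).trans (h.bi.trans hb')
          · have := h.tokens
            rw [MState.clean_ren] at this
            exact this

/-- The configurations of an annotated program. -/
noncomputable def aConfImpl (CT : L.Theory) {P : Set (ARule L κ ν)} (hP : ∀ r ∈ P, GoodRule r) :
    Impl CT P (AConf L κ ν) where
  vars := AConf.vars
  WF := AConf.WF
  nstep := ANormalStep CT P
  step := AStep CT P
  equiv := AConf.Equiv CT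
  abs σ m := m = σ.solved
  complete := AConf.BuiltInFree CT
  size σ := σ.storeBI.card
  vars_finite := AConf.vars_finite
  wf_step := by
    rintro V σ τ hσ ⟨hf, ⟨c, G, C', hG, hC, rfl⟩ | ⟨hfree, h⟩⟩
    · exact ⟨hσ.nodup, hσ.store_le, hσ.token_le⟩
    · obtain ⟨r₀, hr₀, ρ, -, H₁, H₂, G, hfire, rfl⟩ := (aApply_iff (hfree.resolve_left hf)).1 h
      exact hσ.applyRes ((hP r₀ hr₀).rename ρ) hfire.store
  nstep_step := fun h => ⟨h.1, h.2.imp_right And.right⟩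
  nodup := by
    rintro σ _ hσ rfl
    exact hσ.nodup
  exists_abs := fun _ => ⟨_, rfl⟩
  abs_unique := by
    rintro σ _ _ - rfl rfl V
    exact .refl _ _
  sim := by
    rintro V σ τ hσ ⟨hf, h | ⟨hfree, h⟩⟩
    · exact ⟨_, _, rfl, rfl, Or.inl (h.cong.equiv V)⟩
    · exact ⟨_, _, rfl, rfl, Or.inr (h.mStep hP hσ hf (hfree.resolve_left hf))⟩
  progress := by
    intro σ V hσ hc
    simp only [AConf.BuiltInFree, not_or] at hc
    obtain ⟨c, hc0⟩ := Multiset.exists_mem_of_ne_zero hc.2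
    obtain ⟨G, hG⟩ := Multiset.exists_cons_of_mem hc0
    have hs : ASolve CT σ { σ with storeBI := G, bi := BuiltIn.and c σ.bi } :=
      ⟨c, G, _, hG, .refl _, rfl⟩
    exact ⟨_, ⟨hc.1, Or.inl hs⟩, by simp [hG], _, _, rfl, rfl, hs.cong.equiv V⟩
  sim_back := by
    rintro V σ _ m' hσ hc rfl ⟨hf, r₀, hr₀, ρ, hdisj, H₁, H₂, G, hfire, f, hres⟩
    have hf' : ¬ Inconsistent CT σ.bi := fun h => hf (hc.inconsistent_iff.2 h)
    have h0 := hc.resolve_left hf'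
    have hg := (hP r₀ hr₀).rename ρ
    refine ⟨_, _, ⟨hf', Or.inr ⟨hc, (aApply_iff h0).2 ⟨r₀, hr₀, ρ, ?_, H₁, H₂, G, hfire, rfl⟩⟩⟩,
      rfl, (hσ.res hg h0 hfire.store).unique hg.tokens hfire.store hres V⟩
    exact hdisj.mono_right Set.subset_union_left
  step_back := by
    rintro V σ τ hσ hc ⟨hf, ⟨c, G, C', hG, -⟩ | h⟩
    · rw [hc.resolve_left hf] at hG
      exact absurd hG.symm (Multiset.cons_ne_zero)
    · exact ⟨_, _, rfl, h.mStep hP hσ hf (hc.resolve_left hf)⟩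
  equiv_iff := by
    rintro V σ τ _ _ - - hσ hτ rfl rfl
    exact AConf.equiv_iff hσ hτ
  concretize := by
    intro m V hm hV
    obtain ⟨N, hN⟩ := exists_id_bound m.store
    -- The identities `x = x` in `dummy` make the variables of `V` occur without changing the
    -- meaning. Cleaning bounds the identifiers in tokens by `N`, which can serve as the counter
    -- since that is the last identifier used.
    refine ⟨⟨m.store, 0, BuiltIn.and (dummy L hV) m.bi, clean m.store m.tokens, N⟩, _,
      ⟨hm, hN, ?_⟩, Or.inr rfl, ?_, rfl, MCong.equiv ?_ V⟩
    · intro t ht i hi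
      obtain ⟨k, hk, rfl⟩ := ht.2 i hi
      exact hN k hk
    · exact (subset_vars_dummy hV).trans fun x hx => Or.inr (Or.inl hx)
    · refine ⟨rfl, equivalent_iff.2 fun M a => ?_, clean_clean _ _⟩
      simp [AConf.solved, holds_and, holds_conj, holds_dummy]

theorem aNormalConfluent_iff {P : Set (ARule L κ ν)} (hP : ∀ r ∈ P, GoodRule r)
    (ht : MTerminating CT P) : ANormalConfluent CT P ↔ MUnique CT P :=
  (aConfImpl CT hP).confluent_iff hP ht

end AConf

/-! ### CHR programs implement the abstract transitions of their annotated version. -/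

section Conf

variable {L : FirstOrder.Language.{u, v}} {κ : Type w} {ν : Type z} {CT : L.Theory}

theorem ann_bodyChr_chr (r : Rule L κ ν) : r.ann.bodyChr.map IdAtom.chr = ↑r.bodyChr := by
  simp only [Rule.ann, Multiset.map_coe]
  congr 1
  apply List.ext_getElem <;> simp

theorem ann_rename (ρ : Equiv.Perm ℕ) (r : Rule L κ ν) : r.ann.rename ρ = (r.rename ρ).ann := by
  simp only [ARule.rename, Rule.ann, Rule.rename, ARule.mk.injEq, true_and, and_true,
    Multiset.map_coe]
  congr 1
  apply List.ext_getElem <;> simp [IdAtom.subst]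

theorem ann_vars (r : Rule L κ ν) : r.ann.vars = r.vars := by
  have : storeVars r.ann.bodyChr = atomsVars r.bodyChr := by
    ext x
    have h : ∀ k, (∃ l ∈ r.ann.bodyChr, l.chr = k) ↔ k ∈ r.bodyChr := by
      intro k
      rw [← Multiset.mem_map, ann_bodyChr_chr, Multiset.mem_coe]
    constructor
    · rintro ⟨l, hl, hx⟩
      exact ⟨l.chr, (h _).1 ⟨l, hl, rfl⟩, hx⟩
    · rintro ⟨k, hk, hx⟩
      obtain ⟨l, hl, rfl⟩ := (h _).2 hk
      exact ⟨l, hl, hx⟩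
  rw [ARule.vars_eq, this]
  rfl

theorem goodRule_ann {r : Rule L κ ν} (h : r.heads ≠ []) : GoodRule r.ann where
  heads_ne := h
  nodup := by
    have : r.ann.bodyChr.map IdAtom.id = ↑((List.range r.bodyChr.length).map (· + 1)) := by
      simp only [Rule.ann, Multiset.map_coe]
      congr 1
      apply List.ext_getElem <;> simp
    rw [this, Multiset.coe_nodup]
    exact List.nodup_range.map (add_left_injective 1)
  pos := by
    intro k hk
    simp only [Rule.ann, Multiset.mem_coe, List.mem_mapIdx] at hk
    obtain ⟨i, hi, rfl⟩ := hk
    exact Nat.succ_pos i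
  tokens := fun t ht => absurd ht (Set.notMem_empty t)

theorem IsProgram.good {P : Set (Rule L κ ν)} (hP : IsProgram P) : ∀ r ∈ Ann P, GoodRule r := by
  rintro _ ⟨r, hr, rfl⟩
  exact goodRule_ann (hP.heads_ne r hr)

/-- Fresh identifiers for a multiset of CHR constraints. -/
theorem exists_identified (S : Multiset (Atom L κ)) (N : ℕ) : ∃ I : Multiset (IdAtom L κ),
    I.map IdAtom.chr = S ∧ (I.map IdAtom.id).Nodup ∧ ∀ k ∈ I, N ≤ k.id := by
  induction S using Multiset.induction_on generalizing N with
  | empty => exact ⟨0, by simp⟩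
  | cons h S ih =>
    obtain ⟨I, h1, h2, h3⟩ := ih (N + 1)
    refine ⟨⟨h, N⟩ ::ₘ I, by simp [h1], ?_, ?_⟩
    · rw [Multiset.map_cons, Multiset.nodup_cons]
      refine ⟨fun hN => ?_, h2⟩
      obtain ⟨k, hk, hkN⟩ := Multiset.mem_map.1 hN
      have := h3 k hk
      dsimp only at hkN
      omega
    · intro k hk
      rcases Multiset.mem_cons.1 hk with rfl | hk
      · exact le_rfl
      · exact (Nat.le_succ N).trans (h3 k hk)

/-- Two identifications of the same constraints differ by a renaming of identifiers. -/
theorem exists_mapId_eq (I J : Multiset (IdAtom L κ)) (hI : (I.map IdAtom.id).Nodup)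
    (h : I.map IdAtom.chr = J.map IdAtom.chr) : ∃ f : ℕ → ℕ, J = I.map (IdAtom.mapId f) := by
  classical
  induction I using Multiset.induction_on generalizing J with
  | empty =>
    rw [Multiset.map_zero, eq_comm, Multiset.map_eq_zero] at h
    exact ⟨_root_.id, by simp [h]⟩
  | cons a I ih =>
    rw [Multiset.map_cons] at h
    have ha : a.chr ∈ J.map IdAtom.chr := h ▸ Multiset.mem_cons_self _ _
    obtain ⟨b, hb, hba⟩ := Multiset.mem_map.1 ha
    obtain ⟨J, rfl⟩ := Multiset.exists_cons_of_mem hb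
    rw [Multiset.map_cons, hba, Multiset.cons_inj_right] at h
    rw [Multiset.map_cons, Multiset.nodup_cons] at hI
    obtain ⟨f, rfl⟩ := ih J hI.2 h
    refine ⟨Function.update f a.id b.id, ?_⟩
    rw [Multiset.map_cons]
    congr 1
    · simp [IdAtom.mapId, ← hba]
    · refine Multiset.map_congr rfl fun k hk => ?_
      have : k.id ≠ a.id := fun hka => hI.1 (hka ▸ Multiset.mem_map_of_mem _ hk)
      simp [IdAtom.mapId, Function.update_of_ne this]

/-- `m` is obtained from `σ` by identifying the CHR constraints of the goal by `I` and solving the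
built-in constraints of the goal. -/
structure Conf.Abs (σ : Conf L κ ν) (I : Multiset (IdAtom L κ)) (m : MState L κ ν) : Prop where
  chr : I.map IdAtom.chr = σ.goalChr
  store : m.store = σ.store + I
  nodup : m.Nodup
  bi : m.bi = BuiltIn.and (conj σ.goalBI.toList) σ.bi
  -- Cleaning is done before `I` is added, so that a dead token cannot be revived by an identifier
  -- that happens to be chosen in `I`.
  tokens : m.tokens = clean σ.store σ.tokens

theorem clean_mono {S S' : Multiset (IdAtom L κ)} (h : S ≤ S') {T : Set (Token ν)} :
    clean S T ⊆ clean S' T := fun _ ht =>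
  ⟨ht.1, fun i hi => let ⟨k, hk, hki⟩ := ht.2 i hi; ⟨k, Multiset.mem_of_le h hk, hki⟩⟩

theorem Conf.Abs.clean_eq {σ : Conf L κ ν} {I : Multiset (IdAtom L κ)} {m : MState L κ ν}
    (h : σ.Abs I m) : clean m.store m.tokens = clean σ.store σ.tokens := by
  rw [h.tokens, h.store]
  refine Set.Subset.antisymm (fun t ht => ht.1) fun t ht => ⟨ht, ?_⟩
  exact (clean_mono (Multiset.le_add_right _ _) ht).2

/-- Two numberings of the goal differ by a permutation that fixes the identifiers of the store, and
the cleaned tokens mention no others. -/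
theorem Conf.Abs.unique {σ : Conf L κ ν} {I J : Multiset (IdAtom L κ)} {m n : MState L κ ν}
    (hm : σ.Abs I m) (hn : σ.Abs J n) (V : Set ℕ) : MEquiv CT V m n := by
  classical
  have hmn := hm.nodup
  have hnn := hn.nodup
  unfold MState.Nodup at hmn hnn
  rw [hm.store, Multiset.map_add, Multiset.nodup_add] at hmn
  rw [hn.store, Multiset.map_add, Multiset.nodup_add] at hnn
  obtain ⟨f, rfl⟩ := exists_mapId_eq I J hmn.2.1 (hm.chr.trans hn.chr.symm)
  set A : Set ℕ := {i | i ∈ σ.store.map IdAtom.id}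
  set B : Set ℕ := {i | i ∈ I.map IdAtom.id}
  have hfB : ∀ i ∈ B, f i ∉ A := by
    intro i hi hi'
    obtain ⟨k, hk, rfl⟩ := Multiset.mem_map.1 hi
    exact Multiset.disjoint_left.1 hnn.2.2 hi' (Multiset.mem_map.2
      ⟨k.mapId f, Multiset.mem_map_of_mem _ hk, rfl⟩)
  have hBA : ∀ i ∈ B, i ∉ A := fun i hi hi' => Multiset.disjoint_left.1 hmn.2.2 hi' hi
  -- The map relating two numberings need not be injective by itself; it is so on the identifiers of
  -- `I` because those of its image are distinct.
  have hinj : Set.InjOn f B := by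
    have : ((I.map IdAtom.id).map f).Nodup := by
      have := hnn.2.1
      rw [Multiset.map_map] at this ⊢
      exact this
    exact fun i hi j hj hij => Multiset.inj_on_of_nodup_map this i hi j hj hij
  obtain ⟨π, hπ⟩ := exists_perm_eqOn (s := A ∪ B) (g := fun i => if i ∈ A then i else f i)
    ((Multiset.finite_toSet _).union (Multiset.finite_toSet _)) (by
      rintro i hi j hj hij
      by_cases hiA : i ∈ A <;> by_cases hjA : j ∈ A <;>
        simp only [hiA, hjA, if_true, if_false] at hij
      · exact hij
      · exact absurd (hij ▸ hiA) (hfB j (hj.resolve_left hjA))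
      · exact absurd (hij ▸ hjA) (hfB i (hi.resolve_left hiA))
      · exact hinj (hi.resolve_left hiA) (hj.resolve_left hjA) hij)
  have hπA : ∀ i ∈ A, π i = i := fun i hi => by simpa [hi] using hπ (Or.inl hi)
  have hπB : ∀ i ∈ B, π i = f i := fun i hi => by simpa [hBA i hi] using hπ (Or.inr hi)
  refine Or.inr ⟨1, π, fun _ _ => rfl, ?_, ?_, ?_⟩
  · simp only [MState.ren, hm.store, hn.store, Multiset.map_add]
    congr 1
    · conv_rhs => rw [← Multiset.map_id σ.store]
      refine Multiset.map_congr rfl fun k hk => ?_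
      simp [IdAtom.ren, Atom.subst_one, hπA k.id (Multiset.mem_map_of_mem _ hk)]
    · refine Multiset.map_congr rfl fun k hk => ?_
      simp [IdAtom.ren, IdAtom.mapId, Atom.subst_one, hπB k.id (Multiset.mem_map_of_mem _ hk)]
  · rw [hn.bi, ← hm.bi]
    simp only [MState.ren, BuiltIn.subst_one]
    exact .refl _
  · rw [MState.clean_ren, hm.clean_eq, hn.clean_eq]
    have : ∀ t ∈ clean σ.store σ.tokens, Token.map π t = t := fun t ht => by
      rw [Token.map_congr (g := _root_.id) fun i hi => hπA i (Multiset.mem_map.2 (ht.2 i hi)),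
        Token.map_id]
    rw [Set.image_congr this, Set.image_id']

theorem Conf.exists_abs {σ : Conf L κ ν} (hσ : σ.WF) : ∃ I m, σ.Abs I m := by
  obtain ⟨I, h1, h2, h3⟩ := exists_identified σ.goalChr σ.counter
  refine ⟨I, ⟨σ.store + I, _, _⟩, h1, rfl, ?_, rfl, rfl⟩
  rw [MState.Nodup, Multiset.map_add, Multiset.nodup_add, Multiset.disjoint_left]
  refine ⟨hσ.nodup, h2, fun hi hi' => ?_⟩
  obtain ⟨k, hk, rfl⟩ := Multiset.mem_map.1 hi
  obtain ⟨l, hl, hlk⟩ := Multiset.mem_map.1 hi'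
  have := hσ.store_lt k hk
  have := h3 l hl
  omega

theorem Conf.vars_finite (σ : Conf L κ ν) : σ.vars.Finite := by
  have : σ.vars = {x | ∃ h ∈ σ.goalChr, x ∈ h.vars} ∪ {x | ∃ c ∈ σ.goalBI, x ∈ c.vars} ∪
    storeVars σ.store ∪ σ.bi.vars := rfl
  rw [this]
  refine (((?_ : Set.Finite _).union ?_).union (storeVars_finite _)).union (BuiltIn.vars_finite _)
  · refine (atomsVars_finite σ.goalChr.toList).subset ?_
    rintro x ⟨c, hc, hx⟩
    exact ⟨c, by simpa using hc, hx⟩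
  · refine (conjVars_finite σ.goalBI.toList).subset ?_
    rintro x ⟨c, hc, hx⟩
    exact ⟨c, by simpa using hc, hx⟩

theorem Conf.Abs.vars_subset {σ : Conf L κ ν} {I : Multiset (IdAtom L κ)} {m : MState L κ ν}
    (h : σ.Abs I m) : m.vars ⊆ σ.vars := by
  rintro x (⟨k, hk, hx⟩ | hx)
  · rw [h.store] at hk
    rcases Multiset.mem_add.1 hk with hk | hk
    · exact Or.inl (Or.inr ⟨k, hk, hx⟩)
    · exact Or.inl (Or.inl (Or.inl ⟨k.chr, h.chr ▸ Multiset.mem_map_of_mem _ hk, hx⟩))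
  · rw [h.bi] at hx
    rcases hx with hx | hx
    · rw [vars_conj] at hx
      obtain ⟨c, hc, hx⟩ := hx
      exact Or.inl (Or.inl (Or.inr ⟨c, by simpa using hc, hx⟩))
    · exact Or.inr hx

/-- Failed, or nothing is left to introduce or to solve. -/
def Conf.Complete (CT : L.Theory) (σ : Conf L κ ν) : Prop :=
  σ.Failed CT ∨ (σ.goalChr = 0 ∧ σ.goalBI = 0)

theorem Conf.Abs.bi_equivalent {σ : Conf L κ ν} {I : Multiset (IdAtom L κ)} {m : MState L κ ν}
    (h : σ.Abs I m) (h0 : σ.goalBI = 0) : Equivalent CT m.bi σ.bi :=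
  equivalent_iff.2 fun M a => by
    rw [h.bi, holds_and, holds_conj_toList, h0]
    simp

theorem Conf.Abs.inconsistent_iff {σ : Conf L κ ν} {I : Multiset (IdAtom L κ)}
    {m : MState L κ ν} (h : σ.Abs I m) (hc : σ.BuiltInFree CT) :
    Inconsistent CT m.bi ↔ Inconsistent CT σ.bi := by
  rcases hc with hc | hc
  · refine ⟨fun _ => hc, fun _ M a ha => hc M a ?_⟩
    rw [h.bi] at ha
    exact ha.2
  · exact (h.bi_equivalent hc).inconsistent_iff

theorem Conf.Complete.builtInFree {σ : Conf L κ ν} (h : σ.Complete CT) : σ.BuiltInFree CT :=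
  h.imp_right And.right

theorem Conf.Abs.eq_zero {σ : Conf L κ ν} {I : Multiset (IdAtom L κ)} {m : MState L κ ν}
    (h : σ.Abs I m) (h0 : σ.goalChr = 0) : I = 0 := by
  rw [← Multiset.map_eq_zero (f := IdAtom.chr), h.chr, h0]

theorem Solve.abs {σ τ : Conf L κ ν} (h : Solve CT σ τ) {I : Multiset (IdAtom L κ)}
    {m : MState L κ ν} (hm : σ.Abs I m) : ∃ m', τ.Abs I m' ∧ MCong CT m m' := by
  obtain ⟨c, G, C', hG, hC, rfl⟩ := h
  refine ⟨⟨m.store, BuiltIn.and (conj G.toList) C', m.tokens⟩,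
    ⟨hm.chr, hm.store, hm.nodup, rfl, hm.tokens⟩, rfl, equivalent_iff.2 fun M a => ?_, rfl⟩
  simp only [hm.bi, holds_and, holds_conj_toList, hG, Multiset.mem_cons, forall_eq_or_imp,
    ← equivalent_iff.1 hC M a]
  tauto

theorem Introduce.wf {σ τ : Conf L κ ν} (h : Introduce σ τ) (hσ : σ.WF) : τ.WF := by
  obtain ⟨h, G, hG, rfl⟩ := h
  refine ⟨?_, fun k hk => ?_, fun t ht i hi => (hσ.token_lt t ht i hi).trans (Nat.lt_succ_self _)⟩
  · rw [Multiset.map_cons, Multiset.nodup_cons]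
    refine ⟨fun hn => ?_, hσ.nodup⟩
    obtain ⟨k, hk, hkn⟩ := Multiset.mem_map.1 hn
    exact absurd hkn (hσ.store_lt k hk).ne
  · rcases Multiset.mem_cons.1 hk with rfl | hk
    · exact Nat.lt_succ_self _
    · exact (hσ.store_lt k hk).trans (Nat.lt_succ_self _)

/-- A numbering for `τ` is extended to one for `σ` by giving the introduced constraint the
identifier it is about to receive; both configurations then have literally the same solved state. -/
theorem Introduce.abs {σ τ : Conf L κ ν} (h : Introduce σ τ) (hσ : σ.WF) :
    ∃ I J m, σ.Abs I m ∧ τ.Abs J m := by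
  obtain ⟨J, m, hm⟩ := Conf.exists_abs (h.wf hσ)
  obtain ⟨h, G, hG, rfl⟩ := h
  refine ⟨⟨h, σ.counter⟩ ::ₘ J, J, m, ⟨?_, ?_, hm.nodup, hm.bi, ?_⟩, hm⟩
  · rw [Multiset.map_cons, hm.chr, hG]
  · rw [hm.store]
    simp
  · rw [hm.tokens]
    ext t
    constructor
    · rintro ⟨ht, hc⟩
      refine ⟨ht, fun i hi => ?_⟩
      obtain ⟨k, hk, rfl⟩ := hc i hi
      rcases Multiset.mem_cons.1 hk with rfl | hk
      -- The counter occurs in no token, so introducing it as an identifier revives none.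
      · exact absurd (hσ.token_lt t ht _ hi) (lt_irrefl _)
      · exact ⟨k, hk, rfl⟩
    · exact fun ht => clean_mono (Multiset.le_cons_self _ _) ht

/-- The result of Apply. -/
def Conf.applyRes (r : Rule L κ ν) (σ : Conf L κ ν) (H₁ H₂ : List (IdAtom L κ))
    (S : Multiset (IdAtom L κ)) : Conf L κ ν where
  goalChr := ↑r.bodyChr + σ.goalChr
  goalBI := ↑r.bodyBI + σ.goalBI
  store := ↑H₁ + S
  bi := BuiltIn.and (conj (matchEqs ((H₁ ++ H₂).map IdAtom.chr) r.heads)) σ.bi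
  tokens := σ.tokens ∪ {t' | H₂ = [] ∧ t' = ⟨r.name, (H₁ ++ H₂).map IdAtom.id⟩}
  counter := σ.counter

theorem Conf.WF.applyRes {σ : Conf L κ ν} (hσ : σ.WF) (r : Rule L κ ν)
    {H₁ H₂ : List (IdAtom L κ)} {S : Multiset (IdAtom L κ)} (hst : σ.store = ↑H₁ + ↑H₂ + S) :
    (σ.applyRes r H₁ H₂ S).WF := by
  have hle : (↑H₁ + S : Multiset (IdAtom L κ)) ≤ σ.store := by
    rw [hst, add_right_comm]; exact Multiset.le_add_right _ _
  refine ⟨Multiset.nodup_of_le (Multiset.map_le_map hle) hσ.nodup,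
    fun k hk => hσ.store_lt k (Multiset.mem_of_le hle hk), ?_⟩
  rintro t (ht | ⟨-, rfl⟩) i hi
  · exact hσ.token_lt t ht i hi
  · obtain ⟨l, hl, rfl⟩ := List.mem_map.1 hi
    exact hσ.store_lt l (Multiset.mem_of_le (coe_append_le hst) (Multiset.mem_coe.2 hl))

/-- Apply puts the body into the goal, whereas the abstract transition numbers it at once. They
agree if `I` is extended by the numbers from `Rule.ann`, incremented by a bound `N` of those in use.
-/
theorem Conf.Abs.res {σ : Conf L κ ν} {I : Multiset (IdAtom L κ)} {m : MState L κ ν}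
    (hm : σ.Abs I m) {r : Rule L κ ν} (hr : r.heads ≠ [])
    {H₁ H₂ : List (IdAtom L κ)} {S : Multiset (IdAtom L κ)} (h0 : σ.goalBI = 0)
    (hst : σ.store = ↑H₁ + ↑H₂ + S) :
    ∃ J m' f, (σ.applyRes r H₁ H₂ S).Abs J m' ∧ Res CT r.ann m H₁ H₂ (S + I) f m' := by
  obtain ⟨N, hN⟩ := exists_id_bound m.store
  have hg := goodRule_ann hr
  have hres := hg.res_fireRes (CT := CT) H₁ H₂ (S + I) hN
  have hmst : m.store = ↑H₁ + ↑H₂ + (S + I) := by rw [hm.store, hst, add_assoc]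
  have hnd := hres.nodup hg.nodup hm.nodup hmst
  have hstore : (fireRes r.ann m H₁ H₂ (S + I) N).store =
      ↑H₁ + S + (r.ann.bodyChr.map (IdAtom.mapId (· + N)) + I) := by
    simp only [fireRes]
    abel
  refine ⟨r.ann.bodyChr.map (IdAtom.mapId (· + N)) + I,
    ⟨_, BuiltIn.and (conj (σ.applyRes r H₁ H₂ S).goalBI.toList) (σ.applyRes r H₁ H₂ S).bi,
      clean (σ.applyRes r H₁ H₂ S).store (σ.applyRes r H₁ H₂ S).tokens⟩, _, ⟨?_, hstore, hnd, rfl, rfl⟩,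
    hres.inj, hres.disj, rfl, equivalent_iff.2 fun M a => ?_, ?_⟩
  · rw [Multiset.map_add, hm.chr, Multiset.map_map]
    change r.ann.bodyChr.map IdAtom.chr + _ = _
    rw [ann_bodyChr_chr]
    rfl
  · simp only [Conf.applyRes, holds_and, h0, holds_conj, hm.bi]
    simp [Rule.ann, ARule.heads, Rule.heads]
  · have hle : (↑H₁ + S : Multiset (IdAtom L κ)) ≤ (fireRes r.ann m H₁ H₂ (S + I) N).store := by
      rw [hstore]; exact Multiset.le_add_right _ _
    have hle' : (↑H₁ + S : Multiset (IdAtom L κ)) ≤ σ.store := by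
      rw [hst, add_right_comm]; exact Multiset.le_add_right _ _
    have hnd' := hm.nodup
    rw [MState.Nodup, hm.store, Multiset.map_add, Multiset.nodup_add, Multiset.disjoint_left] at hnd'
    rw [hm.clean_eq]
    ext t
    constructor
    · rintro ⟨⟨ht | ht, hc⟩, hc'⟩
      · exact ⟨Or.inl (Or.inl (clean_mono hle' ⟨ht, hc⟩)), hc'⟩
      · exact ⟨Or.inl (Or.inr ht), hc'⟩
    · rintro ⟨(ht | ht) | ⟨t, ht, -⟩, hc⟩
      -- An identifier of a cleaned token belongs to the old store; it is neither a new body number,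
      -- which exceeds `N`, nor in `I`, which is disjoint from the store.
      · refine ⟨⟨Or.inl ht.1, fun i hi => ?_⟩, hc⟩
        obtain ⟨k, hk, rfl⟩ := hc i hi
        obtain ⟨l, hl, hlk⟩ := ht.2 _ hi
        rw [hstore] at hk
        rcases Multiset.mem_add.1 hk with hk | hk
        · exact ⟨k, hk, rfl⟩
        rcases Multiset.mem_add.1 hk with hk | hk
        · obtain ⟨j, hj, rfl⟩ := Multiset.mem_map.1 hk
          have h1 := hg.pos j hj
          have h2 := hN l (by rw [hm.store]; exact Multiset.mem_add.2 (Or.inl hl))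
          simp only [IdAtom.mapId] at hlk
          omega
        · exact absurd (Multiset.mem_map_of_mem IdAtom.id hk)
            (hnd'.2.2 (hlk ▸ Multiset.mem_map_of_mem IdAtom.id hl))
      · refine ⟨⟨Or.inr ht, fun i hi => ?_⟩, hc⟩
        obtain ⟨rfl, rfl⟩ := ht
        obtain ⟨k, hk, rfl⟩ := List.mem_map.1 hi
        exact ⟨k, Multiset.mem_add.2 (Or.inl (by simpa using hk)), rfl⟩
      · exact absurd ht (Set.notMem_empty t)

/-- Apply acts on introduced constraints only, so `I` stays in the context. Cleaning does not affect
the token test, because the identifiers concerned are in the store. -/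
theorem apply_iff {P : Set (Rule L κ ν)} {V : Set ℕ} {σ τ : Conf L κ ν} {m : MState L κ ν}
    {I : Multiset (IdAtom L κ)} (hm : σ.Abs I m) (h0 : σ.goalBI = 0) :
    Apply CT P V σ τ ↔ ∃ r₀ ∈ P, ∃ ρ : Equiv.Perm ℕ, Disjoint (r₀.rename ρ).vars (V ∪ σ.vars) ∧
      ∃ (H₁ H₂ : List (IdAtom L κ)) (S : Multiset (IdAtom L κ)), σ.store = ↑H₁ + ↑H₂ + S ∧
        Fire CT (r₀.rename ρ).ann m H₁ H₂ (S + I) ∧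
        τ = σ.applyRes (r₀.rename ρ) H₁ H₂ S := by
  have hbi := hm.bi_equivalent (CT := CT) h0
  constructor
  · rintro ⟨r₀, hr₀, ρ, r, rfl, hdisj, H₁, H₂, S, E, t, hst, hk, hr, rfl, hent, rfl, ht, rfl⟩
    refine ⟨r₀, hr₀, ρ, hdisj, H₁, H₂, S, hst, ⟨?_, hk, hr, hent.mono hbi.1 (.refl _), ?_⟩, rfl⟩
    · rw [hm.store, hst, add_assoc]
    · rw [hm.tokens]
      exact fun h => ht h.1
  · rintro ⟨r₀, hr₀, ρ, hdisj, H₁, H₂, S, hst, ⟨-, hk, hr, hent, ht⟩, rfl⟩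
    refine ⟨r₀, hr₀, ρ, _, rfl, hdisj, H₁, H₂, S, _, _, hst, hk, hr, rfl,
      hent.mono hbi.2 (.refl _), rfl, fun ht' => ht ?_, rfl⟩
    rw [hm.tokens]
    refine ⟨ht', fun i hi => ?_⟩
    obtain ⟨k, hk, rfl⟩ := List.mem_map.1 hi
    exact ⟨k, Multiset.mem_of_le (coe_append_le hst) (Multiset.mem_coe.2 hk), rfl⟩

theorem Apply.wf {P : Set (Rule L κ ν)} {V : Set ℕ} {σ τ : Conf L κ ν} (hσ : σ.WF)
    (h : Apply CT P V σ τ) : τ.WF := by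
  obtain ⟨r₀, hr₀, ρ, r, rfl, -, H₁, H₂, S, E, t, hst, -, -, rfl, -, rfl, -, rfl⟩ := h
  exact hσ.applyRes _ hst

theorem IsProgram.heads_rename_ne {P : Set (Rule L κ ν)} (hP : IsProgram P) {r : Rule L κ ν}
    (hr : r ∈ P) (ρ : Equiv.Perm ℕ) : (r.rename ρ).heads ≠ [] := by
  have := hP.heads_ne r hr
  simp only [Rule.heads, Rule.rename, ← List.map_append] at this ⊢
  simpa using this

theorem Apply.mStep {P : Set (Rule L κ ν)} (hP : IsProgram P) {V : Set ℕ} {σ τ : Conf L κ ν}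
    (hσ : σ.WF) (hf : ¬ σ.Failed CT) (h0 : σ.goalBI = 0) (h : Apply CT P V σ τ) :
    ∃ I J m m', σ.Abs I m ∧ τ.Abs J m' ∧ MStep CT (Ann P) V m m' := by
  obtain ⟨I, m, hm⟩ := Conf.exists_abs hσ
  obtain ⟨r₀, hr₀, ρ, hdisj, H₁, H₂, S, hst, hfire, rfl⟩ := (apply_iff hm h0).1 h
  obtain ⟨J, m', f, hm', hres⟩ := hm.res (CT := CT) (hP.heads_rename_ne hr₀ ρ) h0 hst
  refine ⟨I, J, m, m', hm, hm', ?_, r₀.ann, ⟨r₀, hr₀, rfl⟩, ρ, ?_, H₁, H₂, S + I, ?_, f, ?_⟩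
  · rwa [hm.inconsistent_iff (Or.inr h0)]
  · rw [ann_rename, ann_vars]
    exact hdisj.mono_right (Set.union_subset_union_right _ hm.vars_subset)
  · rwa [ann_rename]
  · rwa [ann_rename]

theorem Conf.Equiv.failed_iff {V : Set ℕ} {σ τ : Conf L κ ν} (h : Conf.Equiv CT V σ τ) :
    Inconsistent CT σ.bi ↔ Inconsistent CT τ.bi := by
  rcases h with ⟨h, h'⟩ | ⟨ρ, π, -, -, -, -, h, -⟩
  · exact ⟨fun _ => h', fun _ => h⟩
  · rw [← h.inconsistent_iff, inconsistent_subst_ren]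

theorem Conf.equiv_iff {V : Set ℕ} {σ τ : Conf L κ ν} (hσ : σ.Complete CT)
    (hτ : τ.Complete CT) {I J : Multiset (IdAtom L κ)} {m n : MState L κ ν} (hm : σ.Abs I m)
    (hn : τ.Abs J n) : Conf.Equiv CT V σ τ ↔ MEquiv CT V m n := by
  have em := hm.inconsistent_iff hσ.builtInFree
  have en := hn.inconsistent_iff hτ.builtInFree
  by_cases hf : Inconsistent CT σ.bi
  · by_cases hf' : Inconsistent CT τ.bi
    · exact ⟨fun _ => Or.inl ⟨em.2 hf, en.2 hf'⟩, fun _ => Or.inl ⟨hf, hf'⟩⟩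
    · exact ⟨fun h => absurd (h.failed_iff.1 hf) hf',
        fun h => absurd (en.1 (h.failed_iff.1 (em.2 hf))) hf'⟩
  · by_cases hf' : Inconsistent CT τ.bi
    · exact ⟨fun h => absurd (h.failed_iff.2 hf') hf,
        fun h => absurd (em.1 (h.failed_iff.2 (en.2 hf'))) hf⟩
    · obtain ⟨h0, h0'⟩ := hσ.resolve_left hf
      obtain ⟨k0, k0'⟩ := hτ.resolve_left hf'
      have hI := hm.eq_zero h0
      have hJ := hn.eq_zero k0
      subst hI hJ
      have hb := hm.bi_equivalent (CT := CT) h0'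
      have hb' := hn.bi_equivalent (CT := CT) k0'
      have hms : m.store = σ.store := by rw [hm.store, add_zero]
      have hns : n.store = τ.store := by rw [hn.store, add_zero]
      constructor
      · rintro (h | ⟨ρ, π, hV, -, -, h1, h3, h4⟩)
        · exact absurd h.1 hf
        · refine Or.inr ⟨ρ, π, hV, ?_, ?_, ?_⟩
          · rw [hns, ← h1, ← hms]; rfl
          · exact (hb.subst_ren ρ).trans (h3.trans hb'.symm)
          · rw [MState.clean_ren, hm.clean_eq, hn.clean_eq]
            exact h4
      · rintro (h | ⟨ρ, π, hV, h⟩)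
        · exact absurd (em.1 h.1) hf
        · refine Or.inr ⟨ρ, π, hV, ?_, ?_, ?_, ?_, ?_⟩
          · simp [h0, k0]
          · simp [h0', k0']
          · rw [← hns, ← h.store, ← hms]; rfl
          · exact (hb.symm.subst_ren ρ).trans (h.bi.trans hb')
          · have := h.tokens
            rw [MState.clean_ren, hm.clean_eq, hn.clean_eq] at this
            exact this

/-- The configurations of a CHR program. -/
noncomputable def confImpl (CT : L.Theory) {P : Set (Rule L κ ν)} (hP : IsProgram P) :
    Impl CT (Ann P) (Conf L κ ν) where
  vars := Conf.vars
  WF := Conf.WF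
  nstep := NormalStep CT P
  step := Step CT P
  equiv := Conf.Equiv CT
  abs σ m := ∃ I, σ.Abs I m
  complete := Conf.Complete CT
  size σ := σ.goalChr.card + σ.goalBI.card
  vars_finite := Conf.vars_finite
  wf_step := by
    rintro V σ τ hσ ⟨hf, ⟨c, G, C', hG, hC, rfl⟩ | h | ⟨-, h⟩⟩
    · exact ⟨hσ.nodup, hσ.store_lt, hσ.token_lt⟩
    · exact h.wf hσ
    · exact h.wf hσ
  nstep_step := fun h => ⟨h.1, h.2.imp_right (Or.imp_right And.right)⟩
  nodup := fun _ ⟨_, h⟩ => h.nodup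
  exists_abs := fun h => let ⟨I, m, hm⟩ := Conf.exists_abs h; ⟨m, I, hm⟩
  abs_unique := fun _ ⟨_, h⟩ ⟨_, h'⟩ V => h.unique h' V
  sim := by
    rintro V σ τ hσ ⟨hf, h | h | ⟨hfree, h⟩⟩
    · obtain ⟨I, m, hm⟩ := Conf.exists_abs hσ
      obtain ⟨m', hm', e⟩ := h.abs hm
      exact ⟨m, m', ⟨I, hm⟩, ⟨I, hm'⟩, Or.inl (e.equiv V)⟩
    · obtain ⟨I, J, m, hm, hm'⟩ := h.abs hσ
      exact ⟨m, m, ⟨I, hm⟩, ⟨J, hm'⟩, Or.inl (.refl _ _)⟩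
    · obtain ⟨I, J, m, m', hm, hm', hs⟩ := h.mStep hP hσ hf (hfree.resolve_left hf)
      exact ⟨m, m', ⟨I, hm⟩, ⟨J, hm'⟩, Or.inr hs⟩
  progress := by
    intro σ V hσ hc
    simp only [Conf.Complete, not_or, not_and_or] at hc
    obtain ⟨hf, hc | hc⟩ := hc
    · obtain ⟨h, hh⟩ := Multiset.exists_mem_of_ne_zero hc
      obtain ⟨G, hG⟩ := Multiset.exists_cons_of_mem hh
      have hs : Introduce σ { σ with
        goalChr := G, store := ⟨h, σ.counter⟩ ::ₘ σ.store, counter := σ.counter + 1 } :=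
        ⟨h, G, hG, rfl⟩
      obtain ⟨I, J, m, hm, hm'⟩ := hs.abs hσ
      exact ⟨_, ⟨hf, Or.inr (Or.inl hs)⟩, by simp [hG], m, m, ⟨I, hm⟩, ⟨J, hm'⟩, .refl _ _⟩
    · obtain ⟨c, hcm⟩ := Multiset.exists_mem_of_ne_zero hc
      obtain ⟨G, hG⟩ := Multiset.exists_cons_of_mem hcm
      have hs : Solve CT σ { σ with goalBI := G, bi := BuiltIn.and c σ.bi } :=
        ⟨c, G, _, hG, .refl _, rfl⟩
      obtain ⟨I, m, hm⟩ := Conf.exists_abs hσ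
      obtain ⟨m', hm', e⟩ := hs.abs hm
      exact ⟨_, ⟨hf, Or.inl hs⟩, by simp [hG], m, m', ⟨I, hm⟩, ⟨I, hm'⟩, e.equiv V⟩
  sim_back := by
    rintro V σ m m' hσ hc ⟨I, hm⟩ ⟨hf, _, ⟨r₀, hr₀, rfl⟩, ρ, hdisj, H₁, H₂, G, hfire, f, hres⟩
    rw [hm.inconsistent_iff hc.builtInFree] at hf
    obtain ⟨h0, h0'⟩ := hc.resolve_left hf
    -- Nothing is left to introduce, so whatever the abstract transition matches is in the store of
    -- `σ`.
    have hI := hm.eq_zero h0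
    subst hI
    rw [ann_rename] at hdisj hfire hres
    have hst : σ.store = ↑H₁ + ↑H₂ + G := by rw [← hfire.store, hm.store, add_zero]
    obtain ⟨J, m'', f', hm'', hres'⟩ := hm.res (CT := CT) (hP.heads_rename_ne hr₀ ρ) h0' hst
    rw [add_zero] at hres'
    refine ⟨_, m'', ⟨hf, Or.inr (Or.inr ⟨hc.builtInFree, (apply_iff hm h0').2 ⟨r₀, hr₀, ρ, ?_,
      H₁, H₂, G, hst, by rwa [add_zero], rfl⟩⟩)⟩, ⟨J, hm''⟩,
      hres'.unique (goodRule_ann (hP.heads_rename_ne hr₀ ρ)).tokens hfire.store hres V⟩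
    rw [ann_vars] at hdisj
    exact hdisj.mono_right Set.subset_union_left
  step_back := by
    rintro V σ τ hσ hc ⟨hf, ⟨c, G, C', hG, -⟩ | ⟨h, G, hG, -⟩ | h⟩
    · rw [(hc.resolve_left hf).2] at hG
      exact absurd hG.symm Multiset.cons_ne_zero
    · rw [(hc.resolve_left hf).1] at hG
      exact absurd hG.symm Multiset.cons_ne_zero
    · obtain ⟨I, J, m, m', hm, hm', hs⟩ := h.mStep hP hσ hf (hc.resolve_left hf).2
      exact ⟨m, m', ⟨I, hm⟩, hs⟩
  equiv_iff := fun _ _ hσ hτ ⟨_, hm⟩ ⟨_, hn⟩ => Conf.equiv_iff hσ hτ hm hn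
  concretize := by
    intro m V hm hV
    obtain ⟨N, hN⟩ := exists_id_bound m.store
    -- Here the counter is the next free identifier, hence `N + 1`.
    refine ⟨⟨0, 0, m.store, BuiltIn.and (dummy L hV) m.bi, clean m.store m.tokens, N + 1⟩,
      ⟨m.store, BuiltIn.and (conj (0 : Multiset _).toList) (BuiltIn.and (dummy L hV) m.bi),
        clean m.store (clean m.store m.tokens)⟩, ⟨hm, fun k hk => Nat.lt_succ_of_le (hN k hk), ?_⟩, Or.inr ⟨rfl, rfl⟩, ?_,
      ⟨0, rfl, (add_zero _).symm, hm, rfl, rfl⟩, MCong.equiv ?_ V⟩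
    · intro t ht i hi
      obtain ⟨k, hk, rfl⟩ := ht.2 i hi
      exact Nat.lt_succ_of_le (hN k hk)
    · exact (subset_vars_dummy hV).trans fun x hx => Or.inr (Or.inl hx)
    · refine ⟨rfl, equivalent_iff.2 fun M a => ?_, ?_⟩
      · simp [holds_and, holds_conj, holds_dummy]
      · simp only [clean_clean]

theorem normalConfluent_iff {P : Set (Rule L κ ν)} (hP : IsProgram P)
    (ht : MTerminating CT (Ann P)) : NormalConfluent CT P ↔ MUnique CT (Ann P) :=
  (confImpl CT hP).confluent_iff hP.good ht

/-- A configuration that is not accessible starts an infinite normal computation, by dependent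
choice. -/
theorem NormalTerminating.mTerminating {P : Set (Rule L κ ν)} (hP : IsProgram P)
    (ht : NormalTerminating CT P) : MTerminating CT (Ann P) := by
  refine (confImpl CT hP).terminating fun σ hσ => ?_
  by_contra hacc
  obtain ⟨f, h0, hf⟩ := not_acc_iff_exists_descending_chain.1 hacc
  exact ht ⟨f, h0 ▸ hσ, fun i => h0 ▸ hf i⟩

end Conf

end CHR

/-- Let `P` be a normal terminating CHR program and `Q 0, …, Q n` a U-sequence starting from
`Ann(P)`. Then `P` is normal confluent if and only if `Q n` is. -/
theorem mainTheorem8 {L : FirstOrder.Language.{u, v}} {κ : Type w} {ν : Type z}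
    (CT : L.Theory) (hCT : CHR.ClarkEquality CT)
    (P : Set (CHR.Rule L κ ν)) (hP : CHR.IsProgram P) (hterm : CHR.NormalTerminating CT P)
    (n : ℕ) (Q : Fin (n + 1) → Set (CHR.ARule L κ ν))
    (hQ : CHR.IsUSequence CT (CHR.Ann P) n Q) :
    CHR.NormalConfluent CT P ↔ CHR.ANormalConfluent CT (Q (Fin.last n)) := by
  have ht := hterm.mTerminating hP
  obtain ⟨hg, htn, hu⟩ := hQ.unique_iff hCT hP.good ht (Fin.last n)
  rw [CHR.normalConfluent_iff hP ht, hu, CHR.aNormalConfluent_iff hg htn]
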